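/- For a finite simple graph $G$, let $$\mathrm{vi}(G)=\min_{S\subseteq V(G)}\Bigl(|S|+\max_{D\in \mathrm{cc}(G-S)}|D|\Bigr),$$ where $\mathrm{cc}(G-S)$ is the set of connected components of $G-S$ (the maximum is $0$ if $S=V(G)$). For a finite connected graph $G$, let $\mathrm{ml}(G)$ be the maximum number of leaves (vertices of degree $1$) of a spanning tree of $G$. Unweighted Vertex Integrity can be solved in time $2^{O(\mathrm{ml})}n^{O(1)}$. That is, there are a single algorithm and constants $C,c,d\in\mathbb{N}$ such that, for every $n$, every connected graph $G$ on the vertices $0,\dots,n-1$ and every integer $k$, the algorithm, given $(G,k)$, halts after at most $C\cdot 2^{c\cdot \mathrm{ml}(G)}\cdot n^{d}$ steps and answers correctly whether $\mathrm{vi}(G)\le k$. Here an algorithm is a program for a unit-cost random access machine whose memory consists of registers and arrays of natural numbers (with indirect addressing), whose arithmetic operations are addition and truncated subtraction, and whose programs are built by sequencing, branching and while-loops; $G$ is given by its adjacency matrix and $n$, $k$ are given in registers ($k$ by its positive and its negative part). The parameter $\mathrm{ml}(G)$ is not part of the input. -/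

import Mathlib

namespace VertexIntegrity

/-! ### Graph parameters -/

section Graphs

variable {V : Type*}

/-- The largest number of vertices of a connected component of `G - S`
(it is `0` if `G - S` has no vertices, the supremum of the empty family in `ℕ` being `0`). -/
noncomputable def maxComponentSize (G : SimpleGraph V) (S : Finset V) : ℕ :=
  ⨆ D : (G.induce {v | v ∉ S}).ConnectedComponent, D.supp.ncard

/-- The vertex integrity `vi(G) = min_S (|S| + max_{D ∈ cc(G - S)} |D|)`
of a (finite, unweighted) graph. -/
noncomputable def vi (G : SimpleGraph V) : ℕ :=
  ⨅ S : Finset V, (S.card + maxComponentSize G S)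

/-- The number of leaves (vertices of degree `1`) of `T`. -/
noncomputable def numLeaves (T : SimpleGraph V) : ℕ :=
  {v : V | (T.neighborSet v).ncard = 1}.ncard

/-- The max-leaf number of a (finite, connected) graph: the maximum number of leaves of a spanning
tree. Spanning trees are the trees on the same vertex set all of whose edges are edges of `G`. -/
noncomputable def maxLeaf (G : SimpleGraph V) : ℕ :=
  sSup {m : ℕ | ∃ T : SimpleGraph V, T ≤ G ∧ T.IsTree ∧ numLeaves T = m}

end Graphs

/-! ### The machine model

A random access machine with unit costs, programmed by structured programs. The memory consists of
scalar registers and of arrays (one-dimensional, infinite), all holding natural numbers; arrays can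
be addressed indirectly. A program is a finite object and so names only finitely many registers and
arrays. The arithmetic operations are addition and truncated subtraction (no multiplication), so
that numbers gain at most one bit per operation, and unit costs are polynomially
related to the running time of Turing machines. -/

/-- The memory: `reg x` is the content of register `x`, and `arr a i` is entry `i` of array `a`. -/
structure Store where
  reg : ℕ → ℕ
  arr : ℕ → ℕ → ℕ

/-- Store `v` in register `x`. -/
def Store.setReg (s : Store) (x v : ℕ) : Store :=
  { s with reg := Function.update s.reg x v }

/-- Store `v` in entry `i` of array `a`. -/
def Store.setArr (s : Store) (a i v : ℕ) : Store :=
  { s with arr := Function.update s.arr a (Function.update (s.arr a) i v) }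

/-- Arithmetic expressions: constants, registers, array look-up, sum, truncated difference. -/
inductive Expr where
  | const (c : ℕ)
  | reg (x : ℕ)
  | get (a : ℕ) (i : Expr)
  | add (e f : Expr)
  | sub (e f : Expr)

/-- The value of an expression. -/
def Expr.eval (s : Store) : Expr → ℕ
  | const c => c
  | reg x => s.reg x
  | get a i => s.arr a (i.eval s)
  | add e f => e.eval s + f.eval s
  | sub e f => e.eval s - f.eval s

/-- The cost of evaluating an expression: one unit per constant, register access, array access and
arithmetic operation. -/
def Expr.cost : Expr → ℕ
  | const _ => 1
  | reg _ => 1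
  | get _ i => i.cost + 1
  | add e f => e.cost + f.cost + 1
  | sub e f => e.cost + f.cost + 1

/-- Programs. In `ite` and `loop` the test `e` is passed if the value of `e` is not `0`. -/
inductive Prog where
  | skip
  | assign (x : ℕ) (e : Expr)
  | put (a : ℕ) (i e : Expr)
  | seq (p q : Prog)
  | ite (e : Expr) (p q : Prog)
  | loop (e : Expr) (p : Prog)

/-- `Exec p s t s'`: started in memory `s`, the program `p` halts after exactly `t` steps, in memory
`s'`. Each elementary instruction and each test costs one step plus the cost of the expressions
that are evaluated in it. -/
inductive Exec : Prog → Store → ℕ → Store → Prop where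
  | skip (s : Store) : Exec .skip s 1 s
  | assign (s : Store) (x : ℕ) (e : Expr) :
      Exec (.assign x e) s (e.cost + 1) (s.setReg x (e.eval s))
  | put (s : Store) (a : ℕ) (i e : Expr) :
      Exec (.put a i e) s (i.cost + e.cost + 1) (s.setArr a (i.eval s) (e.eval s))
  | seq {p q : Prog} {s s₁ s₂ : Store} {t₁ t₂ : ℕ} :
      Exec p s t₁ s₁ → Exec q s₁ t₂ s₂ → Exec (.seq p q) s (t₁ + t₂) s₂
  | ite_pos {e : Expr} {p q : Prog} {s s' : Store} {t : ℕ} :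
      e.eval s ≠ 0 → Exec p s t s' → Exec (.ite e p q) s (e.cost + 1 + t) s'
  | ite_neg {e : Expr} {p q : Prog} {s s' : Store} {t : ℕ} :
      e.eval s = 0 → Exec q s t s' → Exec (.ite e p q) s (e.cost + 1 + t) s'
  | loop_stop {e : Expr} {p : Prog} {s : Store} :
      e.eval s = 0 → Exec (.loop e p) s (e.cost + 1) s
  | loop_step {e : Expr} {p : Prog} {s s₁ s₂ : Store} {t₁ t₂ : ℕ} :
      e.eval s ≠ 0 → Exec p s t₁ s₁ → Exec (.loop e p) s₁ t₂ s₂ →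
      Exec (.loop e p) s (e.cost + 1 + t₁ + t₂) s₂

/-- Programs are deterministic: running time and final memory are determined by the start. -/
theorem Exec.deterministic {p : Prog} {s s₁ s₂ : Store} {t₁ t₂ : ℕ}
    (h₁ : Exec p s t₁ s₁) (h₂ : Exec p s t₂ s₂) : t₁ = t₂ ∧ s₁ = s₂ := by
  induction h₁ generalizing t₂ s₂ with
  | skip s => cases h₂; exact ⟨rfl, rfl⟩
  | assign s x e => cases h₂; exact ⟨rfl, rfl⟩
  | put s a i e => cases h₂; exact ⟨rfl, rfl⟩
  | seq _ _ ih₁ ih₂ =>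
    cases h₂ with
    | seq a b =>
      obtain ⟨rfl, rfl⟩ := ih₁ a
      obtain ⟨rfl, rfl⟩ := ih₂ b
      exact ⟨rfl, rfl⟩
  | ite_pos h _ ih =>
    cases h₂ with
    | ite_pos h' a => obtain ⟨rfl, rfl⟩ := ih a; exact ⟨rfl, rfl⟩
    | ite_neg h' a => exact absurd h' h
  | ite_neg h _ ih =>
    cases h₂ with
    | ite_pos h' a => exact absurd h h'
    | ite_neg h' a => obtain ⟨rfl, rfl⟩ := ih a; exact ⟨rfl, rfl⟩
  | loop_stop h =>
    cases h₂ with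
    | loop_stop h' => exact ⟨rfl, rfl⟩
    | loop_step h' a b => exact absurd h h'
  | loop_step h _ _ ih₁ ih₂ =>
    cases h₂ with
    | loop_stop h' => exact absurd h' h
    | loop_step h' a b =>
      obtain ⟨rfl, rfl⟩ := ih₁ a
      obtain ⟨rfl, rfl⟩ := ih₂ b
      exact ⟨rfl, rfl⟩

open Classical in
/-- The initial memory for the instance `(G, k)`, where `G` is a graph on the vertices
`0, …, n - 1` and `k` is an integer. Register `0` holds `n`, registers `1` and `2` hold the positive
part and the negative part of `k`, array `0` holds the adjacency matrix of `G` row by row, and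
everything else is `0`. -/
noncomputable def inputStore {n : ℕ} (G : SimpleGraph (Fin n)) (k : ℤ) : Store where
  reg x := if x = 0 then n else if x = 1 then k.toNat else if x = 2 then (-k).toNat else 0
  arr a m := if a = 0 ∧ ∃ i j : Fin n, m = i * n + j ∧ G.Adj i j then 1 else 0

/-- On the instance `(G, k)` the program `p` halts after at most `T` steps, and register `0` then
holds the correct answer to the question whether `vi(G) ≤ k`: `1` for yes and `0` for no. -/
def DecidesWithin (p : Prog) {n : ℕ} (G : SimpleGraph (Fin n)) (k : ℤ) (T : ℕ) : Prop :=
  ∃ (t : ℕ) (s : Store), Exec p (inputStore G k) t s ∧ t ≤ T ∧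
    s.reg 0 = if (vi G : ℤ) ≤ k then 1 else 0

end VertexIntegrity

/-! Let `B` consist of the vertices of degree other than two and the vertex `0`, which makes `B`
nonempty even if `G` is a cycle. Following vertices of degree two shows that the components of `G -
B` are paths whose ends are attached to `B` (`exists_isPathSystem`). An exchange argument in a
spanning tree with the maximum number `ml` of leaves bounds the size of `B` plus the number of paths
by `20 * ml + 3` (`card_branch_le`, `card_special_le`).

A set `S` that leaves only components of at most `l` vertices meets a path with `p` vertices at
least `p / (l + 1)` times, and `p / (l + 1) + 2` deletions are always enough (`hitCount_bounds`). Up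
to the positions on the paths, `S` is therefore described by `l`, by `X = S ∩ B`, and by a number in
`{0, 1, 2}` for each path. Such a guess is written as a number in base 4, with one digit for each
vertex of `B` and each path.

It remains to decide whether a guess can be realised. On a path with `q ≥ 1` deletions, the `q - 1`
inner gaps and one piece for each end in `X` take up to `l` vertices each. The others, `rest` in
number, stay connected to components of the kept part, which consists of `B \ X` and the untouched
paths; such a component has room for `l` minus its size. By Hall's theorem the remainders can be
distributed iff for every union `F` of kept components the size of `F`, plus the remainders of the
paths that have no end in `B \ X` outside `F`, is at most `l` times the number of components in `F`.
`exists_distribution` and `exists_deletion` show that this suffices, `hallCondition_of_small` that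
it is necessary. Since `F` is determined by a second guess of the same kind, `vi_le_iff_guess`
decides `vi G ≤ k` by two nested searches.

The criterion is written as a term of a small language of bounded iteration, whose loops are bounded
by `n` or by the number `E` of guesses. `Tm.evaluates` compiles every such term to a program with
running time polynomial in these bounds. The parameter `ml` enters only the estimate of the time:
the program finds `E` by counting labels. -/

namespace VertexIntegrity

/-! ### A language of terms with bounded iteration -/

/-- Terms denoting natural numbers. Variables are registers; the binders of a term at level `m`
bind the registers `m`, `m + 1`. `iter y t b` iterates `b` as often as register `y` says, starting
with `t`; `tab y t₀ t b` evaluates `b` after making a table with initial entries `t₀`, all of whose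
entries are simultaneously replaced by `t` as often as register `y` says. -/
inductive Tm where
  | lit (c : ℕ)
  | var (x : ℕ)
  | get (a : ℕ) (i : Tm)
  | add (t u : Tm)
  | sub (t u : Tm)
  | cond (c t u : Tm)
  | bind (t b : Tm)
  | iter (y : ℕ) (t b : Tm)
  | tab (y : ℕ) (t₀ t b : Tm)

/-- Replace an array. -/
def Store.setTab (s : Store) (a : ℕ) (c : ℕ → ℕ) : Store :=
  { s with arr := Function.update s.arr a c }

/-- The table of length `n` with entries `f`. -/
def table (n : ℕ) (f : ℕ → ℕ) (i : ℕ) : ℕ := if i < n then f i else 0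

/-- The value of a term whose binders use the registers from `m` and the arrays from `A` on. -/
def Tm.eval : Tm → ℕ → ℕ → Store → ℕ
  | lit c, _, _, _ => c
  | var x, _, _, s => s.reg x
  | get a i, m, A, s => s.arr a (i.eval m A s)
  | add t u, m, A, s => t.eval m A s + u.eval m A s
  | sub t u, m, A, s => t.eval m A s - u.eval m A s
  | cond c t u, m, A, s => if c.eval m A s ≠ 0 then t.eval m A s else u.eval m A s
  | bind t b, m, A, s => b.eval (m + 1) A (s.setReg m (t.eval m A s))
  | iter y t b, m, A, s =>
      Nat.rec (t.eval m A s)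
        (fun i acc => b.eval (m + 2) A ((s.setReg m acc).setReg (m + 1) i)) (s.reg y)
  | tab y t₀ t b, m, A, s =>
      b.eval m (A + 2) (s.setTab A (Nat.rec
        (table (s.reg 0) fun i => t₀.eval (m + 1) (A + 2) (s.setReg m i))
        (fun j c => table (s.reg 0) fun i =>
          t.eval (m + 2) (A + 2) (((s.setReg m j).setReg (m + 1) i).setTab A c)) (s.reg y)))

/-- A term is well-formed at level `m`, `A` if it uses only variables below `m`, the arrays in `P`
and the loop bounds in `L`. -/
def Tm.wf (L : List ℕ) : Tm → ℕ → ℕ → List ℕ → Bool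
  | lit _, _, _, _ => true
  | var x, m, _, _ => decide (x < m)
  | get a i, m, A, P => P.contains a && i.wf L m A P
  | add t u, m, A, P => t.wf L m A P && u.wf L m A P
  | sub t u, m, A, P => t.wf L m A P && u.wf L m A P
  | cond c t u, m, A, P => c.wf L m A P && (t.wf L m A P && u.wf L m A P)
  | bind t b, m, A, P => t.wf L m A P && b.wf L (m + 1) A P
  | iter y t b, m, A, P => L.contains y && (t.wf L m A P && b.wf L (m + 2) A P)
  | tab y t₀ t b, m, A, P => L.contains y && (t₀.wf L (m + 1) (A + 2) P &&
      (t.wf L (m + 2) (A + 2) (A :: P) && b.wf L m (A + 2) (A :: P)))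

/-- The program that fills the array `a` with the values computed by the program `p`, which finds
the index in register `m` and leaves its result in entry `d` of array `1`. -/
def fillProg (a m d : ℕ) (p : Prog) : Prog :=
  .seq (.assign m (.const 0)) (.loop (.sub (.reg 0) (.reg m))
    (.seq p (.seq (.put a (.reg m) (.get 1 (.const d))) (.assign m (.add (.reg m) (.const 1))))))

/-- The program that evaluates a term and leaves the value in entry `d` of array `1`. -/
def Tm.comp : Tm → ℕ → ℕ → ℕ → Prog
  | lit c, _, _, d => .put 1 (.const d) (.const c)
  | var x, _, _, d => .put 1 (.const d) (.reg x)
  | get a i, m, A, d => .seq (i.comp m A d) (.put 1 (.const d) (.get a (.get 1 (.const d))))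
  | add t u, m, A, d => .seq (t.comp m A d) (.seq (u.comp m A (d + 1))
      (.put 1 (.const d) (.add (.get 1 (.const d)) (.get 1 (.const (d + 1))))))
  | sub t u, m, A, d => .seq (t.comp m A d) (.seq (u.comp m A (d + 1))
      (.put 1 (.const d) (.sub (.get 1 (.const d)) (.get 1 (.const (d + 1))))))
  | cond c t u, m, A, d =>
      .seq (c.comp m A d) (.ite (.get 1 (.const d)) (t.comp m A d) (u.comp m A d))
  | bind t b, m, A, d =>
      .seq (t.comp m A d) (.seq (.assign m (.get 1 (.const d))) (b.comp (m + 1) A d))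
  | iter y t b, m, A, d =>
      .seq (t.comp m A d) (.seq (.assign m (.get 1 (.const d))) (.seq (.assign (m + 1) (.const 0))
        (.seq (.loop (.sub (.reg y) (.reg (m + 1)))
          (.seq (b.comp (m + 2) A d) (.seq (.assign m (.get 1 (.const d)))
            (.assign (m + 1) (.add (.reg (m + 1)) (.const 1))))))
          (.put 1 (.const d) (.reg m)))))
  | tab y t₀ t b, m, A, d =>
      .seq (fillProg A m d (t₀.comp (m + 1) (A + 2) d)) (.seq (.assign m (.const 0))
        (.seq (.loop (.sub (.reg y) (.reg m))
          (.seq (fillProg (A + 1) (m + 1) d (t.comp (m + 2) (A + 2) d))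
            (.seq (fillProg A (m + 1) d
              (.put 1 (.const d) (.get (A + 1) (.reg (m + 1)))))
              (.assign m (.add (.reg m) (.const 1))))))
          (b.comp m (A + 2) d)))

/-- Agreement of two memories on the registers below `m` and the arrays in `P`. -/
structure Agree (m : ℕ) (P : List ℕ) (s s' : Store) : Prop where
  reg : ∀ x < m, s.reg x = s'.reg x
  arr : ∀ a ∈ P, s.arr a = s'.arr a

@[simp] theorem Store.setReg_reg (s : Store) (x v : ℕ) :
    (s.setReg x v).reg = Function.update s.reg x v := rfl
@[simp] theorem Store.setReg_arr (s : Store) (x v : ℕ) : (s.setReg x v).arr = s.arr := rfl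
@[simp] theorem Store.setTab_reg (s : Store) (a : ℕ) (c : ℕ → ℕ) : (s.setTab a c).reg = s.reg := rfl
@[simp] theorem Store.setTab_arr (s : Store) (a : ℕ) (c : ℕ → ℕ) :
    (s.setTab a c).arr = Function.update s.arr a c := rfl
@[simp] theorem Store.setArr_reg (s : Store) (a i v : ℕ) : (s.setArr a i v).reg = s.reg := rfl
@[simp] theorem Store.setArr_arr (s : Store) (a i v : ℕ) :
    (s.setArr a i v).arr = Function.update s.arr a (Function.update (s.arr a) i v) := rfl

theorem Agree.setReg {m : ℕ} {P : List ℕ} {s s' : Store} (h : Agree m P s s') (v : ℕ) :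
    Agree (m + 1) P (s.setReg m v) (s'.setReg m v) := by
  refine ⟨fun x hx => ?_, fun a ha => h.arr a ha⟩
  rcases eq_or_ne x m with rfl | hne
  · simp
  · simpa [hne] using h.reg x (by omega)

theorem Agree.setTab {m A : ℕ} {P : List ℕ} {s s' : Store} (h : Agree m P s s') (c : ℕ → ℕ) :
    Agree m (A :: P) (s.setTab A c) (s'.setTab A c) := by
  refine ⟨fun x hx => h.reg x hx, fun a ha => ?_⟩
  rcases eq_or_ne a A with rfl | hne
  · simp
  · have : a ∈ P := by simpa [hne] using ha
    simpa [hne] using h.arr a this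

/-- The value of a well-formed term depends only on what it may use. -/
theorem Tm.eval_congr {L : List ℕ} (t : Tm) : ∀ {m A : ℕ} {P : List ℕ} {s s' : Store},
    t.wf L m A P → 0 < m → (∀ y ∈ L, y < m) → Agree m P s s' → t.eval m A s = t.eval m A s' := by
  induction t with
  | lit c => intros; rfl
  | var x => intro m A P s s' h _ _ hs; exact hs.reg x (by simpa [wf] using h)
  | get a i ih =>
    intro m A P s s' h h0 hL hs
    simp only [wf, Bool.and_eq_true, List.contains_iff_mem] at h
    simp only [eval, ih h.2 h0 hL hs, hs.arr a h.1]
  | add t u iht ihu =>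
    intro m A P s s' h h0 hL hs
    simp only [wf, Bool.and_eq_true] at h
    simp only [eval, iht h.1 h0 hL hs, ihu h.2 h0 hL hs]
  | sub t u iht ihu =>
    intro m A P s s' h h0 hL hs
    simp only [wf, Bool.and_eq_true] at h
    simp only [eval, iht h.1 h0 hL hs, ihu h.2 h0 hL hs]
  | cond c t u ihc iht ihu =>
    intro m A P s s' h h0 hL hs
    simp only [wf, Bool.and_eq_true] at h
    simp only [eval, ihc h.1 h0 hL hs, iht h.2.1 h0 hL hs, ihu h.2.2 h0 hL hs]
  | bind t b iht ihb =>
    intro m A P s s' h h0 hL hs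
    simp only [wf, Bool.and_eq_true] at h
    simp only [eval, iht h.1 h0 hL hs]
    exact ihb h.2 (by omega) (fun y hy => (hL y hy).trans (by omega)) (hs.setReg _)
  | iter y t b iht ihb =>
    intro m A P s s' h h0 hL hs
    simp only [wf, Bool.and_eq_true, List.contains_iff_mem] at h
    simp only [eval, iht h.2.1 h0 hL hs, hs.reg y (hL y h.1)]
    congr 1
    funext i acc
    exact ihb h.2.2 (by omega) (fun y hy => (hL y hy).trans (by omega)) ((hs.setReg _).setReg _)
  | tab y t₀ t b ih₀ iht ihb =>
    intro m A P s s' h h0 hL hs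
    simp only [wf, Bool.and_eq_true, List.contains_iff_mem] at h
    have e₀ : ∀ i, t₀.eval (m + 1) (A + 2) (s.setReg m i) =
        t₀.eval (m + 1) (A + 2) (s'.setReg m i) := fun i =>
      ih₀ h.2.1 (by omega) (fun y hy => (hL y hy).trans (by omega)) (hs.setReg _)
    have e : ∀ j c i, t.eval (m + 2) (A + 2) (((s.setReg m j).setReg (m + 1) i).setTab A c) =
        t.eval (m + 2) (A + 2) (((s'.setReg m j).setReg (m + 1) i).setTab A c) := fun j c i =>
      iht h.2.2.1 (by omega) (fun y hy => (hL y hy).trans (by omega))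
        (((hs.setReg _).setReg _).setTab _)
    simp only [eval, e₀, e, hs.reg y (hL y h.1), hs.reg 0 h0]
    exact ihb h.2.2.2 h0 hL (hs.setTab _)

/-! ### Correctness of the compilation -/

/-- What a program at level `m`, `A`, `d` leaves untouched. -/
structure Keep (m A d : ℕ) (s s' : Store) : Prop where
  reg : ∀ x < m, s'.reg x = s.reg x
  stack : ∀ j < d, s'.arr 1 j = s.arr 1 j
  arr : ∀ a, a ≠ 1 → a < A → s'.arr a = s.arr a
  clean : (∀ a, 2 ≤ a → ∀ i, s.reg 0 ≤ i → s.arr a i = 0) →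
    ∀ a, 2 ≤ a → ∀ i, s.reg 0 ≤ i → s'.arr a i = 0

theorem Keep.trans {m A d : ℕ} {s s' s'' : Store} (h0 : 0 < m) (h : Keep m A d s s')
    (h' : Keep m A d s' s'') : Keep m A d s s'' :=
  ⟨fun x hx => (h'.reg x hx).trans (h.reg x hx), fun x hx => (h'.stack x hx).trans (h.stack x hx),
    fun a ha ha' => (h'.arr a ha ha').trans (h.arr a ha ha'), fun hc => by
      have := h'.clean
      rw [h.reg 0 h0] at this
      exact this (h.clean hc)⟩

theorem Keep.mono {m A d m' A' d' : ℕ} {s s' : Store} (h : Keep m A d s s') (hm : m' ≤ m)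
    (hA : A' ≤ A) (hd : d' ≤ d) : Keep m' A' d' s s' :=
  ⟨fun x hx => h.reg x (by omega), fun x hx => h.stack x (by omega),
    fun a ha ha' => h.arr a ha (by omega), h.clean⟩

theorem Keep.setReg (m A d : ℕ) (s : Store) {x : ℕ} (hx : m ≤ x) (v : ℕ) :
    Keep m A d s (s.setReg x v) :=
  ⟨fun y hy => by simp [show y ≠ x by omega], fun _ _ => rfl, fun _ _ _ => rfl, fun h => h⟩

theorem Keep.push (m A d : ℕ) (s : Store) (v : ℕ) : Keep m A d s (s.setArr 1 d v) :=
  ⟨fun y hy => rfl, fun j hj => by simp [show j ≠ d by omega], fun a ha _ => by simp [ha],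
    fun h a ha => by simpa [show a ≠ 1 by omega] using h a ha⟩

theorem Keep.put (m A d : ℕ) (s : Store) {a i : ℕ} (ha : 2 ≤ a) (hA : A ≤ a) (hi : i < s.reg 0)
    (v : ℕ) : Keep m A d s (s.setArr a i v) := by
  refine ⟨fun y hy => rfl, fun j hj => by simp [show 1 ≠ a by omega],
    fun b hb hb' => by simp [show b ≠ a by omega], fun h b hb j hj => ?_⟩
  rcases eq_or_ne b a with rfl | hne
  · simpa [show j ≠ i by omega] using h b hb j hj
  · simpa [hne] using h b hb j hj

theorem Keep.agree {m A d : ℕ} {P : List ℕ} {s s' : Store} (h : Keep m A d s s')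
    (hP : ∀ a ∈ P, a ≠ 1 ∧ a < A) : Agree m P s s' :=
  ⟨fun x hx => (h.reg x hx).symm, fun a ha => (h.arr a (hP a ha).1 (hP a ha).2).symm⟩

/-- A counting loop. -/
theorem exec_count {y x N τ : ℕ} {p : Prog} (I : ℕ → Store → Prop)
    (hI : ∀ i s, I i s → s.reg y = N ∧ s.reg x = i)
    (hp : ∀ i s, i < N → I i s → ∃ t s', Exec p s t s' ∧ t ≤ τ ∧ I (i + 1) s')
    {s : Store} (hs : I 0 s) :
    ∃ t s', Exec (.loop (.sub (.reg y) (.reg x)) p) s t s' ∧ t ≤ N * (τ + 4) + 4 ∧ I N s' := by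
  suffices H : ∀ k i s, i + k = N → I i s → ∃ t s',
      Exec (.loop (.sub (.reg y) (.reg x)) p) s t s' ∧ t ≤ k * (τ + 4) + 4 ∧ I N s' from
    H N 0 s (by omega) hs
  intro k
  induction k with
  | zero =>
    intro i s hi h
    obtain rfl : i = N := by omega
    obtain ⟨h1, h2⟩ := hI _ _ h
    exact ⟨_, s, Exec.loop_stop (by simp [Expr.eval, h1, h2]), by simp [Expr.cost], h⟩
  | succ k ih =>
    intro i s hi h
    obtain ⟨h1, h2⟩ := hI _ _ h
    obtain ⟨t₁, s₁, e₁, ht₁, hI₁⟩ := hp i s (by omega) h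
    obtain ⟨t₂, s₂, e₂, ht₂, hI₂⟩ := ih (i + 1) s₁ (by omega) hI₁
    refine ⟨_, s₂, Exec.loop_step (by simp only [Expr.eval, h1, h2]; omega) e₁ e₂, ?_, hI₂⟩
    simp only [Expr.cost, Nat.succ_mul]
    omega

/-- Filling a table. -/
theorem exec_fill {a m A d τ : ℕ} {p : Prog} {s₀ : Store} {f : ℕ → ℕ} (h0 : 0 < m) (ha : 2 ≤ a)
    (hA : A ≤ a)
    (hp : ∀ i s, i < s₀.reg 0 → Keep m A d s₀ s → (∀ b, b ≠ 1 → b ≠ a → b < A + 2 →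
        s.arr b = s₀.arr b) → s.reg m = i →
      ∃ t s', Exec p s t s' ∧ t ≤ τ ∧ Keep (m + 1) (A + 2) d s s' ∧ s'.arr 1 d = f i)
    (hA2 : a < A + 2)
    (hc : ∀ i, s₀.reg 0 ≤ i → s₀.arr a i = 0) :
    ∃ t s', Exec (fillProg a m d p) s₀ t s' ∧ t ≤ s₀.reg 0 * (τ + 20) + 20 ∧ Keep m A d s₀ s' ∧
      (∀ b, b ≠ 1 → b ≠ a → b < A + 2 → s'.arr b = s₀.arr b) ∧ s'.arr a = table (s₀.reg 0) f := by
  -- The invariant says that the entries below the counter are final and that those from `n` on are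
  -- still zero; at the end the array equals `table` as a function on all of `ℕ`.
  obtain ⟨t, s', e, ht, hk⟩ := exec_count (y := 0) (x := m) (N := s₀.reg 0) (τ := τ + 10)
    (p := .seq p (.seq (.put a (.reg m) (.get 1 (.const d))) (.assign m (.add (.reg m) (.const 1)))))
    (fun i s => Keep m A d s₀ s ∧ s.reg m = i ∧
      (∀ b, b ≠ 1 → b ≠ a → b < A + 2 → s.arr b = s₀.arr b) ∧
      (∀ j < i, s.arr a j = f j) ∧ ∀ j, s₀.reg 0 ≤ j → s.arr a j = 0)
    (fun i s h => ⟨h.1.reg 0 h0, h.2.1⟩) (fun i s hi h => by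
      obtain ⟨h1, h2, h3, h4, h5⟩ := h
      obtain ⟨t, s', e, ht, hk, hv⟩ := hp i s hi h1 h3 h2
      have hm : s'.reg m = i := by rw [hk.reg m (by omega), h2]
      have haa := hk.arr a (by omega) (by omega)
      refine ⟨_, _, Exec.seq e (Exec.seq (Exec.put _ _ _ _) (Exec.assign _ _ _)), ?_, ?_, ?_, ?_,
        ?_, ?_⟩
      · simp only [Expr.cost]; omega
      · have k1 : Keep m A d s₀ s' := h1.trans h0 (hk.mono (by omega) (by omega) le_rfl)
        refine (k1.trans h0 ?_).trans h0 (Keep.setReg m A d _ le_rfl _)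
        apply Keep.put _ _ _ _ ha hA
        simp only [Expr.eval, hm]
        rw [k1.reg 0 h0]; exact hi
      · simp [Expr.eval, hm]
      · intro b hb1 hb hbA
        simp only [Store.setReg_arr, Store.setArr_arr, Function.update_of_ne hb]
        rw [hk.arr b hb1 hbA, h3 b hb1 hb hbA]
      · intro j hj
        simp only [Store.setReg_arr, Store.setArr_arr, Function.update_self, Expr.eval, hm, hv]
        rcases eq_or_ne j i with rfl | hne
        · simp
        · rw [Function.update_of_ne hne, haa]; exact h4 j (by omega)
      · intro j hj
        simp only [Store.setReg_arr, Store.setArr_arr, Function.update_self, Expr.eval, hm, hv]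
        rw [Function.update_of_ne (by omega), haa]; exact h5 j hj)
    (s := s₀.setReg m 0) ⟨Keep.setReg m A d _ le_rfl _, by simp, fun _ _ _ _ => rfl,
      fun j hj => absurd hj (by omega), hc⟩
  refine ⟨_, s', Exec.seq (Exec.assign _ _ _) e, ?_, hk.1, hk.2.2.1, ?_⟩
  · simp only [Expr.cost]
    have : s₀.reg 0 * (τ + 10 + 4) ≤ s₀.reg 0 * (τ + 20) := Nat.mul_le_mul_left _ (by omega)
    omega
  · funext i
    unfold table
    split_ifs with hi
    · exact hk.2.2.2.1 i hi
    · exact hk.2.2.2.2 i (by omega)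

/-- All tables are zero from `n` on, where `n` is the content of register `0`. -/
def Store.Clean (s : Store) : Prop := ∀ a, 2 ≤ a → ∀ i, s.reg 0 ≤ i → s.arr a i = 0

theorem Keep.clean' {m A d : ℕ} {s s' : Store} (h : Keep m A d s s') (h0 : 0 < m) (hc : s.Clean) :
    s'.Clean := by
  have := h.clean hc
  rw [← h.reg 0 h0] at this
  exact this

/-- A uniform polynomial time bound, in terms of an upper bound on the loop bounds, for a program
that evaluates `f`. -/
def Evaluates (L : List ℕ) (p : Prog) (m A d : ℕ) (f : Store → ℕ) : Prop :=
  ∃ K D : ℕ, ∀ (Q : ℕ) (s : Store), 1 ≤ Q → (∀ y ∈ L, s.reg y ≤ Q) → s.Clean →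
    ∃ t s', Exec p s t s' ∧ t ≤ K * Q ^ D ∧ Keep m A d s s' ∧ s'.arr 1 d = f s

theorem mul_pow_mono {Q K D D' t : ℕ} (hQ : 1 ≤ Q) (ht : t ≤ K * Q ^ D) (hD : D ≤ D') :
    t ≤ K * Q ^ D' :=
  ht.trans (Nat.mul_le_mul_left _ (Nat.pow_le_pow_right hQ hD))

theorem add_const_bound {Q K D t c : ℕ} (hQ : 1 ≤ Q) (ht : t ≤ K * Q ^ D) :
    t + c ≤ (K + c) * Q ^ D := by
  have : 1 ≤ Q ^ D := Nat.one_le_pow _ _ hQ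
  nlinarith

theorem add_bound {Q K D K' D' t t' : ℕ} (hQ : 1 ≤ Q) (ht : t ≤ K * Q ^ D)
    (ht' : t' ≤ K' * Q ^ D') : t + t' ≤ (K + K') * Q ^ (D + D') := by
  have h1 := mul_pow_mono hQ ht (Nat.le_add_right D D')
  have h2 := mul_pow_mono hQ ht' (Nat.le_add_left D' D)
  rw [add_mul]; omega

theorem loop_bound {Q K D N τ : ℕ} (hN : N ≤ Q) (ht : τ ≤ K * Q ^ D) :
    N * τ ≤ K * Q ^ (D + 1) := by
  calc N * τ ≤ Q * (K * Q ^ D) := Nat.mul_le_mul hN ht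
    _ = _ := by ring

theorem max_bound {Q K D K' D' t : ℕ} (hQ : 1 ≤ Q) (h : t ≤ K * Q ^ D ∨ t ≤ K' * Q ^ D') :
    t ≤ (K + K') * Q ^ (D + D') := by
  rcases h with h | h
  · simpa using add_bound hQ h (Nat.zero_le (K' * Q ^ D'))
  · simpa using add_bound hQ (Nat.zero_le (K * Q ^ D)) h

section
variable {L : List ℕ} {m A d : ℕ}

/-- The first value waits in entry `d` of array 1 while the second program works from entry `d + 1`
on. `hg` is needed because `q` runs in the memory left behind by `p`. -/
theorem Evaluates.binary {p q : Prog} {f g : Store → ℕ} {op : Expr → Expr → Expr}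
    {op' : ℕ → ℕ → ℕ} (hop : ∀ s e e', (op e e').eval s = op' (e.eval s) (e'.eval s))
    (hcost : ∀ e e', (op e e').cost = e.cost + e'.cost + 1)
    (h0 : 0 < m) (hL : ∀ y ∈ L, y < m)
    (hp : Evaluates L p m A d f) (hq : Evaluates L q m A (d + 1) g)
    (hg : ∀ s s', Keep m A d s s' → g s' = g s) :
    Evaluates L (.seq p (.seq q
      (.put 1 (.const d) (op (.get 1 (.const d)) (.get 1 (.const (d + 1)))))))
      m A d (fun s => op' (f s) (g s)) := by
  obtain ⟨K₁, D₁, h₁⟩ := hp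
  obtain ⟨K₂, D₂, h₂⟩ := hq
  refine ⟨K₁ + K₂ + 10, D₁ + D₂, fun Q s hQ hy hc => ?_⟩
  obtain ⟨t₁, s₁, e₁, ht₁, k₁, v₁⟩ := h₁ Q s hQ hy hc
  obtain ⟨t₂, s₂, e₂, ht₂, k₂, v₂⟩ := h₂ Q s₁ hQ
    (fun y hyL => by rw [k₁.reg y (hL y hyL)]; exact hy y hyL) (k₁.clean' h0 hc)
  refine ⟨_, _, Exec.seq e₁ (Exec.seq e₂ (Exec.put _ _ _ _)), ?_,
    (k₁.trans h0 (k₂.mono le_rfl le_rfl (by omega))).trans h0 (Keep.push _ _ _ _ _), ?_⟩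
  · refine le_trans ?_ (add_const_bound hQ (add_bound hQ ht₁ ht₂))
    simp only [hcost, Expr.cost]; omega
  · simp only [Expr.eval, Store.setArr_arr, Function.update_self, hop]
    rw [k₂.stack d (by omega), v₁, v₂, hg _ _ k₁]

/-- Compiled terms compute their values in time polynomial in the loop bounds. -/
theorem Tm.evaluates (L : List ℕ) (h0L : 0 ∈ L) (t : Tm) : ∀ (m A d : ℕ) (P : List ℕ), t.wf L m A P →
    2 ≤ A → (∀ y ∈ L, y < m) → (∀ a ∈ P, a ≠ 1 ∧ a < A) →
    Evaluates L (t.comp m A d) m A d (t.eval m A) := by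
  induction t with
  | lit c =>
    intro m A d P _ _ _ _
    refine ⟨3, 0, fun Q s hQ hy hc => ⟨_, _, Exec.put _ _ _ _, by simp [Expr.cost],
      Keep.push _ _ _ _ _, by simp [Expr.eval, eval]⟩⟩
  | var x =>
    intro m A d P _ _ _ _
    refine ⟨3, 0, fun Q s hQ hy hc => ⟨_, _, Exec.put _ _ _ _, by simp [Expr.cost],
      Keep.push _ _ _ _ _, by simp [Expr.eval, eval]⟩⟩
  | get a i ih =>
    intro m A d P h hA hL hP
    have h0 := hL 0 h0L
    simp only [wf, Bool.and_eq_true, List.contains_iff_mem] at h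
    obtain ⟨K, D, hi⟩ := ih m A d P h.2 hA hL hP
    refine ⟨K + 5, D, fun Q s hQ hy hc => ?_⟩
    obtain ⟨t, s', e, ht, k, v⟩ := hi Q s hQ hy hc
    refine ⟨_, _, Exec.seq e (Exec.put _ _ _ _), ?_, k.trans h0 (Keep.push _ _ _ _ _), ?_⟩
    · refine le_trans ?_ (add_const_bound hQ ht)
      simp [Expr.cost]
    · simp only [Expr.eval, Store.setArr_arr, Function.update_self, eval, v,
        k.arr a (hP a h.1).1 (hP a h.1).2]
  | add t u iht ihu =>
    intro m A d P h hA hL hP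
    simp only [wf, Bool.and_eq_true] at h
    exact Evaluates.binary (op := .add) (fun _ _ _ => rfl) (fun _ _ => rfl) (hL 0 h0L) hL
      (iht m A d P h.1 hA hL hP) (ihu m A (d + 1) P h.2 hA hL hP)
      (fun s s' k => (eval_congr u h.2 (hL 0 h0L) hL (k.agree hP)).symm)
  | sub t u iht ihu =>
    intro m A d P h hA hL hP
    simp only [wf, Bool.and_eq_true] at h
    exact Evaluates.binary (op := .sub) (fun _ _ _ => rfl) (fun _ _ => rfl) (hL 0 h0L) hL
      (iht m A d P h.1 hA hL hP) (ihu m A (d + 1) P h.2 hA hL hP)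
      (fun s s' k => (eval_congr u h.2 (hL 0 h0L) hL (k.agree hP)).symm)
  | cond c t u ihc iht ihu =>
    intro m A d P h hA hL hP
    have h0 := hL 0 h0L
    simp only [wf, Bool.and_eq_true] at h
    obtain ⟨K₁, D₁, h₁⟩ := ihc m A d P h.1 hA hL hP
    obtain ⟨K₂, D₂, h₂⟩ := iht m A d P h.2.1 hA hL hP
    obtain ⟨K₃, D₃, h₃⟩ := ihu m A d P h.2.2 hA hL hP
    refine ⟨K₁ + (K₂ + K₃) + 5, D₁ + (D₂ + D₃), fun Q s hQ hy hc => ?_⟩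
    obtain ⟨t₁, s₁, e₁, ht₁, k₁, v₁⟩ := h₁ Q s hQ hy hc
    have hy₁ : ∀ y ∈ L, s₁.reg y ≤ Q := fun y hyL => by rw [k₁.reg y (hL y hyL)]; exact hy y hyL
    have hc₁ := k₁.clean' h0 hc
    have hag := k₁.agree hP
    by_cases hv : c.eval m A s = 0
    · obtain ⟨t₂, s₂, e₂, ht₂, k₂, v₂⟩ := h₃ Q s₁ hQ hy₁ hc₁
      refine ⟨_, _, Exec.seq e₁ (Exec.ite_neg (by simp [Expr.eval, v₁, hv]) e₂), ?_,
        k₁.trans h0 k₂, ?_⟩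
      · refine le_trans ?_ (add_const_bound hQ (add_bound hQ ht₁ (max_bound hQ (Or.inr ht₂))))
        simp only [Expr.cost]; omega
      · simp only [eval, hv, v₂, ne_eq, not_true_eq_false, if_false]
        exact (eval_congr u h.2.2 h0 hL hag).symm
    · obtain ⟨t₂, s₂, e₂, ht₂, k₂, v₂⟩ := h₂ Q s₁ hQ hy₁ hc₁
      refine ⟨_, _, Exec.seq e₁ (Exec.ite_pos (by simp [Expr.eval, v₁, hv]) e₂), ?_,
        k₁.trans h0 k₂, ?_⟩
      · refine le_trans ?_ (add_const_bound hQ (add_bound hQ ht₁ (max_bound hQ (Or.inl ht₂))))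
        simp only [Expr.cost]; omega
      · simp only [eval, hv, v₂, ne_eq, not_false_eq_true, if_true]
        exact (eval_congr t h.2.1 h0 hL hag).symm
  | bind t b iht ihb =>
    intro m A d P h hA hL hP
    have h0 := hL 0 h0L
    simp only [wf, Bool.and_eq_true] at h
    have hL' : ∀ y ∈ L, y < m + 1 := fun y hy => (hL y hy).trans (by omega)
    obtain ⟨K₁, D₁, h₁⟩ := iht m A d P h.1 hA hL hP
    obtain ⟨K₂, D₂, h₂⟩ := ihb (m + 1) A d P h.2 hA hL' hP
    refine ⟨K₁ + K₂ + 5, D₁ + D₂, fun Q s hQ hy hc => ?_⟩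
    obtain ⟨t₁, s₁, e₁, ht₁, k₁, v₁⟩ := h₁ Q s hQ hy hc
    have k₁' := k₁.trans h0 (Keep.setReg m A d s₁ le_rfl (s₁.arr 1 d))
    obtain ⟨t₂, s₂, e₂, ht₂, k₂, v₂⟩ := h₂ Q (s₁.setReg m (s₁.arr 1 d)) hQ
      (fun y hyL => by rw [k₁'.reg y (hL y hyL)]; exact hy y hyL) (k₁'.clean' h0 hc)
    refine ⟨_, _, Exec.seq e₁ (Exec.seq (Exec.assign _ _ _) e₂), ?_,
      k₁'.trans h0 (k₂.mono (by omega) le_rfl le_rfl), ?_⟩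
    · refine le_trans ?_ (add_const_bound hQ (add_bound hQ ht₁ ht₂))
      simp only [Expr.cost]; omega
    · rw [v₂, v₁]
      exact (eval_congr b h.2 (by omega) hL' ((k₁.agree hP).setReg _)).symm
  | iter y t b iht ihb =>
    intro m A d P h hA hL hP
    have h0 := hL 0 h0L
    simp only [wf, Bool.and_eq_true, List.contains_iff_mem] at h
    have hL' : ∀ y ∈ L, y < m + 2 := fun y hy => (hL y hy).trans (by omega)
    obtain ⟨K₁, D₁, h₁⟩ := iht m A d P h.2.1 hA hL hP
    obtain ⟨K₂, D₂, h₂⟩ := ihb (m + 2) A d P h.2.2 hA hL' hP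
    refine ⟨K₁ + (K₂ + 20) + 20, D₁ + (D₂ + 1), fun Q s hQ hy hc => ?_⟩
    obtain ⟨t₁, s₁, e₁, ht₁, k₁, v₁⟩ := h₁ Q s hQ hy hc
    -- The partial results of the iteration: before round `i` the loop has `F i` in register `m` and
    -- `i` in register `m + 1`.
    let F : ℕ → ℕ := fun i => Nat.rec (t.eval m A s)
        (fun i acc => b.eval (m + 2) A ((s.setReg m acc).setReg (m + 1) i)) i
    obtain ⟨t₂, s₂, e₂, ht₂, k₂, hm₂, -⟩ := exec_count (y := y) (x := m + 1) (N := s.reg y)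
      (τ := K₂ * Q ^ D₂ + 10)
      (p := .seq (b.comp (m + 2) A d) (.seq (.assign m (.get 1 (.const d)))
            (.assign (m + 1) (.add (.reg (m + 1)) (.const 1)))))
      (fun i s' => Keep m A d s s' ∧ s'.reg m = F i ∧ s'.reg (m + 1) = i)
      (fun i s' hs' => ⟨hs'.1.reg y (hL y h.1), hs'.2.2⟩)
      (fun i s' hi hs' => by
        obtain ⟨hk, hm, hm1⟩ := hs'
        obtain ⟨t₃, s₃, e₃, ht₃, k₃, v₃⟩ := h₂ Q s' hQ
          (fun y hyL => by rw [hk.reg y (hL y hyL)]; exact hy y hyL) (hk.clean' h0 hc)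
        refine ⟨_, _, Exec.seq e₃ (Exec.seq (Exec.assign _ _ _) (Exec.assign _ _ _)), ?_,
          ((hk.trans h0 (k₃.mono (by omega) le_rfl le_rfl)).trans h0
            (Keep.setReg _ _ _ _ le_rfl _)).trans h0 (Keep.setReg _ _ _ _ (by omega) _), ?_, ?_⟩
        · simp only [Expr.cost]; omega
        · simp only [Store.setReg_reg, Expr.eval, v₃, Function.update_of_ne (show m ≠ m + 1 by omega),
            Function.update_self]
          refine eval_congr b h.2.2 (by omega) hL' ⟨fun x hx => ?_, fun a ha => ?_⟩
          · rcases eq_or_ne x (m + 1) with rfl | hx1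
            · simp [hm1]
            rcases eq_or_ne x m with rfl | hx2
            · simp [hm, F]
            · simpa [hx1, hx2] using hk.reg x (by omega)
          · exact hk.arr a (hP a ha).1 (hP a ha).2
        · simp [Expr.eval, k₃.reg (m + 1) (by omega), hm1])
      (s := (s₁.setReg m (s₁.arr 1 d)).setReg (m + 1) 0)
      ⟨(k₁.trans h0 (Keep.setReg _ _ _ _ le_rfl _)).trans h0 (Keep.setReg _ _ _ _ (by omega) _),
        by simp [F, v₁], by simp⟩
    refine ⟨_, _, Exec.seq e₁ (Exec.seq (Exec.assign _ _ _) (Exec.seq (Exec.assign _ _ _)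
      (Exec.seq e₂ (Exec.put _ _ _ _)))), ?_, k₂.trans h0 (Keep.push _ _ _ _ _), ?_⟩
    · have := loop_bound (hy y h.1) (add_const_bound (c := 20) hQ (le_refl (K₂ * Q ^ D₂)))
      have h3 := add_bound hQ ht₁ this
      refine le_trans ?_ (add_const_bound hQ h3)
      have h4 : s.reg y * (K₂ * Q ^ D₂ + 10 + 4) ≤ s.reg y * (K₂ * Q ^ D₂ + 20) :=
        Nat.mul_le_mul_left _ (by omega)
      simp only [Expr.cost]; omega
    · simp [Expr.eval, hm₂, F, eval]
  | tab y t₀ t b ih₀ iht ihb =>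
    intro m A d P h hA hL hP
    have h0 := hL 0 h0L
    simp only [wf, Bool.and_eq_true, List.contains_iff_mem] at h
    have hL₁ : ∀ y ∈ L, y < m + 1 := fun y hy => (hL y hy).trans (by omega)
    have hL₂ : ∀ y ∈ L, y < m + 2 := fun y hy => (hL y hy).trans (by omega)
    have hP₁ : ∀ a ∈ P, a ≠ 1 ∧ a < A + 2 := fun a ha => ⟨(hP a ha).1, by have := (hP a ha).2; omega⟩
    have hP₂ : ∀ a ∈ A :: P, a ≠ 1 ∧ a < A + 2 := fun a ha => by
      rcases List.mem_cons.1 ha with rfl | ha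
      · omega
      · exact hP₁ a ha
    obtain ⟨K₀, D₀, h₀⟩ := ih₀ (m + 1) (A + 2) d P h.2.1 (by omega) hL₁ hP₁
    obtain ⟨K₁, D₁, h₁⟩ := iht (m + 2) (A + 2) d (A :: P) h.2.2.1 (by omega) hL₂ hP₂
    obtain ⟨K₂, D₂, h₂⟩ := ihb m (A + 2) d (A :: P) h.2.2.2 (by omega) hL hP₂
    refine ⟨(K₀ + 20) + ((K₁ + 20) + 100 + K₂) + 100, (D₀ + 1) + ((D₁ + 1 + 1) + D₂),
      fun Q s hQ hy hc => ?_⟩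
    have hn : s.reg 0 ≤ Q := hy 0 h0L
    let F₀ : ℕ → ℕ := fun i => t₀.eval (m + 1) (A + 2) (s.setReg m i)
    let G : ℕ → (ℕ → ℕ) → ℕ → ℕ := fun j c i =>
      t.eval (m + 2) (A + 2) (((s.setReg m j).setReg (m + 1) i).setTab A c)
    let F : ℕ → ℕ → ℕ := fun j => Nat.rec (table (s.reg 0) F₀) (fun j c => table (s.reg 0) (G j c)) j
    have hF : ∀ j, F (j + 1) = table (s.reg 0) (G j (F j)) := fun j => rfl
    obtain ⟨t₁, s₁, e₁, ht₁, k₁, ha₁, hA₁⟩ := exec_fill (a := A) (m := m) (A := A) (d := d)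
      (τ := K₀ * Q ^ D₀) (p := t₀.comp (m + 1) (A + 2) d) (s₀ := s) (f := F₀) h0 hA le_rfl
      (fun i s' hi hk ha' hm' => by
        obtain ⟨t', s'', e', ht', k', v'⟩ := h₀ Q s' hQ
          (fun y hyL => by rw [hk.reg y (hL y hyL)]; exact hy y hyL) (hk.clean' h0 hc)
        refine ⟨t', s'', e', ht', k', v'.trans ?_⟩
        refine eval_congr t₀ h.2.1 (by omega) hL₁ ⟨fun x hx => ?_, fun a ha => ?_⟩
        · rcases eq_or_ne x m with rfl | hx2
          · simp [hm']
          · simpa [hx2] using hk.reg x (by omega)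
        · exact hk.arr a (hP a ha).1 (hP a ha).2)
      (by omega) (hc A hA)
    -- A round computes the new table in array `A + 1` from the old one in array `A` and copies it
    -- back afterwards, so that all entries are replaced simultaneously.
    obtain ⟨t₂, s₂, e₂, ht₂, k₂, -, hA₂⟩ := exec_count (y := y) (x := m) (N := s.reg y)
      (τ := s.reg 0 * (K₁ * Q ^ D₁ + 20) + 20 + (s.reg 0 * (5 + 20) + 20) + 10)
      (p := .seq (fillProg (A + 1) (m + 1) d (t.comp (m + 2) (A + 2) d))
            (.seq (fillProg A (m + 1) d (.put 1 (.const d) (.get (A + 1) (.reg (m + 1)))))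
              (.assign m (.add (.reg m) (.const 1)))))
      (fun j s' => Keep m A d s s' ∧ s'.reg m = j ∧ s'.arr A = F j)
      (fun i s' hs' => ⟨hs'.1.reg y (hL y h.1), hs'.2.1⟩)
      (fun j s' hj hs' => by
        obtain ⟨hk, hm, hA'⟩ := hs'
        have hc' := hk.clean' h0 hc
        have h00 : s'.reg 0 = s.reg 0 := hk.reg 0 h0
        obtain ⟨t₃, s₃, e₃, ht₃, k₃, ha₃, hA₃⟩ := exec_fill (a := A + 1) (m := m + 1) (A := A) (d := d)
          (τ := K₁ * Q ^ D₁) (p := t.comp (m + 2) (A + 2) d) (s₀ := s') (f := G j (F j)) (by omega)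
          (by omega) (by omega)
          (fun i s'' hi hk' ha' hm' => by
            have hk'' := hk.trans h0 (hk'.mono (Nat.le_succ m) le_rfl le_rfl)
            obtain ⟨t', s''', e', ht', k', v'⟩ := h₁ Q s'' hQ
              (fun y hyL => by rw [hk''.reg y (hL y hyL)]; exact hy y hyL) (hk''.clean' h0 hc)
            refine ⟨t', s''', e', ht', k', v'.trans ?_⟩
            refine eval_congr t h.2.2.1 (by omega) hL₂ ⟨fun x hx => ?_, fun a ha => ?_⟩
            · rcases eq_or_ne x (m + 1) with rfl | hx1
              · simp [hm']
              rcases eq_or_ne x m with rfl | hx2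
              · simp [hk'.reg x (by omega), hm]
              · simpa [hx1, hx2] using hk''.reg x (by omega)
            · rcases List.mem_cons.1 ha with rfl | ha
              · simpa [hA'] using ha' a (by omega) (by omega) (by omega)
              · have := (hP a ha).2
                simpa [show a ≠ A by omega] using hk''.arr a (hP a ha).1 (hP a ha).2)
          (by omega) (hc' (A + 1) (by omega))
        have k₃' := hk.trans h0 (k₃.mono (Nat.le_succ m) le_rfl le_rfl)
        have h03 : s₃.reg 0 = s.reg 0 := k₃'.reg 0 h0
        obtain ⟨t₄, s₄, e₄, ht₄, k₄, ha₄, hA₄⟩ := exec_fill (a := A) (m := m + 1) (A := A) (d := d)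
          (τ := 5) (p := .put 1 (.const d) (.get (A + 1) (.reg (m + 1)))) (s₀ := s₃)
          (f := s₃.arr (A + 1)) (by omega)
          (by omega) (by omega)
          (fun i s'' hi hk' ha' hm' => by
            refine ⟨_, _, Exec.put _ _ _ _, by simp [Expr.cost], Keep.push _ _ _ _ _, ?_⟩
            simp [Expr.eval, hm', ha' (A + 1) (by omega) (by omega) (by omega)])
          (by omega) (k₃'.clean' h0 hc A (by omega))
        refine ⟨_, _, Exec.seq e₃ (Exec.seq e₄ (Exec.assign _ _ _)), ?_,
          (k₃'.trans h0 (k₄.mono (Nat.le_succ m) le_rfl le_rfl)).trans h0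
            (Keep.setReg _ _ _ _ le_rfl _), ?_, ?_⟩
        · simp only [Expr.cost]
          rw [h00] at ht₃; rw [h03] at ht₄
          omega
        · simp [Expr.eval, k₄.reg m (by omega), k₃.reg m (by omega), hm]
        · simp only [Store.setReg_arr, hA₄, hA₃, hF, h00, h03]
          funext i
          simp only [table]
          split_ifs <;> rfl)
      (s := s₁.setReg m 0)
      ⟨k₁.trans h0 (Keep.setReg _ _ _ _ le_rfl _), by simp, by simpa [F] using hA₁⟩
    obtain ⟨t₃, s₃, e₃, ht₃, k₃, v₃⟩ := h₂ Q s₂ hQ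
          (fun y hyL => by rw [k₂.reg y (hL y hyL)]; exact hy y hyL) (k₂.clean' h0 hc)
    refine ⟨_, _, Exec.seq e₁ (Exec.seq (Exec.assign _ _ _) (Exec.seq e₂ e₃)), ?_,
      k₂.trans h0 (k₃.mono le_rfl (by omega) le_rfl), ?_⟩
    · have b₀ := loop_bound hn (add_const_bound (c := 20) hQ (le_refl (K₀ * Q ^ D₀)))
      have b₁ := loop_bound hn (add_const_bound (c := 20) hQ (le_refl (K₁ * Q ^ D₁)))
      have b₂ : s.reg 0 * (K₁ * Q ^ D₁ + 20) + 20 + (s.reg 0 * (5 + 20) + 20) + 10 + 4 ≤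
          ((K₁ + 20) + 100) * Q ^ (D₁ + 1) := by
        have : s.reg 0 ≤ Q ^ (D₁ + 1) := hn.trans (Nat.le_self_pow (by omega) Q)
        have h1 : 1 ≤ Q ^ (D₁ + 1) := Nat.one_le_pow _ _ hQ
        rw [add_mul (K₁ + 20)]
        omega
      have b₃ := loop_bound (hy y h.1) b₂
      refine le_trans ?_ (add_const_bound hQ (add_bound hQ b₀ (add_bound hQ b₃ ht₃)))
      simp only [Expr.cost]
      omega
    · rw [v₃]
      refine eval_congr b h.2.2.2 h0 hL ⟨fun x hx => k₂.reg x hx, fun a ha => ?_⟩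
      rcases List.mem_cons.1 ha with rfl | ha
      · simpa [eval] using hA₂
      · have := (hP a ha).2
        simpa [show a ≠ A by omega] using k₂.arr a (hP a ha).1 (hP a ha).2
end


/-! ### Components and labellings -/

section Labels
variable {V : Type*} (G : SimpleGraph V)

/-- The graph `G` without the edges that leave `U`. -/
def within (U : Set V) : SimpleGraph V where
  Adj u v := G.Adj u v ∧ u ∈ U ∧ v ∈ U
  symm := ⟨fun _ _ h => ⟨h.1.symm, h.2.2, h.2.1⟩⟩
  loopless := ⟨fun _ h => G.loopless.irrefl _ h.1⟩

variable {G}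

theorem within_mono {U U' : Set V} (h : U ⊆ U') : within G U ≤ within G U' :=
  fun _ _ ha => ⟨ha.1, h ha.2.1, h ha.2.2⟩

theorem within_reachable_mem {U : Set V} {u v : V} (h : (within G U).Reachable u v) (hu : u ∈ U) :
    v ∈ U := by
  obtain ⟨p⟩ := h
  induction p with
  | nil => exact hu
  | cons ha _ ih => exact ih ha.2.2

theorem eq_of_within_reachable {U : Set V} {α : Type*} {φ : V → α}
    (hφ : ∀ u v, u ∈ U → v ∈ U → G.Adj u v → φ u = φ v) {u v : V}
    (h : (within G U).Reachable u v) : φ u = φ v := by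
  obtain ⟨p⟩ := h
  induction p with
  | nil => rfl
  | cons ha _ ih => exact (hφ _ _ ha.2.1 ha.2.2 ha.1).trans ih

/-- `lab` chooses a representative of every component of `G[U]`. -/
structure IsLabel (G : SimpleGraph V) (U : Set V) (lab : V → V) : Prop where
  adj : ∀ u v, u ∈ U → v ∈ U → G.Adj u v → lab u = lab v
  reach : ∀ u ∈ U, (within G U).Reachable u (lab u)
  off : ∀ u, u ∉ U → lab u = u

namespace IsLabel
variable {U : Set V} {lab : V → V}

theorem mem (h : IsLabel G U lab) {u : V} (hu : u ∈ U) : lab u ∈ U :=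
  within_reachable_mem (h.reach u hu) hu

theorem eq_of_reachable (h : IsLabel G U lab) {u v : V} (hr : (within G U).Reachable u v) :
    lab u = lab v := eq_of_within_reachable h.adj hr

theorem idem (h : IsLabel G U lab) (u : V) : lab (lab u) = lab u := by
  by_cases hu : u ∈ U
  · exact (h.eq_of_reachable (h.reach u hu)).symm
  · rw [h.off u hu, h.off u hu]

end IsLabel

/-- All components of `G - S` have at most `l` vertices. -/
def SmallComponents (G : SimpleGraph V) (S : Finset V) (l : ℕ) : Prop :=
  ∀ v ∉ S, {u | (within G {w | w ∉ S}).Reachable v u}.ncard ≤ l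

theorem within_reachable_iff {U : Set V} (u v : U) :
    (within G U).Reachable u v ↔ (G.induce U).Reachable u v := by
  constructor
  · rintro ⟨p⟩
    have key : ∀ (a b : V) (p : (within G U).Walk a b) (ha : a ∈ U) (hb : b ∈ U),
        (G.induce U).Reachable ⟨a, ha⟩ ⟨b, hb⟩ := by
      intro a b p
      induction p with
      | nil => intros; rfl
      | cons h _ ih =>
        intro ha hb
        exact (SimpleGraph.Adj.reachable (by exact h.1)).trans (ih h.2.2 hb)
    exact key _ _ p u.2 v.2
  · rintro ⟨p⟩
    induction p with
    | nil => rfl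
    | @cons a b c h _ ih =>
      refine SimpleGraph.Reachable.trans (SimpleGraph.Adj.reachable ?_) ih
      exact ⟨h, a.2, b.2⟩

theorem supp_ncard {S : Finset V} (v : {v | v ∉ S}) :
    ((G.induce {v | v ∉ S}).connectedComponentMk v).supp.ncard =
      {u | (within G {w | w ∉ S}).Reachable v u}.ncard := by
  rw [← Set.ncard_image_of_injective _ Subtype.val_injective]
  congr 1
  ext u
  simp only [Set.mem_image, SimpleGraph.ConnectedComponent.mem_supp_iff,
    SimpleGraph.ConnectedComponent.eq]
  constructor
  · rintro ⟨w, hw, rfl⟩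
    exact ((within_reachable_iff _ _).2 hw).symm
  · intro h
    exact ⟨⟨u, within_reachable_mem h v.2⟩, ((within_reachable_iff v ⟨u, _⟩).1 h).symm, rfl⟩

theorem maxComponentSize_le_iff [Finite V] {S : Finset V} {l : ℕ} :
    maxComponentSize G S ≤ l ↔ SmallComponents G S l := by
  unfold maxComponentSize
  constructor
  · intro h v hv
    rw [← supp_ncard ⟨v, hv⟩]
    exact (le_ciSup (f := fun D : (G.induce {v | v ∉ S}).ConnectedComponent => D.supp.ncard)
      (Set.finite_range _).bddAbove _).trans h
  · intro h
    refine ciSup_le' fun D => ?_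
    induction D using SimpleGraph.ConnectedComponent.ind with
    | _ v => rw [supp_ncard]; exact h v v.2

/-- The infimum over `S` is attained, and the largest component size may be replaced by any common
bound `l`, which the algorithm can guess. -/
theorem vi_le_iff [Finite V] {k : ℕ} :
    vi G ≤ k ↔ ∃ (S : Finset V) (l : ℕ), SmallComponents G S l ∧ S.card + l ≤ k := by
  constructor
  · intro h
    obtain ⟨S, hS⟩ : vi G ∈ Set.range fun S : Finset V => S.card + maxComponentSize G S :=
      Nat.sInf_mem (Set.range_nonempty _)
    exact ⟨S, maxComponentSize G S, maxComponentSize_le_iff.1 le_rfl, by simp only at hS; omega⟩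
  · rintro ⟨S, l, hS, hk⟩
    exact (Nat.sInf_le (Set.mem_range_self S)).trans
      ((Nat.add_le_add_left (maxComponentSize_le_iff.2 hS) _).trans hk)

end Labels

/-! ### Systems of paths -/

section Paths
variable {V : Type*} [DecidableEq V]

/-- The components of `G - B` are paths: `f κ 1, …, f κ (len κ)` are the vertices of the component
with label `κ`, in order, and `f κ 0` and `f κ (len κ + 1)` are the neighbours of its ends
in `B`. -/
structure IsPathSystem (G : SimpleGraph V) (B : Finset V) (lab : V → V) (len : V → ℕ)
    (f : V → ℕ → V) : Prop where
  label : IsLabel G {v | v ∉ B} lab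
  start : ∀ κ ∉ B, f κ 0 ∈ B
  finish : ∀ κ ∉ B, f κ (len κ + 1) ∈ B
  notMem : ∀ κ ∉ B, ∀ i ∈ Finset.Icc 1 (len κ), f κ i ∉ B
  lab_eq : ∀ κ ∉ B, lab κ = κ → ∀ i ∈ Finset.Icc 1 (len κ), lab (f κ i) = κ
  surj : ∀ v ∉ B, ∃ i ∈ Finset.Icc 1 (len (lab v)), f (lab v) i = v
  inj : ∀ κ ∉ B, Set.InjOn (f κ) (Finset.Icc 1 (len κ))
  adj_iff : ∀ κ ∉ B, ∀ i ∈ Finset.Icc 1 (len κ), ∀ w,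
    G.Adj (f κ i) w ↔ w = f κ (i - 1) ∨ w = f κ (i + 1)
  ne : ∀ κ ∉ B, ∀ i ∈ Finset.Icc 1 (len κ), f κ (i - 1) ≠ f κ (i + 1)

variable (B : Finset V) (lab : V → V) (len : V → ℕ) (f : V → ℕ → V)

/-- The labels of the paths. -/
def pathLabels [Fintype V] : Finset V := {κ | κ ∉ B ∧ lab κ = κ}

/-- The number of edges between a path and `X`. -/
def endCount (X : Finset V) (κ : V) : ℕ :=
  (if f κ 0 ∈ X then 1 else 0) + if f κ (len κ + 1) ∈ X then 1 else 0

/-- The least number of vertices of the path `κ` that remain connected to `B \ X` if `q κ` vertices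
of the path are deleted and the other pieces have at most `l` vertices. -/
def rest (X : Finset V) (q : V → ℕ) (l : ℕ) (κ : V) : ℕ :=
  len κ - q κ - l * (q κ + endCount len f X κ - 1)

/-- The vertices of `B \ X` and those of the paths from which nothing is deleted. -/
def kept (X : Finset V) (q : V → ℕ) : Set V :=
  {u | (u ∈ B ∧ u ∉ X) ∨ (u ∉ B ∧ q (lab u) = 0)}

/-- The paths that are hit and whose remainders have to be connected to `F`. -/
def confined [Fintype V] (X : Finset V) (q : V → ℕ) (F : Finset V) : Finset V :=
  {κ ∈ pathLabels B lab | 1 ≤ q κ ∧ (f κ 0 ∈ X ∨ f κ 0 ∈ F) ∧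
    (f κ (len κ + 1) ∈ X ∨ f κ (len κ + 1) ∈ F)}

/-- Hall's condition: the union `F` of some components of the kept part has room for what remains of
the paths that have to be connected to `F`. -/
def HallCondition [Fintype V] (X : Finset V) (q : V → ℕ) (l : ℕ) (lab' : V → V) : Prop :=
  ∀ F : Finset V, (∀ u ∈ F, u ∈ kept B lab X q) →
    (∀ u ∈ F, ∀ v ∈ kept B lab X q, lab' v = lab' u → v ∈ F) →
    F.card + ∑ κ ∈ confined B lab len f X q F, rest len f X q l κ ≤
      l * (F.filter fun c => lab' c = c).card

end Paths

/-! ### Distributing the remainders of the paths by Hall's theorem -/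

section Sound
variable {V : Type*} [DecidableEq V] [Fintype V] {G : SimpleGraph V} {B : Finset V} {lab : V → V}
  {len : V → ℕ} {f : V → ℕ → V} {X : Finset V} {q : V → ℕ} {l : ℕ} {lab' : V → V}

open Classical in
/-- The part of the remainders that is connected to the components of the kept part, chosen by
Hall's theorem. -/
theorem exists_distribution (hlab' : IsLabel G (kept B lab X q) lab')
    (hs : ∀ κ ∈ pathLabels B lab, f κ 0 ∈ B ∧ f κ (len κ + 1) ∈ B)
    (h : HallCondition B lab len f X q l lab') :
    ∃ a b : V → ℕ,
      (∀ κ ∈ pathLabels B lab, 1 ≤ q κ → rest len f X q l κ ≤ a κ + b κ ∧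
        (f κ 0 ∈ X → a κ = 0) ∧ (f κ (len κ + 1) ∈ X → b κ = 0)) ∧
      ∀ c ∈ kept B lab X q, lab' c = c →
        ({u | u ∈ kept B lab X q ∧ lab' u = c} : Finset V).card +
          ∑ κ ∈ pathLabels B lab with 1 ≤ q κ,
            ((if f κ 0 ∉ X ∧ lab' (f κ 0) = c then a κ else 0) +
              if f κ (len κ + 1) ∉ X ∧ lab' (f κ (len κ + 1)) = c then b κ else 0) ≤ l := by
  set r := rest len f X q l with hr
  let cl : V → Finset V := fun c => {u | u ∈ kept B lab X q ∧ lab' u = c}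
  let K : Finset V := {κ ∈ pathLabels B lab | 1 ≤ q κ}
  -- There is one unit for each vertex of each remainder. `T κ` contains the labels of the at most
  -- two kept components that can take the units of `κ`, and a component `c` offers `l - |cl c|`
  -- slots.
  let ι := {p : V × ℕ // p.1 ∈ K ∧ p.2 < r p.1}
  let T : V → Finset V := fun κ =>
    (if f κ 0 ∉ X then {lab' (f κ 0)} else ∅) ∪
      if f κ (len κ + 1) ∉ X then {lab' (f κ (len κ + 1))} else ∅
  let slots : V → Finset (Σ _ : V, ℕ) := fun κ =>
    (T κ).sigma fun c => Finset.range (l - (cl c).card)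
  have hTmem : ∀ κ c, c ∈ T κ ↔ (f κ 0 ∉ X ∧ c = lab' (f κ 0)) ∨
      (f κ (len κ + 1) ∉ X ∧ c = lab' (f κ (len κ + 1))) := by
    intro κ c
    simp only [T, Finset.mem_union]
    by_cases h1 : f κ 0 ∈ X <;> by_cases h2 : f κ (len κ + 1) ∈ X <;> simp [h1, h2]
  have hTkept : ∀ κ ∈ K, ∀ c ∈ T κ, c ∈ kept B lab X q ∧ lab' c = c := by
    intro κ hκ c hc
    have hκ' := hs κ (Finset.mem_filter.1 hκ).1
    have key : ∀ u ∈ B, u ∉ X → lab' u ∈ kept B lab X q ∧ lab' (lab' u) = lab' u := fun u hu hu' =>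
      ⟨hlab'.mem (Or.inl ⟨hu, hu'⟩), hlab'.idem u⟩
    rcases (hTmem κ c).1 hc with ⟨h1, rfl⟩ | ⟨h1, rfl⟩
    · exact key _ hκ'.1 h1
    · exact key _ hκ'.2 h1
  have hall : ∀ s : Finset ι, s.card ≤ (s.biUnion fun x => slots x.1.1).card := by
    intro s
    let C : Finset V := s.biUnion fun x => T x.1.1
    have hC : ∀ c ∈ C, c ∈ kept B lab X q ∧ lab' c = c := by
      intro c hc
      obtain ⟨x, -, hx⟩ := Finset.mem_biUnion.1 hc
      exact hTkept _ x.2.1 c hx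
    -- Hall's condition is used for the union of all components that are open to the units in `s`.
    -- The labels in it are exactly `C`, and every path with a unit in `s` is confined to it.
    let F : Finset V := C.biUnion cl
    have hF := h F (fun u hu => by
        obtain ⟨c, -, hu⟩ := Finset.mem_biUnion.1 hu
        exact (Finset.mem_filter.1 hu).2.1) (fun u hu v hv huv => by
        obtain ⟨c, hc, hu⟩ := Finset.mem_biUnion.1 hu
        exact Finset.mem_biUnion.2 ⟨c, hc, Finset.mem_filter.2
          ⟨Finset.mem_univ _, hv, huv.trans (Finset.mem_filter.1 hu).2.2⟩⟩)
    have hFC : (F.filter fun c => lab' c = c) = C := by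
      ext c
      simp only [Finset.mem_filter, F, Finset.mem_biUnion, cl]
      constructor
      · rintro ⟨⟨c', hc', -, -, h1⟩, h2⟩
        rwa [← h2, h1]
      · intro hc
        exact ⟨⟨c, hc, Finset.mem_univ _, (hC c hc).1, (hC c hc).2⟩, (hC c hc).2⟩
    have hFcard : F.card = ∑ c ∈ C, (cl c).card := by
      refine Finset.card_biUnion fun c _ c' _ hne => ?_
      rw [Function.onFun, Finset.disjoint_left]
      intro u hu hu'
      exact hne ((Finset.mem_filter.1 hu).2.2.symm.trans (Finset.mem_filter.1 hu').2.2)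
    have hU : (s.biUnion fun x => slots x.1.1) =
        C.sigma fun c => Finset.range (l - (cl c).card) := by
      ext ⟨c, j⟩
      simp only [Finset.mem_biUnion, Finset.mem_sigma, slots, C]
      tauto
    rw [hU, Finset.card_sigma]
    simp only [Finset.card_range]
    have h1 : l * C.card ≤ ∑ c ∈ C, (l - (cl c).card) + ∑ c ∈ C, (cl c).card := by
      rw [← Finset.sum_add_distrib, mul_comm, ← smul_eq_mul, ← Finset.sum_const]
      exact Finset.sum_le_sum fun c _ => by omega
    have h2 : s.card ≤ ∑ κ ∈ confined B lab len f X q F, r κ := by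
      have : s.card = (s.map ⟨Subtype.val, Subtype.val_injective⟩).card := by simp
      rw [this]
      calc _ ≤ ((confined B lab len f X q F).sigma fun κ => Finset.range (r κ)).card := by
            refine Finset.card_le_card_of_injOn (fun p => (⟨p.1, p.2⟩ : Σ _ : V, ℕ)) ?_ ?_
            · intro p hp
              obtain ⟨x, hx, rfl⟩ := Finset.mem_map.1 (Finset.mem_coe.1 hp)
              have hxK := Finset.mem_filter.1 x.2.1
              have hκ' := hs x.1.1 hxK.1
              have hT : ∀ u ∈ B, u ∉ X → lab' u ∈ T x.1.1 → u ∈ F := fun u hu hu' hc =>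
                Finset.mem_biUnion.2 ⟨lab' u, Finset.mem_biUnion.2 ⟨x, hx, hc⟩,
                  Finset.mem_filter.2 ⟨Finset.mem_univ _, Or.inl ⟨hu, hu'⟩, rfl⟩⟩
              simp only [Finset.coe_sigma, Set.mem_sigma_iff, Finset.mem_coe, Finset.mem_range]
              refine ⟨Finset.mem_filter.2 ⟨hxK.1, hxK.2, ?_, ?_⟩, x.2.2⟩
              · by_contra! h'
                exact h'.2 (hT _ hκ'.1 h'.1 ((hTmem _ _).2 (Or.inl ⟨h'.1, rfl⟩)))
              · by_contra! h'
                exact h'.2 (hT _ hκ'.2 h'.1 ((hTmem _ _).2 (Or.inr ⟨h'.1, rfl⟩)))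
            · rintro ⟨a, b⟩ - ⟨a', b'⟩ - h
              simpa using h
        _ = _ := by simp
    rw [hFC, hFcard, ← hr] at hF
    omega
  obtain ⟨φ, hinj, hφ⟩ := (Finset.all_card_le_biUnion_card_iff_exists_injective _).1 hall
  let ψ : V → ℕ → V := fun κ i => if hh : κ ∈ K ∧ i < r κ then (φ ⟨(κ, i), hh⟩).1 else κ
  have hψφ : ∀ κ i (hh : κ ∈ K ∧ i < r κ), ψ κ i = (φ ⟨(κ, i), hh⟩).1 := fun κ i hh => dif_pos hh
  -- A unit counts at the start of its path if it is sent to the component there, and at the end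
  -- only otherwise; a path with both ends in one component thus counts no unit twice.
  let PA : V → ℕ → Prop := fun κ i => f κ 0 ∉ X ∧ ψ κ i = lab' (f κ 0)
  let PB : V → ℕ → Prop := fun κ i => ¬ PA κ i ∧ f κ (len κ + 1) ∉ X ∧
    ψ κ i = lab' (f κ (len κ + 1))
  have hψ : ∀ κ ∈ K, ∀ i < r κ, PA κ i ∨ PB κ i := by
    intro κ hκ i hi
    have := hφ ⟨(κ, i), hκ, hi⟩
    have hc := (Finset.mem_sigma.1 this).1
    have hψi : ψ κ i = (φ ⟨(κ, i), hκ, hi⟩).1 := dif_pos ⟨hκ, hi⟩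
    rw [← hψi] at hc
    by_cases hA : PA κ i
    · exact Or.inl hA
    · refine Or.inr ⟨hA, ?_⟩
      rcases (hTmem κ _).1 hc with h1 | h1
      · exact absurd h1 hA
      · exact h1
  refine ⟨fun κ => ((Finset.range (r κ)).filter (PA κ)).card,
    fun κ => ((Finset.range (r κ)).filter (PB κ)).card, ?_, ?_⟩
  · intro κ hκ hq
    refine ⟨?_, fun h0 => ?_, fun h0 => ?_⟩
    · refine le_trans ?_ (Finset.card_union_le _ _)
      rw [← Finset.filter_or, Finset.filter_true_of_mem, Finset.card_range]
      exact fun i hi => hψ κ (Finset.mem_filter.2 ⟨hκ, hq⟩) i (Finset.mem_range.1 hi)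
    · exact Finset.card_eq_zero.2 (Finset.filter_false_of_mem fun i _ hA => hA.1 h0)
    · exact Finset.card_eq_zero.2 (Finset.filter_false_of_mem fun i _ hA => hA.2.1 h0)
  · intro c hc hcc
    -- The number `l - |cl c|` of slots is a truncated difference, so `|cl c| ≤ l` has to come from
    -- Hall's condition for this single component.
    have hle : (cl c).card ≤ l := by
      have := h (cl c) (fun u hu => (Finset.mem_filter.1 hu).2.1) (fun u hu v hv huv =>
        Finset.mem_filter.2 ⟨Finset.mem_univ _, hv, huv.trans (Finset.mem_filter.1 hu).2.2⟩)
      have h1 : ((cl c).filter fun c => lab' c = c) ⊆ {c} := by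
        intro d hd
        have := Finset.mem_filter.1 hd
        rw [Finset.mem_singleton, ← this.2, (Finset.mem_filter.1 this.1).2.2]
      have h2 := Finset.card_le_card h1
      rw [Finset.card_singleton] at h2
      have h3 := Nat.mul_le_mul_left l h2
      omega
    have hsum : ∑ κ ∈ K, ((if f κ 0 ∉ X ∧ lab' (f κ 0) = c then
          ((Finset.range (r κ)).filter (PA κ)).card else 0) +
          if f κ (len κ + 1) ∉ X ∧ lab' (f κ (len κ + 1)) = c then
            ((Finset.range (r κ)).filter (PB κ)).card else 0) ≤
        (K.sigma fun κ => (Finset.range (r κ)).filter fun i => ψ κ i = c).card := by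
      rw [Finset.card_sigma]
      refine Finset.sum_le_sum fun κ _ => ?_
      have hsub : ((if f κ 0 ∉ X ∧ lab' (f κ 0) = c then
          ((Finset.range (r κ)).filter (PA κ)) else ∅) ∪
          if f κ (len κ + 1) ∉ X ∧ lab' (f κ (len κ + 1)) = c then
            ((Finset.range (r κ)).filter (PB κ)) else ∅) ⊆
          (Finset.range (r κ)).filter fun i => ψ κ i = c := by
        intro i hi
        simp only [Finset.mem_union] at hi
        rcases hi with hi | hi <;> split_ifs at hi with h1
        · have := Finset.mem_filter.1 hi
          exact Finset.mem_filter.2 ⟨this.1, this.2.2.trans h1.2⟩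
        · simp at hi
        · have := Finset.mem_filter.1 hi
          exact Finset.mem_filter.2 ⟨this.1, this.2.2.2.trans h1.2⟩
        · simp at hi
      refine le_trans (le_of_eq ?_) (Finset.card_le_card hsub)
      rw [Finset.card_union_of_disjoint]
      · split_ifs <;> simp
      · rw [Finset.disjoint_left]
        intro i hi hi'
        split_ifs at hi with h1
        · split_ifs at hi' with h2
          · exact (Finset.mem_filter.1 hi').2.1 (Finset.mem_filter.1 hi).2
          · simp at hi'
        · simp at hi
    have hcard : (K.sigma fun κ => (Finset.range (r κ)).filter fun i => ψ κ i = c).card ≤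
        (Finset.range (l - (cl c).card)).card := by
      refine Finset.card_le_card_of_injOn (fun p =>
        if hh : p.1 ∈ K ∧ p.2 < r p.1 then (φ ⟨(p.1, p.2), hh⟩).2 else 0) ?_ ?_
      · rintro ⟨κ, i⟩ hp
        obtain ⟨h1, h2⟩ := Finset.mem_sigma.1 (Finset.mem_coe.1 hp)
        obtain ⟨h2, h3⟩ := Finset.mem_filter.1 h2
        have hh : κ ∈ K ∧ i < r κ := ⟨h1, Finset.mem_range.1 h2⟩
        simp only [dif_pos hh, Finset.coe_range, Set.mem_Iio]
        have h4 := (Finset.mem_sigma.1 (hφ ⟨(κ, i), hh⟩)).2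
        have h5 : (φ ⟨(κ, i), hh⟩).1 = c := (hψφ _ _ hh).symm.trans h3
        rw [h5] at h4
        exact Finset.mem_range.1 h4
      · rintro ⟨κ, i⟩ hp ⟨κ', i'⟩ hp' he
        obtain ⟨h1, h2⟩ := Finset.mem_sigma.1 (Finset.mem_coe.1 hp)
        obtain ⟨h2, h3⟩ := Finset.mem_filter.1 h2
        have hh : κ ∈ K ∧ i < r κ := ⟨h1, Finset.mem_range.1 h2⟩
        obtain ⟨h1', h2'⟩ := Finset.mem_sigma.1 (Finset.mem_coe.1 hp')
        obtain ⟨h2', h3'⟩ := Finset.mem_filter.1 h2'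
        have hh' : κ' ∈ K ∧ i' < r κ' := ⟨h1', Finset.mem_range.1 h2'⟩
        simp only [dif_pos hh, dif_pos hh'] at he
        have h5 : (φ ⟨(κ, i), hh⟩).1 = c := (hψφ _ _ hh).symm.trans h3
        have h5' : (φ ⟨(κ', i'), hh'⟩).1 = c := (hψφ _ _ hh').symm.trans h3'
        have := hinj (Sigma.ext (h5.trans h5'.symm) (heq_of_eq he))
        obtain ⟨rfl, rfl⟩ := Prod.mk.inj (congrArg Subtype.val this)
        rfl
    rw [Finset.card_range] at hcard
    change (cl c).card + _ ≤ l
    have := hsum.trans hcard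
    exact (Nat.add_le_add_left this _).trans (by omega)
end Sound

/-! ### Hall's condition yields a deletion set -/

section Sound
variable {V : Type*} [DecidableEq V] [Fintype V] {G : SimpleGraph V} {B : Finset V} {lab : V → V}
  {len : V → ℕ} {f : V → ℕ → V} {X : Finset V} {q : V → ℕ} {l : ℕ} {lab' : V → V}

theorem IsPathSystem.lab_mem (hP : IsPathSystem G B lab len f) {v : V} (hv : v ∉ B) :
    lab v ∈ pathLabels B lab := by
  have := hP.label.mem (u := v) hv
  simp only [pathLabels, Finset.mem_filter, Finset.mem_univ, true_and]
  exact ⟨this, hP.label.idem v⟩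

/-- Equal quotients of consecutive numbers. -/
theorem piece_succ {l k q i : ℕ} (hS : ∀ j < q, i + 1 ≠ k + 1 + j * (l + 1)) :
    min q ((i + l - k) / (l + 1)) = min q ((i + 1 + l - k) / (l + 1)) := by
  rcases Nat.lt_or_ge (i + l) k with h | h
  · have h1 : i + l - k = 0 := by omega
    have h2 : i + 1 + l - k = 0 := by omega
    rw [h1, h2]
  have h1 : i + 1 + l - k = (i + l - k) + 1 := by omega
  -- The quotient grows only if `l + 1` divides `i + 1 + l - k`, that is, if `i + 1 = k + 1 + j * (l
  -- + 1)` for some `j`. This is excluded for `j < q`, and for `j ≥ q` the minimum with `q` does not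
  -- change.
  rw [h1, Nat.succ_div]
  split_ifs with hd
  · obtain ⟨c, hc⟩ := hd
    have hc0 : c ≠ 0 := by rintro rfl; simp at hc
    obtain ⟨j, rfl⟩ := Nat.exists_eq_succ_of_ne_zero hc0
    have hj : q ≤ j := by
      by_contra! hlt
      refine hS j hlt ?_
      have : (l + 1) * (j + 1) = j * (l + 1) + (l + 1) := by ring
      rw [Nat.succ_eq_add_one, this] at hc
      omega
    have h2 : j ≤ (i + l - k) / (l + 1) := by
      rw [Nat.le_div_iff_mul_le (by omega)]
      have : (l + 1) * (j + 1) = j * (l + 1) + (l + 1) := by ring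
      rw [Nat.succ_eq_add_one, this] at hc
      omega
    omega
  · simp

-- On a path that is hit, deletions are made at distance `l + 1` from each other, after an initial
-- piece of length `l` if the path starts next to `X`, and otherwise of the length `a κ` granted by
-- the component at its start. By the definition of `rest`, at most `b κ` vertices follow the last
-- deletion, or at most `l` if the path ends next to `X`. The sizes of the components are then
-- bounded by means of a labelling `φ` that is constant along the edges of `G - S`.
open Classical in
theorem exists_deletion (hP : IsPathSystem G B lab len f)
    (hlab' : IsLabel G (kept B lab X q) lab') (h : HallCondition B lab len f X q l lab') :
    ∃ S : Finset V, S.card ≤ X.card + ∑ κ ∈ pathLabels B lab, q κ ∧ SmallComponents G S l := by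
  have hK : ∀ κ ∈ pathLabels B lab, κ ∉ B ∧ lab κ = κ := fun κ hκ => (Finset.mem_filter.1 hκ).2
  obtain ⟨a, b, hab, hsum⟩ := exists_distribution hlab'
    (fun κ hκ => ⟨hP.start κ (hK κ hκ).1, hP.finish κ (hK κ hκ).1⟩) h
  let k : V → ℕ := fun κ => if f κ 0 ∈ X then l else a κ
  -- The minimum with `len κ` moves deletions beyond the end of the path to its last vertex, where
  -- they coincide.
  let S : Finset V := X ∪ (pathLabels B lab).biUnion fun κ =>
    (Finset.range (q κ)).image fun j => f κ (min (len κ) (k κ + 1 + j * (l + 1)))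
  have hSX : ∀ u ∈ B, u ∈ S → u ∈ X := by
    intro u hu hS
    rcases Finset.mem_union.1 hS with h1 | h1
    · exact h1
    · obtain ⟨κ, hκ, h1⟩ := Finset.mem_biUnion.1 h1
      obtain ⟨j, -, rfl⟩ := Finset.mem_image.1 h1
      by_cases h0 : len κ = 0
      · obtain ⟨i, hi, -⟩ := hP.surj κ (hK κ hκ).1
        rw [(hK κ hκ).2] at hi
        have := Finset.mem_Icc.1 hi
        omega
      · exact absurd hu (hP.notMem κ (hK κ hκ).1 _ (Finset.mem_Icc.2 ⟨by omega, by omega⟩))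
  have hSf : ∀ κ ∈ pathLabels B lab, ∀ i ∈ Finset.Icc 1 (len κ), f κ i ∉ S → ∀ j < q κ,
      i ≠ min (len κ) (k κ + 1 + j * (l + 1)) := by
    intro κ hκ i hi hS j hj he
    refine hS (Finset.mem_union_right _ (Finset.mem_biUnion.2 ⟨κ, hκ, Finset.mem_image.2
      ⟨j, Finset.mem_range.2 hj, ?_⟩⟩))
    rw [← he]
  choose! idx hidx hfidx using hP.surj
  -- The vertices before the first deletion form piece `0`; those between deletion number `j`
  -- (counted from `0`) and the next one form piece `j + 1`.
  let piece : V → ℕ := fun v => min (q (lab v)) ((idx v + l - k (lab v)) / (l + 1))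
  have hpiece : ∀ κ ∈ pathLabels B lab, ∀ i ∈ Finset.Icc 1 (len κ),
      piece (f κ i) = min (q κ) ((i + l - k κ) / (l + 1)) := by
    intro κ hκ i hi
    have h1 := hP.lab_eq κ (hK κ hκ).1 (hK κ hκ).2 i hi
    have h2 := hP.notMem κ (hK κ hκ).1 i hi
    have h3 : idx (f κ i) = i := by
      have h4 := hidx _ h2
      have h5 := hfidx _ h2
      rw [h1] at h4 h5
      exact hP.inj κ (hK κ hκ).1 h4 hi h5
    simp only [piece, h1, h3]
  -- `Sum.inl c` marks the kept component `c` and the first and last pieces attached to it;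
  -- `Sum.inr` marks a piece that is cut off from `B \ X`.
  let φ : V → V ⊕ V × ℕ := fun v =>
    if v ∈ kept B lab X q then Sum.inl (lab' v)
    else if piece v = 0 then
      if f (lab v) 0 ∉ X then Sum.inl (lab' (f (lab v) 0)) else Sum.inr (lab v, 0)
    else if piece v = q (lab v) then
      if f (lab v) (len (lab v) + 1) ∉ X then Sum.inl (lab' (f (lab v) (len (lab v) + 1)))
      else Sum.inr (lab v, q (lab v))
    else Sum.inr (lab v, piece v)
  have hkB : ∀ u ∈ B, u ∉ S → u ∈ kept B lab X q := fun u hu hS =>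
    Or.inl ⟨hu, fun h => hS (Finset.mem_union_left _ h)⟩
  have hnk : ∀ v, v ∉ kept B lab X q → v ∉ S → v ∉ B ∧ 1 ≤ q (lab v) := by
    intro v hv hS
    have hB : v ∉ B := fun hB => hv (hkB v hB hS)
    refine ⟨hB, ?_⟩
    by_contra! h0
    exact hv (Or.inr ⟨hB, by omega⟩)
  have hmul : ∀ κ, 1 ≤ q κ → (q κ - 1) * (l + 1) = l * (q κ - 1) + (q κ - 1) := fun κ _ => by ring
  -- the label is constant along the edges of `G - S`
  have hstart : ∀ v, v ∉ kept B lab X q → v ∉ S → idx v = 1 → f (lab v) 0 ∉ S →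
      φ v = Sum.inl (lab' (f (lab v) 0)) := by
    intro v hv hS hi h0
    obtain ⟨hB, hq⟩ := hnk v hv hS
    have hl := hP.lab_mem hB
    have h0X : f (lab v) 0 ∉ X := fun h => h0 (Finset.mem_union_left _ h)
    have hne := hSf _ hl (idx v) (hidx v hB) (by rwa [hfidx v hB]) 0 hq
    have hle := Finset.mem_Icc.1 (hidx v hB)
    have hp : piece v = 0 := by
      simp only [piece]
      rw [Nat.div_eq_of_lt (by omega)]; simp
    simp only [φ, if_neg hv, if_pos hp, if_pos h0X]
  have hlast : ∀ v, v ∉ kept B lab X q → v ∉ S → idx v = len (lab v) →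
      f (lab v) (len (lab v) + 1) ∉ S → φ v = Sum.inl (lab' (f (lab v) (len (lab v) + 1))) := by
    intro v hv hS hi h0
    obtain ⟨hB, hq⟩ := hnk v hv hS
    have hl := hP.lab_mem hB
    have h0X : f (lab v) (len (lab v) + 1) ∉ X := fun h => h0 (Finset.mem_union_left _ h)
    have hne := hSf _ hl (idx v) (hidx v hB) (by rwa [hfidx v hB]) (q (lab v) - 1) (by omega)
    have hle := Finset.mem_Icc.1 (hidx v hB)
    have hp : piece v = q (lab v) := by
      simp only [piece]
      apply min_eq_left
      rw [Nat.le_div_iff_mul_le (by omega)]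
      have : q (lab v) * (l + 1) = (q (lab v) - 1) * (l + 1) + (l + 1) := by
        conv_lhs => rw [← Nat.sub_add_cancel hq]
        ring
      omega
    have hp0 : piece v ≠ 0 := by omega
    simp only [φ, if_neg hv, if_neg hp0, if_pos hp, if_pos h0X]
  have hφ : ∀ u v, u ∉ S → v ∉ S → G.Adj u v → φ u = φ v := by
    have key : ∀ u v, u ∉ S → v ∉ S → G.Adj u v → v ∉ kept B lab X q → φ u = φ v := by
      intro u v hu hv huv hvk
      obtain ⟨hB, hq⟩ := hnk v hvk hv
      have hl := hP.lab_mem hB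
      have hlB := (hK _ hl).1
      have hi := hidx v hB
      have hi' := Finset.mem_Icc.1 hi
      have hvf := hfidx v hB
      have hnb := (hP.adj_iff (lab v) hlB (idx v) hi u).1 (by rw [hvf]; exact huv.symm)
      by_cases huB : u ∈ B
      · have huk := hkB u huB hu
        have hu' : φ u = Sum.inl (lab' u) := by simp only [φ, if_pos huk]
        rcases hnb with h1 | h1
        · have : idx v = 1 := by
            by_contra hne
            exact hP.notMem _ hlB (idx v - 1) (Finset.mem_Icc.2 (by omega)) (h1 ▸ huB)
          rw [this] at h1
          rw [hstart v hvk hv this (by rw [← h1]; exact hu), hu', h1]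
        · have : idx v = len (lab v) := by
            by_contra hne
            exact hP.notMem _ hlB (idx v + 1) (Finset.mem_Icc.2 (by omega)) (h1 ▸ huB)
          rw [this] at h1
          rw [hlast v hvk hv this (by rw [← h1]; exact hu), hu', h1]
      · have hlu : lab u = lab v := hP.label.adj u v huB hB huv
        have huk : u ∉ kept B lab X q := by
          rintro (h1 | h1)
          · exact huB h1.1
          · rw [hlu] at h1; omega
        have hpe : piece u = piece v := by
          have hiu := hidx u huB
          have hiu' := Finset.mem_Icc.1 hiu
          have hfu := hfidx u huB
          rw [hlu] at hiu hiu' hfu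
          simp only [piece, hlu]
          rcases hnb with h1 | h1
          · have h2 : idx u = idx v - 1 := by
              have : idx v ≠ 1 := fun h2 => by
                rw [h2] at h1
                exact huB (h1 ▸ hP.start _ hlB)
              exact hP.inj _ hlB hiu (Finset.mem_coe.2 (Finset.mem_Icc.2 (by omega))) (hfu.trans h1)
            have hv2 : idx v = idx u + 1 := by omega
            rw [hv2]
            refine piece_succ fun j hj he => ?_
            exact hSf _ hl (idx v) hi (by rwa [hvf]) j hj (by omega)
          · have h2 : idx u = idx v + 1 := by
              have : idx v ≠ len (lab v) := fun h2 => by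
                rw [h2] at h1
                exact huB (h1 ▸ hP.finish _ hlB)
              exact hP.inj _ hlB hiu (Finset.mem_coe.2 (Finset.mem_Icc.2 (by omega))) (hfu.trans h1)
            rw [h2]
            refine (piece_succ fun j hj he => ?_).symm
            exact hSf _ hl (idx u) hiu (by rwa [hfu]) j hj (by omega)
        simp only [φ, if_neg hvk, if_neg huk, hlu, hpe]
    intro u v hu hv huv
    by_cases hvk : v ∈ kept B lab X q
    · by_cases huk : u ∈ kept B lab X q
      · simp only [φ, if_pos hvk, if_pos huk]
        rw [hlab'.adj u v huk hvk huv]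
      · exact (key v u hv hu huv.symm huk).symm
    · exact key u v hu hv huv hvk
  -- positions of the vertices of a piece
  have hpos0 : ∀ v, v ∉ kept B lab X q → v ∉ S → piece v = 0 → idx v ≤ k (lab v) := by
    intro v hv hS hp
    obtain ⟨hB, hq⟩ := hnk v hv hS
    simp only [piece] at hp
    have h1 : (idx v + l - k (lab v)) / (l + 1) = 0 := by omega
    have := (Nat.div_eq_zero_iff_lt (by omega)).1 h1
    omega
  have hpos1 : ∀ v, v ∉ kept B lab X q → v ∉ S → piece v ≠ 0 →
      k (lab v) + 1 + (piece v - 1) * (l + 1) < idx v := by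
    intro v hv hS hp
    obtain ⟨hB, hq⟩ := hnk v hv hS
    have hi := Finset.mem_Icc.1 (hidx v hB)
    have hlt : piece v - 1 < q (lab v) := by
      have : piece v ≤ q (lab v) := min_le_left _ _
      omega
    have hne := hSf _ (hP.lab_mem hB) (idx v) (hidx v hB) (by rwa [hfidx v hB]) _ hlt
    have h1 : piece v ≤ (idx v + l - k (lab v)) / (l + 1) := min_le_right _ _
    rw [Nat.le_div_iff_mul_le (by omega)] at h1
    have : piece v * (l + 1) = (piece v - 1) * (l + 1) + (l + 1) := by
      conv_lhs => rw [← Nat.sub_add_cancel (show 1 ≤ piece v by omega)]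
      ring
    omega
  have hpos2 : ∀ v, v ∉ kept B lab X q → v ∉ S → piece v ≠ 0 → piece v ≠ q (lab v) →
      idx v ≤ k (lab v) + 1 + (piece v - 1) * (l + 1) + l := by
    intro v hv hS hp hpq
    have h1 : (idx v + l - k (lab v)) / (l + 1) < piece v + 1 := by
      simp only [piece] at hpq ⊢
      omega
    rw [Nat.div_lt_iff_lt_mul (by omega)] at h1
    have : (piece v + 1) * (l + 1) = (piece v - 1) * (l + 1) + (l + 1) + (l + 1) := by
      conv_lhs => rw [← Nat.sub_add_cancel (show 1 ≤ piece v by omega)]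
      ring
    omega
  -- This is `rest ≤ a κ + b κ`, solved for the part behind the last deletion. The four cases say
  -- which ends lie in `X`; each such end contributes one more `l` to the product in `rest`.
  have hrest : ∀ κ ∈ pathLabels B lab, 1 ≤ q κ →
      len κ - (k κ + 1 + (q κ - 1) * (l + 1)) ≤ if f κ (len κ + 1) ∉ X then b κ else l := by
    intro κ hκ hq
    obtain ⟨h1, h2, h3⟩ := hab κ hκ hq
    rw [hmul κ hq]
    simp only [rest, endCount] at h1
    simp only [k]
    by_cases hx : f κ 0 ∈ X <;> by_cases hy : f κ (len κ + 1) ∈ X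
    · simp only [hx, hy, if_true, not_true_eq_false, if_false] at h1 ⊢
      have e : l * (q κ + (1 + 1) - 1) = l * (q κ - 1) + l + l := by
        rw [show q κ + (1 + 1) - 1 = (q κ - 1) + 1 + 1 by omega]; ring
      rw [e, h2 hx, h3 hy] at h1
      omega
    · simp only [hx, hy, if_true, not_false_eq_true, if_false] at h1 ⊢
      have e : l * (q κ + (1 + 0) - 1) = l * (q κ - 1) + l := by
        rw [show q κ + (1 + 0) - 1 = (q κ - 1) + 1 by omega]; ring
      rw [e, h2 hx] at h1
      omega
    · simp only [hx, hy, if_true, not_true_eq_false, if_false] at h1 ⊢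
      have e : l * (q κ + (0 + 1) - 1) = l * (q κ - 1) + l := by
        rw [show q κ + (0 + 1) - 1 = (q κ - 1) + 1 by omega]; ring
      rw [e, h3 hy] at h1
      omega
    · simp only [hx, hy, not_false_eq_true, if_true, if_false] at h1 ⊢
      have e : l * (q κ + (0 + 0) - 1) = l * (q κ - 1) := by
        rw [show q κ + (0 + 0) - 1 = (q κ - 1) by omega]
      rw [e] at h1
      omega
  have himg : ∀ (T : Finset V) (κ : V) (i j : ℕ), (∀ v ∈ T, v ∉ B ∧ lab v = κ ∧ i < idx v ∧ idx v ≤ j) →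
      T.card ≤ j - i := by
    intro T κ i j hT
    have : T ⊆ (Finset.Ioc i j).image (f κ) := fun v hv => by
      obtain ⟨h1, rfl, h3, h4⟩ := hT v hv
      exact Finset.mem_image.2 ⟨idx v, Finset.mem_Ioc.2 ⟨h3, h4⟩, hfidx v h1⟩
    exact (Finset.card_le_card this).trans (Finset.card_image_le.trans (by simp))
  refine ⟨S, ?_, ?_⟩
  · refine (Finset.card_union_le _ _).trans (Nat.add_le_add_left ?_ _)
    refine Finset.card_biUnion_le.trans (Finset.sum_le_sum fun κ _ => ?_)
    exact Finset.card_image_le.trans (by simp)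
  · intro v hv
    have hsub : {u | (within G {w | w ∉ S}).Reachable v u} ⊆
        ((Finset.univ.filter fun u => u ∉ S ∧ φ u = φ v : Finset V) : Set V) := by
      intro u hu
      simp only [Finset.coe_filter, Finset.mem_univ, true_and, Set.mem_ofPred_eq]
      exact ⟨within_reachable_mem (G := G) hu hv, (eq_of_within_reachable (φ := φ)
        (fun x y hx hy => hφ x y hx hy) hu).symm⟩
    refine (Set.ncard_le_ncard hsub).trans ?_
    rw [Set.ncard_coe_finset]
    have hcase : ∀ u, u ∉ S → (∃ c ∈ kept B lab X q, lab' c = c ∧ φ u = Sum.inl c) ∨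
        ∃ p, φ u = Sum.inr p := by
      intro u hu
      have hend : ∀ w ∈ B, w ∉ X → ∃ c ∈ kept B lab X q, lab' c = c ∧ lab' w = c :=
        fun w hw hwX => ⟨lab' w, hlab'.mem (Or.inl ⟨hw, hwX⟩), hlab'.idem w, rfl⟩
      by_cases huk : u ∈ kept B lab X q
      · exact Or.inl ⟨lab' u, hlab'.mem huk, hlab'.idem u, by simp only [φ, if_pos huk]⟩
      have hlB := (hK _ (hP.lab_mem (hnk u huk hu).1)).1
      simp only [φ, if_neg huk]
      split_ifs with h1 h2 h3 h4
      · exact Or.inr ⟨_, rfl⟩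
      · obtain ⟨c, hc, hc', hc''⟩ := hend _ (hP.start _ hlB) h2
        exact Or.inl ⟨c, hc, hc', by rw [hc'']⟩
      · exact Or.inr ⟨_, rfl⟩
      · obtain ⟨c, hc, hc', hc''⟩ := hend _ (hP.finish _ hlB) h4
        exact Or.inl ⟨c, hc, hc', by rw [hc'']⟩
      · exact Or.inr ⟨_, rfl⟩
    -- The vertices with the label of `v` are either a kept component with its attached first and
    -- last pieces, bounded by `hsum`, or part of a single piece, bounded by the distance of the
    -- deletions or by `hrest`.
    rcases hcase v hv with ⟨c, hc, hcc, hφc⟩ | ⟨⟨κ, j⟩, hφp⟩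
    · rw [hφc]
      refine le_trans ?_ (hsum c hc hcc)
      let PT : V → Finset V := fun κ => Finset.univ.filter fun u => u ∉ S ∧ u ∉ kept B lab X q ∧
        lab u = κ ∧ φ u = Sum.inl c
      have hcover : (Finset.univ.filter fun u => u ∉ S ∧ φ u = Sum.inl c : Finset V) ⊆
          (Finset.univ.filter fun u => u ∈ kept B lab X q ∧ lab' u = c : Finset V) ∪
            ((pathLabels B lab).filter fun κ => 1 ≤ q κ).biUnion PT := by
        intro u hu
        obtain ⟨-, huS, huφ⟩ := Finset.mem_filter.1 hu
        by_cases huk : u ∈ kept B lab X q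
        · refine Finset.mem_union_left _ (Finset.mem_filter.2 ⟨Finset.mem_univ _, huk, ?_⟩)
          simpa only [φ, if_pos huk, Sum.inl.injEq] using huφ
        · obtain ⟨hB, hq⟩ := hnk u huk huS
          exact Finset.mem_union_right _ (Finset.mem_biUnion.2 ⟨lab u,
            Finset.mem_filter.2 ⟨hP.lab_mem hB, hq⟩,
            Finset.mem_filter.2 ⟨Finset.mem_univ _, huS, huk, rfl, huφ⟩⟩)
      refine (Finset.card_le_card hcover).trans ((Finset.card_union_le _ _).trans
        (Nat.add_le_add_left (Finset.card_biUnion_le.trans (Finset.sum_le_sum fun κ hκ => ?_)) _))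
      obtain ⟨hκ, hq⟩ := Finset.mem_filter.1 hκ
      have hsplit : PT κ ⊆ (PT κ).filter (fun u => piece u = 0) ∪
          (PT κ).filter (fun u => piece u ≠ 0) := by
        rw [Finset.filter_union_filter_not_eq]
      refine (Finset.card_le_card hsplit).trans ((Finset.card_union_le _ _).trans
        (Nat.add_le_add ?_ ?_))
      · split_ifs with hc'
        · refine (himg _ κ 0 (a κ) fun u hu => ?_).trans (by omega)
          obtain ⟨hu, hp⟩ := Finset.mem_filter.1 hu
          obtain ⟨-, huS, huk, hlu, huφ⟩ := Finset.mem_filter.1 hu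
          obtain ⟨hB, -⟩ := hnk u huk huS
          have h1 := hpos0 u huk huS hp
          rw [hlu] at h1
          simp only [k, if_neg hc'.1] at h1
          exact ⟨hB, hlu, (Finset.mem_Icc.1 (hidx u hB)).1, h1⟩
        · rw [Nat.le_zero, Finset.card_eq_zero]
          refine Finset.filter_false_of_mem fun u hu hp => hc' ?_
          obtain ⟨-, huS, huk, hlu, huφ⟩ := Finset.mem_filter.1 hu
          simp only [φ, if_neg huk, if_pos hp, hlu] at huφ
          split_ifs at huφ with h1
          exact ⟨h1, by simpa using huφ⟩
      · have hmem : ∀ u ∈ (PT κ).filter (fun u => piece u ≠ 0), u ∉ B ∧ lab u = κ ∧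
            k κ + 1 + (q κ - 1) * (l + 1) < idx u ∧ idx u ≤ len κ ∧ f κ (len κ + 1) ∉ X ∧
              lab' (f κ (len κ + 1)) = c := by
          intro u hu
          obtain ⟨hu, hp⟩ := Finset.mem_filter.1 hu
          obtain ⟨-, huS, huk, hlu, huφ⟩ := Finset.mem_filter.1 hu
          obtain ⟨hB, -⟩ := hnk u huk huS
          have h1 := hpos1 u huk huS hp
          have h2 := (Finset.mem_Icc.1 (hidx u hB)).2
          simp only [φ, if_neg huk, if_neg hp, hlu] at huφ
          split_ifs at huφ with h3 h4
          rw [hlu] at h1 h2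
          rw [h3] at h1
          exact ⟨hB, hlu, h1, h2, h4, by simpa using huφ⟩
        split_ifs with hc'
        · have h1 := himg _ κ _ _ fun u hu =>
            ⟨(hmem u hu).1, (hmem u hu).2.1, (hmem u hu).2.2.1, (hmem u hu).2.2.2.1⟩
          have h2 := hrest κ hκ hq
          rw [if_pos hc'.1] at h2
          exact h1.trans h2
        · rw [Nat.le_zero, Finset.card_eq_zero, Finset.eq_empty_iff_forall_notMem]
          exact fun u hu => hc' (hmem u hu).2.2.2.2
    · rw [hφp]
      have hmem : ∀ u ∈ (Finset.univ.filter fun u => u ∉ S ∧ φ u = Sum.inr (κ, j) : Finset V),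
          u ∉ B ∧ 1 ≤ q κ ∧ lab u = κ ∧ 1 ≤ idx u ∧ ((j = 0 ∧ idx u ≤ l) ∨
            (j ≠ 0 ∧ j ≠ q κ ∧ k κ + 1 + (j - 1) * (l + 1) < idx u ∧
              idx u ≤ k κ + 1 + (j - 1) * (l + 1) + l) ∨
            (j ≠ 0 ∧ j = q κ ∧ k κ + 1 + (q κ - 1) * (l + 1) < idx u ∧ idx u ≤ len κ ∧
              f κ (len κ + 1) ∈ X)) := by
        intro u hu
        obtain ⟨-, huS, huφ⟩ := Finset.mem_filter.1 hu
        have huk : u ∉ kept B lab X q := fun huk => by simp [φ, if_pos huk] at huφ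
        obtain ⟨hB, hq⟩ := hnk u huk huS
        have hi := Finset.mem_Icc.1 (hidx u hB)
        have h0 := hpos0 u huk huS
        have h1 := hpos1 u huk huS
        have h2 := hpos2 u huk huS
        simp only [φ, if_neg huk] at huφ
        split_ifs at huφ with hp h4 hpq h5
        · simp only [Sum.inr.injEq, Prod.mk.injEq] at huφ
          obtain ⟨rfl, rfl⟩ := huφ
          have h0 := h0 hp
          simp only [k, if_pos h4] at h0
          exact ⟨hB, hq, rfl, hi.1, Or.inl ⟨rfl, h0⟩⟩
        · simp only [Sum.inr.injEq, Prod.mk.injEq] at huφ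
          obtain ⟨rfl, rfl⟩ := huφ
          have h1 := h1 hp
          rw [hpq] at h1
          exact ⟨hB, hq, rfl, hi.1, Or.inr (Or.inr ⟨by omega, rfl, h1, hi.2, h5⟩)⟩
        · simp only [Sum.inr.injEq, Prod.mk.injEq] at huφ
          obtain ⟨rfl, rfl⟩ := huφ
          exact ⟨hB, hq, rfl, hi.1, Or.inr (Or.inl ⟨hp, hpq, h1 hp, h2 hp hpq⟩)⟩
      have hvm := hmem v (Finset.mem_filter.2 ⟨Finset.mem_univ _, hv, hφp⟩)
      have hκ : κ ∈ pathLabels B lab := hvm.2.2.1 ▸ hP.lab_mem hvm.1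
      by_cases hj0 : j = 0
      · refine (himg _ κ 0 l fun u hu => ?_).trans (by omega)
        obtain ⟨h1, h2, h3, h4, h5⟩ := hmem u hu
        exact ⟨h1, h3, h4, by omega⟩
      by_cases hjq : j = q κ
      · refine (himg _ κ (k κ + 1 + (q κ - 1) * (l + 1)) (len κ) fun u hu => ?_).trans ?_
        · obtain ⟨h1, h2, h3, h4, h5⟩ := hmem u hu
          exact ⟨h1, h3, by tauto, by tauto⟩
        · have := hrest κ hκ hvm.2.1
          rwa [if_neg (not_not.2 (by tauto))] at this
      · refine (himg _ κ (k κ + 1 + (j - 1) * (l + 1)) (k κ + 1 + (j - 1) * (l + 1) + l)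
          fun u hu => ?_).trans (by omega)
        obtain ⟨h1, h2, h3, h4, h5⟩ := hmem u hu
        exact ⟨h1, h3, by tauto, by tauto⟩
end Sound

/-- If a sequence `1, …, p` is hit at the positions in `T`, the first and the last of which are
`i₀` and `i₁`, and the gaps have length at most `l`, then `p` is bounded. -/
theorem length_le_of_gaps {p l i₀ i₁ : ℕ} {T : Finset ℕ} (hT : T ⊆ Finset.Icc 1 p) (h₀ : i₀ ∈ T)
    (h₁ : i₁ ∈ T) (hmin : ∀ i ∈ T, i₀ ≤ i) (hmax : ∀ i ∈ T, i ≤ i₁)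
    (hgap : ∀ i j, i ≤ j → j ≤ p → (∀ k, i < k → k ≤ j → k ∉ T) → j - i ≤ l) :
    p ≤ (i₀ - 1) + (p - i₁) + T.card + l * (T.card - 1) := by
  -- Induction along the hits: at most `l` positions lie between a hit `i` and the preceding hit
  -- `j`.
  have key : ∀ i ∈ T, i ≤ (i₀ - 1) + (T.filter (· ≤ i)).card + l * ((T.filter (· ≤ i)).card - 1) := by
    intro i
    induction i using Nat.strong_induction_on with
    | _ i ih =>
      intro hi
      have hi1 := Finset.mem_Icc.1 (hT hi)
      rcases (hmin i hi).eq_or_lt with rfl | hlt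
      · have : 1 ≤ (T.filter (· ≤ i₀)).card :=
          Finset.card_pos.2 ⟨i₀, Finset.mem_filter.2 ⟨hi, le_rfl⟩⟩
        omega
      · have hne : (T.filter (· < i)).Nonempty := ⟨i₀, Finset.mem_filter.2 ⟨h₀, hlt⟩⟩
        set j := (T.filter (· < i)).max' hne with hj
        have hjm := Finset.mem_filter.1 (Finset.max'_mem _ hne)
        rw [← hj] at hjm
        have hgap' := hgap j (i - 1) (by omega) (by omega) (fun k hk hk' hkT => by
          have : k ≤ j := Finset.le_max' _ _ (Finset.mem_filter.2 ⟨hkT, by omega⟩)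
          omega)
        have hcard : (T.filter (· ≤ j)).card + 1 ≤ (T.filter (· ≤ i)).card := by
          have : insert i (T.filter (· ≤ j)) ⊆ T.filter (· ≤ i) := by
            intro k hk
            rcases Finset.mem_insert.1 hk with rfl | hk
            · exact Finset.mem_filter.2 ⟨hi, le_rfl⟩
            · have := Finset.mem_filter.1 hk
              exact Finset.mem_filter.2 ⟨this.1, by omega⟩
          have h2 := Finset.card_le_card this
          rwa [Finset.card_insert_of_notMem] at h2
          intro h3
          have := (Finset.mem_filter.1 h3).2
          omega
        have h1 : 1 ≤ (T.filter (· ≤ j)).card :=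
          Finset.card_pos.2 ⟨j, Finset.mem_filter.2 ⟨hjm.1, le_rfl⟩⟩
        have h2 := ih j hjm.2 hjm.1
        have h3 : l * ((T.filter (· ≤ j)).card - 1) + l ≤ l * ((T.filter (· ≤ i)).card - 1) := by
          rw [← Nat.mul_succ]
          exact Nat.mul_le_mul_left _ (by omega)
        omega
  have h2 := key i₁ h₁
  rw [Finset.filter_true_of_mem hmax] at h2
  have := Finset.mem_Icc.1 (hT h₁)
  omega

theorem reachable_of_path {V : Type*} {G : SimpleGraph V} {P : V → Prop} {g : ℕ → V} {i j : ℕ} (hij : i ≤ j)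
    (hadj : ∀ k, i ≤ k → k < j → G.Adj (g k) (g (k + 1))) (hP : ∀ k, i ≤ k → k ≤ j → P (g k)) :
    (within G {v | P v}).Reachable (g i) (g j) := by
  induction j, hij using Nat.le_induction with
  | base => rfl
  | succ j hj ih =>
    refine (ih (fun k h1 h2 => hadj k h1 (by omega)) (fun k h1 h2 => hP k h1 (by omega))).trans ?_
    exact SimpleGraph.Adj.reachable ⟨hadj j hj (by omega), hP j hj (by omega), hP _ (by omega) le_rfl⟩

theorem IsPathSystem.adj_succ {V : Type*} {G : SimpleGraph V} {B : Finset V} {lab : V → V}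
    {len : V → ℕ} {f : V → ℕ → V} (hP : IsPathSystem G B lab len f) {κ : V} (hκ : κ ∉ B)
    (hlen : 1 ≤ len κ) {i : ℕ} (hi : i ≤ len κ) : G.Adj (f κ i) (f κ (i + 1)) := by
  rcases Nat.eq_zero_or_pos i with rfl | h0
  · exact ((hP.adj_iff κ hκ 1 (Finset.mem_Icc.2 ⟨le_rfl, hlen⟩) _).2 (Or.inl rfl)).symm
  · exact (hP.adj_iff κ hκ i (Finset.mem_Icc.2 ⟨h0, hi⟩) _).2 (Or.inr rfl)

/-! ### Every deletion set satisfies Hall's condition -/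

section Complete
variable {V : Type*} [DecidableEq V] [Fintype V] {G : SimpleGraph V} {B : Finset V} {lab : V → V}
  {len : V → ℕ} {f : V → ℕ → V} {X : Finset V} {q : V → ℕ} {l : ℕ} {lab' : V → V}

theorem IsPathSystem.one_le_len (hP : IsPathSystem G B lab len f) {κ : V}
    (hκ : κ ∈ pathLabels B lab) : 1 ≤ len κ := by
  obtain ⟨-, h1, h2⟩ := Finset.mem_filter.1 hκ
  obtain ⟨i, hi, -⟩ := hP.surj κ h1
  rw [h2] at hi
  have := Finset.mem_Icc.1 hi
  omega

/-- The number of vertices of a path that are deleted, up to the number that always suffices. -/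
def hitCount (len : V → ℕ) (f : V → ℕ → V) (S : Finset V) (l : ℕ) (κ : V) : ℕ :=
  min ((Finset.Icc 1 (len κ)).filter fun i => f κ i ∈ S).card (len κ / (l + 1) + 2)

variable {S : Finset V}

/-- Consecutive undeleted vertices of a path lie in one component of `G - S`. The run is half-open,
so that `i = 0` and `j = len κ` cover the runs at the two ends. -/
theorem gap_le (hP : IsPathSystem G B lab len f) (hS : SmallComponents G S l) {κ : V}
    (hκ : κ ∈ pathLabels B lab) {i j : ℕ} (hij : i ≤ j) (hj : j ≤ len κ)
    (h : ∀ k, i < k → k ≤ j → f κ k ∉ S) : j - i ≤ l := by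
  have hκB := (Finset.mem_filter.1 hκ).2.1
  rcases hij.eq_or_lt with rfl | hlt
  · simp
  have hl := hP.one_le_len hκ
  have hsub : (((Finset.Ioc i j).image (f κ) : Finset V) : Set V) ⊆
      {u | (within G {w | w ∉ S}).Reachable (f κ (i + 1)) u} := by
    intro u hu
    obtain ⟨k, hk, rfl⟩ := Finset.mem_image.1 (Finset.mem_coe.1 hu)
    rw [Finset.mem_Ioc] at hk
    exact reachable_of_path (P := (· ∉ S)) (g := f κ) (by omega)
      (fun m h1 h2 => hP.adj_succ hκB hl (by omega)) (fun m h1 h2 => h m (by omega) (by omega))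
  have h1 := Set.ncard_le_ncard hsub (Set.toFinite _)
  rw [Set.ncard_coe_finset, Finset.card_image_of_injOn, Nat.card_Ioc] at h1
  · exact h1.trans (hS _ (h _ (by omega) (by omega)))
  · refine (hP.inj κ hκB).mono fun k hk => ?_
    have := Finset.mem_Ioc.1 (Finset.mem_coe.1 hk)
    exact Finset.mem_coe.2 (Finset.mem_Icc.2 ⟨by omega, by omega⟩)

/-- With `t` hits there are at most `t + 1` runs of at most `l` vertices each, so `len κ ≤ t + (t +
1) * l < (t + 1) * (l + 1)`. Relative to `len κ / (l + 1)` only three values remain to be guessed.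
-/
theorem hitCount_bounds (hP : IsPathSystem G B lab len f) (hS : SmallComponents G S l) {κ : V}
    (hκ : κ ∈ pathLabels B lab) :
    len κ / (l + 1) ≤ hitCount len f S l κ ∧ hitCount len f S l κ ≤ len κ / (l + 1) + 2 := by
  refine ⟨le_min ?_ (by omega), min_le_right _ _⟩
  set T := (Finset.Icc 1 (len κ)).filter fun i => f κ i ∈ S with hT
  have hTm : ∀ k, 1 ≤ k → k ≤ len κ → k ∉ T → f κ k ∉ S := fun k h1 h2 h3 h4 =>
    h3 (Finset.mem_filter.2 ⟨Finset.mem_Icc.2 ⟨h1, h2⟩, h4⟩)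
  suffices len κ ≤ T.card + (T.card + 1) * l by
    rw [← Nat.lt_succ_iff, Nat.div_lt_iff_lt_mul (by omega)]
    have e : (T.card).succ * (l + 1) = T.card + (T.card + 1) * l + 1 := by
      rw [Nat.succ_eq_add_one]; ring
    omega
  rcases T.eq_empty_or_nonempty with h0 | hne
  · have := gap_le hP hS hκ (Nat.zero_le (len κ)) le_rfl
      (fun k h1 h2 => hTm k h1 h2 (by rw [h0]; simp))
    rw [h0]
    simpa using this
  · have hsub : T ⊆ Finset.Icc 1 (len κ) := Finset.filter_subset _ _
    have m0 := Finset.mem_Icc.1 (hsub (T.min'_mem hne))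
    have m1 := Finset.mem_Icc.1 (hsub (T.max'_mem hne))
    have h1 := length_le_of_gaps hsub (T.min'_mem hne) (T.max'_mem hne)
      (fun i hi => T.min'_le i hi) (fun i hi => T.le_max' i hi) (l := l)
      (fun i j hij hj hh => gap_le hP hS hκ hij hj fun k h2 h3 => hTm k (by omega) (by omega) (hh k h2 h3))
    have h2 := gap_le hP hS hκ (Nat.zero_le (T.min' hne - 1)) (by omega) (fun k h1 h2 =>
      hTm k h1 (by omega) fun h3 => by have := T.min'_le k h3; omega)
    have h3 := gap_le hP hS hκ m1.2 le_rfl (fun k h1 h2 =>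
      hTm k (by omega) (by omega) fun h3 => by have := T.le_max' k h3; omega)
    have hc : 1 ≤ T.card := Finset.card_pos.2 hne
    have e : (T.card + 1) * l = l * (T.card - 1) + l + l := by
      obtain ⟨c, hc'⟩ := Nat.exists_eq_add_of_le hc
      rw [hc', Nat.add_sub_cancel_left]; ring
    omega

/-- The paths are disjoint from each other and from `B`, and capping only lowers the counts. Hence
the guess read off from `S` costs no more than `S`. -/
theorem card_hits_le (hP : IsPathSystem G B lab len f) (S : Finset V) (l : ℕ) :
    (S ∩ B).card + ∑ κ ∈ pathLabels B lab, hitCount len f S l κ ≤ S.card := by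
  have hK : ∀ κ ∈ pathLabels B lab, κ ∉ B ∧ lab κ = κ := fun κ hκ => (Finset.mem_filter.1 hκ).2
  have h1 : ∑ κ ∈ pathLabels B lab, hitCount len f S l κ ≤ (S \ B).card := by
    calc _ ≤ ∑ κ ∈ pathLabels B lab, ((S \ B).filter fun v => lab v = κ).card := by
          refine Finset.sum_le_sum fun κ hκ => (min_le_left _ _).trans ?_
          refine Finset.card_le_card_of_injOn (f κ) ?_ ?_
          · intro i hi
            obtain ⟨hi, hiS⟩ := Finset.mem_filter.1 (Finset.mem_coe.1 hi)
            exact Finset.mem_coe.2 (Finset.mem_filter.2 ⟨Finset.mem_sdiff.2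
              ⟨hiS, hP.notMem κ (hK κ hκ).1 i hi⟩, hP.lab_eq κ (hK κ hκ).1 (hK κ hκ).2 i hi⟩)
          · exact (hP.inj κ (hK κ hκ).1).mono (Finset.coe_subset.2 (Finset.filter_subset _ _))
      _ = (S \ B).card := by
          refine (Finset.card_eq_sum_card_fiberwise fun v hv => ?_).symm
          exact hP.lab_mem (Finset.mem_sdiff.1 (Finset.mem_coe.1 hv)).2
  have := Finset.card_inter_add_card_sdiff S B
  omega

-- For a confined path let `Z κ` be the vertices before the first hit, if the path starts in `F`,
-- and those behind the last hit, if it ends in `F`. The inner gaps and the pieces next to `X` have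
-- at most `l` vertices each, so `Z κ` has at least `rest` elements. On the other hand `F` and all
-- `Z κ` are disjoint and lie in the components of `G - S` of the labels in `F`, each of which has
-- at most `l` vertices.
open Classical in
theorem hallCondition_of_small (hP : IsPathSystem G B lab len f) (hS : SmallComponents G S l)
    (hlab' : IsLabel G (kept B lab (S ∩ B) (hitCount len f S l)) lab') :
    HallCondition B lab len f (S ∩ B) (hitCount len f S l) l lab' := by
  have hK : ∀ κ ∈ pathLabels B lab, κ ∉ B ∧ lab κ = κ := fun κ hκ => (Finset.mem_filter.1 hκ).2
  set q := hitCount len f S l with hq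
  set X := S ∩ B with hX
  let T : V → Finset ℕ := fun κ => (Finset.Icc 1 (len κ)).filter fun i => f κ i ∈ S
  have hTm : ∀ κ k, 1 ≤ k → k ≤ len κ → k ∉ T κ → f κ k ∉ S := fun κ k h1 h2 h3 h4 =>
    h3 (Finset.mem_filter.2 ⟨Finset.mem_Icc.2 ⟨h1, h2⟩, h4⟩)
  have hqT : ∀ κ, q κ = min (T κ).card (len κ / (l + 1) + 2) := fun κ => rfl
  -- The cap `len κ / (l + 1) + 2` is positive, so `q κ = 0` means that `S` really avoids the path.
  have hkS : ∀ u ∈ kept B lab X q, u ∉ S := by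
    rintro u (⟨h1, h2⟩ | ⟨h1, h2⟩) hu
    · exact h2 (Finset.mem_inter.2 ⟨hu, h1⟩)
    · obtain ⟨i, hi, hfi⟩ := hP.surj u h1
      have : 0 < (T (lab u)).card := Finset.card_pos.2
        ⟨i, Finset.mem_filter.2 ⟨hi, by rw [hfi]; exact hu⟩⟩
      have h3 : 0 < q (lab u) := by rw [hqT]; exact lt_min this (Nat.succ_pos _)
      exact h3.ne' h2
  intro F hF hFcl
  let i₀ : V → ℕ := fun κ => if h : (T κ).Nonempty then (T κ).min' h else 0
  let i₁ : V → ℕ := fun κ => if h : (T κ).Nonempty then (T κ).max' h else 0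
  let J : V → Finset ℕ := fun κ => (if f κ 0 ∈ F then Finset.Icc 1 (i₀ κ - 1) else ∅) ∪
    if f κ (len κ + 1) ∈ F then Finset.Ioc (i₁ κ) (len κ) else ∅
  let Z : V → Finset V := fun κ => (J κ).image (f κ)
  let C := confined B lab len f X q F
  have hC : ∀ κ ∈ C, κ ∈ pathLabels B lab ∧ 1 ≤ q κ ∧ (f κ 0 ∈ X ∨ f κ 0 ∈ F) ∧
    (f κ (len κ + 1) ∈ X ∨ f κ (len κ + 1) ∈ F) := fun κ hκ => Finset.mem_filter.1 hκ
  have hne : ∀ κ ∈ C, (T κ).Nonempty := fun κ hκ => by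
    have h1 := (hC κ hκ).2.1
    rw [hqT] at h1
    exact Finset.card_pos.1 (by omega)
  have hi₀ : ∀ κ ∈ C, i₀ κ ∈ T κ ∧ ∀ i ∈ T κ, i₀ κ ≤ i := fun κ hκ => by
    simp only [i₀, dif_pos (hne κ hκ)]
    exact ⟨Finset.min'_mem _ _, fun i hi => Finset.min'_le _ _ hi⟩
  have hi₁ : ∀ κ ∈ C, i₁ κ ∈ T κ ∧ ∀ i ∈ T κ, i ≤ i₁ κ := fun κ hκ => by
    simp only [i₁, dif_pos (hne κ hκ)]
    exact ⟨Finset.max'_mem _ _, fun i hi => Finset.le_max' _ _ hi⟩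
  have hTsub : ∀ κ, T κ ⊆ Finset.Icc 1 (len κ) := fun κ => Finset.filter_subset _ _
  have hr : ∀ κ ∈ C, rest len f X q l κ ≤ (Z κ).card := by
    intro κ hκ
    obtain ⟨hκK, hq1, hst, hsp⟩ := hC κ hκ
    obtain ⟨h0T, h0m⟩ := hi₀ κ hκ
    obtain ⟨h1T, h1m⟩ := hi₁ κ hκ
    have m0 := Finset.mem_Icc.1 (hTsub κ h0T)
    have m1 := Finset.mem_Icc.1 (hTsub κ h1T)
    have hZ : (Z κ).card = (J κ).card := by
      refine Finset.card_image_of_injOn ((hP.inj κ (hK κ hκK).1).mono fun i hi => ?_)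
      simp only [J, Finset.coe_union, Set.mem_union, Finset.mem_coe] at hi
      rw [Finset.mem_coe, Finset.mem_Icc]
      rcases hi with hi | hi <;> split_ifs at hi <;> simp at hi <;> omega
    have hJ : (J κ).card = (if f κ 0 ∈ F then i₀ κ - 1 else 0) +
        if f κ (len κ + 1) ∈ F then len κ - i₁ κ else 0 := by
      rw [Finset.card_union_of_disjoint]
      · split_ifs <;> simp
      · rw [Finset.disjoint_left]
        intro i hi hi'
        have := h0m _ h1T
        split_ifs at hi hi' <;> simp at hi hi'
        omega
    have hlen := length_le_of_gaps (hTsub κ) h0T h1T h0m h1m (l := l)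
      (fun i j hij hj hh => gap_le hP hS hκK hij hj
        fun k h2 h3 => hTm κ k (by omega) (by omega) (hh k h2 h3))
    have hl0 := gap_le hP hS hκK (Nat.zero_le (i₀ κ - 1)) (by omega) (fun k h1 h2 =>
      hTm κ k h1 (by omega) fun h3 => by have := h0m k h3; omega)
    have hl1 := gap_le hP hS hκK m1.2 le_rfl (fun k h1 h2 =>
      hTm κ k (by omega) (by omega) fun h3 => by have := h1m k h3; omega)
    rw [hZ, hJ]
    unfold rest
    rcases le_total (T κ).card (len κ / (l + 1) + 2) with hc | hc
    · have hqc : q κ = (T κ).card := by rw [hqT, min_eq_left hc]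
      rw [← hqc] at hlen
      unfold endCount
      have hXF : ∀ u, u ∈ X → u ∉ F := fun u hu hu' =>
        hkS u (hF u hu') (Finset.mem_inter.1 hu).1
      rcases hst with hx | hx <;> rcases hsp with hy | hy
      · simp only [hx, hy, if_true, if_neg (hXF _ hx), if_neg (hXF _ hy)]
        have e : l * (q κ + (1 + 1) - 1) = l * (q κ - 1) + l + l := by
          rw [show q κ + (1 + 1) - 1 = (q κ - 1) + 1 + 1 by omega]; ring
        omega
      · have hy' : f κ (len κ + 1) ∉ X := fun h => hXF _ h hy
        simp only [hx, hy, hy', if_true, if_false, if_neg (hXF _ hx)]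
        have e : l * (q κ + (1 + 0) - 1) = l * (q κ - 1) + l := by
          rw [show q κ + (1 + 0) - 1 = (q κ - 1) + 1 by omega]; ring
        omega
      · have hx' : f κ 0 ∉ X := fun h => hXF _ h hx
        simp only [hx, hy, hx', if_true, if_false, if_neg (hXF _ hy)]
        have e : l * (q κ + (0 + 1) - 1) = l * (q κ - 1) + l := by
          rw [show q κ + (0 + 1) - 1 = (q κ - 1) + 1 by omega]; ring
        omega
      · have hx' : f κ 0 ∉ X := fun h => hXF _ h hx
        have hy' : f κ (len κ + 1) ∉ X := fun h => hXF _ h hy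
        simp only [hx, hy, hx', hy', if_true, if_false]
        simp only [add_zero]
        omega
    -- At the cap nothing remains: `q κ + l * (q κ - 1)` already exceeds `len κ`.
    · have hqc : q κ = len κ / (l + 1) + 2 := by rw [hqT, min_eq_right hc]
      have h1 : len κ < (len κ / (l + 1) + 1) * (l + 1) := by
        rw [← Nat.div_lt_iff_lt_mul (by omega)]; omega
      have h2 : l * (len κ / (l + 1) + 1) ≤ l * (q κ + endCount len f X κ - 1) :=
        Nat.mul_le_mul_left _ (by omega)
      have e : (len κ / (l + 1) + 1) * (l + 1) =
          l * (len κ / (l + 1) + 1) + (len κ / (l + 1) + 1) := by ring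
      omega
  have hZP : ∀ κ ∈ C, ∀ u ∈ Z κ, u ∉ B ∧ lab u = κ := by
    intro κ hκ u hu
    obtain ⟨hκK, -⟩ := hC κ hκ
    obtain ⟨h0T, h0m⟩ := hi₀ κ hκ
    obtain ⟨h1T, h1m⟩ := hi₁ κ hκ
    have m0 := Finset.mem_Icc.1 (hTsub κ h0T)
    obtain ⟨i, hi, rfl⟩ := Finset.mem_image.1 hu
    have hi' : i ∈ Finset.Icc 1 (len κ) := by
      rw [Finset.mem_Icc]
      rcases Finset.mem_union.1 hi with hi | hi <;> split_ifs at hi <;> simp at hi <;> omega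
    exact ⟨hP.notMem κ (hK κ hκK).1 i hi', hP.lab_eq κ (hK κ hκK).1 (hK κ hκK).2 i hi'⟩
  have hcard : F.card + ∑ κ ∈ C, (Z κ).card = (F ∪ C.biUnion Z).card := by
    rw [Finset.card_union_of_disjoint, Finset.card_biUnion]
    · intro κ hκ κ' hκ' hne'
      rw [Function.onFun, Finset.disjoint_left]
      intro u hu hu'
      exact hne' ((hZP κ hκ u hu).2.symm.trans (hZP κ' hκ' u hu').2)
    · rw [Finset.disjoint_left]
      intro u hu hu'
      obtain ⟨κ, hκ, hu'⟩ := Finset.mem_biUnion.1 hu'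
      obtain ⟨h1, h2⟩ := hZP κ hκ u hu'
      have h3 := (hC κ hκ).2.1
      rcases hF u hu with h4 | h4
      · exact h1 h4.1
      · rw [h2] at h4; omega
  -- every vertex is connected in `G - S` to the label of a component of `F`
  have hconn : ∀ u ∈ F ∪ C.biUnion Z, ∃ c ∈ F.filter fun c => lab' c = c,
      (within G {w | w ∉ S}).Reachable c u := by
    have hmono := within_mono (G := G) (U := kept B lab X q) (U' := {w | w ∉ S}) hkS
    have hFu : ∀ u ∈ F, lab' u ∈ (F.filter fun c => lab' c = c) ∧
        (within G {w | w ∉ S}).Reachable (lab' u) u := fun u hu =>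
      ⟨Finset.mem_filter.2 ⟨hFcl u hu _ (hlab'.mem (hF u hu)) (hlab'.idem u), hlab'.idem u⟩,
        ((hlab'.reach u (hF u hu)).mono hmono).symm⟩
    intro u hu
    rcases Finset.mem_union.1 hu with hu | hu
    · exact ⟨lab' u, hFu u hu⟩
    · obtain ⟨κ, hκ, hu⟩ := Finset.mem_biUnion.1 hu
      obtain ⟨i, hi, rfl⟩ := Finset.mem_image.1 hu
      obtain ⟨hκK, -⟩ := hC κ hκ
      obtain ⟨h0T, h0m⟩ := hi₀ κ hκ
      obtain ⟨h1T, h1m⟩ := hi₁ κ hκ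
      have m0 := Finset.mem_Icc.1 (hTsub κ h0T)
      have m1 := Finset.mem_Icc.1 (hTsub κ h1T)
      have hκB := (hK κ hκK).1
      have hlen := hP.one_le_len hκK
      rcases Finset.mem_union.1 hi with hi | hi <;> split_ifs at hi with hin
      · rw [Finset.mem_Icc] at hi
        refine ⟨_, (hFu _ hin).1, (hFu _ hin).2.trans ?_⟩
        refine reachable_of_path (P := (· ∉ S)) (g := f κ) (Nat.zero_le i)
          (fun k _ h2 => hP.adj_succ hκB hlen (by omega)) fun k _ h2 => ?_
        rcases Nat.eq_zero_or_pos k with rfl | hk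
        · exact hkS _ (hF _ hin)
        · exact hTm κ k hk (by omega) fun h3 => by have := h0m k h3; omega
      · simp at hi
      · rw [Finset.mem_Ioc] at hi
        refine ⟨_, (hFu _ hin).1, (hFu _ hin).2.trans (SimpleGraph.Reachable.symm ?_)⟩
        refine reachable_of_path (P := (· ∉ S)) (g := f κ) (by omega)
          (fun k _ h2 => hP.adj_succ hκB hlen (by omega)) fun k h1 h2 => ?_
        rcases h2.eq_or_lt with rfl | h2
        · exact hkS _ (hF _ hin)
        · exact hTm κ k (by omega) (by omega) fun h3 => by have := h1m k h3; omega
      · simp at hi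
  calc F.card + ∑ κ ∈ C, rest len f X q l κ ≤ F.card + ∑ κ ∈ C, (Z κ).card :=
        Nat.add_le_add_left (Finset.sum_le_sum hr) _
    _ = (F ∪ C.biUnion Z).card := hcard
    _ ≤ ((F.filter fun c => lab' c = c).biUnion fun c => Finset.univ.filter fun u =>
          (within G {w | w ∉ S}).Reachable c u).card := by
        refine Finset.card_le_card fun u hu => ?_
        obtain ⟨c, hc, hcu⟩ := hconn u hu
        exact Finset.mem_biUnion.2 ⟨c, hc, Finset.mem_filter.2 ⟨Finset.mem_univ _, hcu⟩⟩
    _ ≤ _ := by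
        rw [mul_comm]
        refine Finset.card_biUnion_le_card_mul _ _ _ fun c hc => ?_
        have := hS c (hkS c (hF c (Finset.mem_filter.1 hc).1))
        rw [← Set.ncard_coe_finset]
        simpa using this
end Complete

open Classical in
/-- The truth value of a proposition. -/
noncomputable def ind (P : Prop) : ℕ := if P then 1 else 0

theorem ind_of {P : Prop} (h : P) : ind P = 1 := if_pos h
theorem ind_congr {P Q : Prop} (h : P ↔ Q) : ind P = ind Q := by rw [propext h]
theorem ind_eq (P : Prop) [Decidable P] : ind P = if P then 1 else 0 := by
  unfold ind; congr

theorem sum_ind_mul {α : Type*} [Fintype α] (P : α → Prop) [DecidablePred P] (r : α → ℕ) :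
    ∑ x, ind (P x) * r x = ∑ x with P x, r x := by
  rw [Finset.sum_filter]
  refine Finset.sum_congr rfl fun x _ => ?_
  rw [ind_eq]
  split_ifs <;> simp

theorem sum_ind {α : Type*} [Fintype α] (P : α → Prop) [DecidablePred P] :
    ∑ x, ind (P x) = (Finset.univ.filter P).card := by
  have := sum_ind_mul P fun _ => 1
  simpa using this

/-! ### Existence of the path system and its description by labels -/

section PathSystem
variable {V : Type*} {G : SimpleGraph V} {B : Finset V} {lab : V → V}

/-- The vertex `v` just before the walk first enters `B` is still in the component of `u`. -/
theorem exists_port {u b : V} (p : G.Walk u b) (hu : u ∉ B) (hb : b ∈ B) :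
    ∃ v ∉ B, ∃ b' ∈ B, G.Adj b' v ∧ (within G {v | v ∉ B}).Reachable u v := by
  induction p with
  | nil => exact absurd hb hu
  | @cons u w b h _ ih =>
    by_cases hw : w ∈ B
    · exact ⟨u, hu, w, hw, h.symm, SimpleGraph.Reachable.refl _⟩
    · obtain ⟨v, hv, b', hb', ha, hr⟩ := ih hw hb
      have huw : (within G {v | v ∉ B}).Adj u w := ⟨h, hu, hw⟩
      exact ⟨v, hv, b', hb', ha, huw.reachable.trans hr⟩

/-- Following a path of vertices of degree two until it reaches `B`. -/
theorem exists_path [Finite V] (hdeg : ∀ v ∉ B, ∃ x y, x ≠ y ∧ ∀ w, G.Adj v w ↔ w = x ∨ w = y)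
    {b v : V} (hb : b ∈ B) (hv : v ∉ B) (hbv : G.Adj b v) :
    ∃ (m : ℕ) (f : ℕ → V), 1 ≤ m ∧ f 0 = b ∧ f 1 = v ∧ f (m + 1) ∈ B ∧
      (∀ i ∈ Finset.Icc 1 m, f i ∉ B) ∧ Set.InjOn f (Finset.Icc 1 m) ∧
      (∀ i ∈ Finset.Icc 1 m, ∀ w, G.Adj (f i) w ↔ w = f (i - 1) ∨ w = f (i + 1)) ∧
      ∀ i ∈ Finset.Icc 1 m, f (i - 1) ≠ f (i + 1) := by
  have hoth : ∀ v ∉ B, ∀ x, G.Adj v x → ∃ y, x ≠ y ∧ ∀ w, G.Adj v w ↔ w = x ∨ w = y := by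
    intro v hv x hx
    obtain ⟨a, c, hac, h⟩ := hdeg v hv
    rcases (h x).1 hx with rfl | rfl
    · exact ⟨c, hac, h⟩
    · exact ⟨a, hac.symm, fun w => (h w).trans or_comm⟩
  have : Nonempty V := ⟨b⟩
  choose! oth hne hoth using hoth
  -- `g i` is a pair of consecutive vertices. `oth v x` is the neighbour of `v` other than `x`, so
  -- the sequence never turns back outside `B`.
  let g : ℕ → V × V := fun i => (fun p => (p.2, oth p.2 p.1))^[i] (b, v)
  let f : ℕ → V := fun i => (g i).1
  have hg : ∀ i, g (i + 1) = ((g i).2, oth (g i).2 (g i).1) := fun i => by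
    simp only [g, Function.iterate_succ_apply']
  have hf2 : ∀ i, f (i + 2) = oth (f (i + 1)) (f i) := fun i => by
    simp only [f, hg]
  have hf0 : f 0 = b := rfl
  have hf1 : f 1 = v := rfl
  have hadj : ∀ m, (∀ i ∈ Finset.Icc 1 m, f i ∉ B) → ∀ i ≤ m, G.Adj (f i) (f (i + 1)) := by
    intro m hm i
    induction i with
    | zero => intro _; exact hbv
    | succ i ih =>
      intro hi
      have h1 := hm (i + 1) (Finset.mem_Icc.2 ⟨by omega, hi⟩)
      rw [hf2]
      exact (hoth _ h1 (f i) (ih (by omega)).symm _).2 (Or.inr rfl)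
  have hnb : ∀ m, (∀ i ∈ Finset.Icc 1 m, f i ∉ B) → ∀ i ∈ Finset.Icc 1 m,
      (∀ w, G.Adj (f i) w ↔ w = f (i - 1) ∨ w = f (i + 1)) ∧ f (i - 1) ≠ f (i + 1) := by
    intro m hm i hi
    have hi' := Finset.mem_Icc.1 hi
    obtain ⟨j, rfl⟩ := Nat.exists_eq_succ_of_ne_zero (show i ≠ 0 by omega)
    have h1 := hm _ hi
    have h2 := (hadj m hm j (by omega)).symm
    simp only [Nat.succ_eq_add_one, Nat.add_sub_cancel, hf2] at *
    exact ⟨hoth _ h1 _ h2, hne _ h1 _ h2⟩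
  have hinj : ∀ m, (∀ i ∈ Finset.Icc 1 m, f i ∉ B) → Set.InjOn f (Finset.Icc 1 m) := by
    intro m
    induction m with
    | zero => intro _ i hi; simp at hi
    | succ m ih =>
      intro hm
      have hm' : ∀ i ∈ Finset.Icc 1 m, f i ∉ B := fun i hi =>
        hm i (Finset.Icc_subset_Icc_right (Nat.le_succ m) hi)
      have ih := ih hm'
      -- If `f (m + 1) = f j`, then `f m` is a neighbour of `f j`, hence `f (j - 1)` or `f (j + 1)`.
      -- Injectivity up to `m` leaves three cases: `f m = f 0` lies in `B`, or there is a loop (`j =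
      -- m`), or the sequence turns back (`m = j + 1`).
      have key : ∀ j ∈ Finset.Icc 1 m, f j ≠ f (m + 1) := by
        intro j hj he
        have hj' := Finset.mem_Icc.1 hj
        have h1 := hadj m hm' m le_rfl
        rw [← he] at h1
        rcases ((hnb m hm' j hj).1 _).1 h1.symm with h2 | h2
        · rcases hj'.1.eq_or_lt with rfl | hlt
          · exact hm' m (Finset.mem_Icc.2 ⟨by omega, le_rfl⟩) (by rw [h2]; exact hb)
          · have := ih (Finset.mem_coe.2 (Finset.mem_Icc.2 ⟨by omega, le_rfl⟩))
              (Finset.mem_coe.2 (Finset.mem_Icc.2 ⟨by omega, by omega⟩)) h2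
            omega
        · rcases hj'.2.eq_or_lt with rfl | hlt
          · exact G.loopless.irrefl _ (he ▸ h1)
          · have := ih (Finset.mem_coe.2 (Finset.mem_Icc.2 ⟨by omega, le_rfl⟩))
              (Finset.mem_coe.2 (Finset.mem_Icc.2 ⟨by omega, by omega⟩)) h2
            subst this
            exact (hnb _ hm' (j + 1) (Finset.mem_Icc.2 ⟨by omega, le_rfl⟩)).2 he
      intro i hi j hj hij
      rw [Finset.mem_coe, Finset.mem_Icc] at hi hj
      by_cases hi1 : i = m + 1 <;> by_cases hj1 : j = m + 1
      · omega
      · exact absurd (hij.symm.trans (congrArg f hi1)) (key j (Finset.mem_Icc.2 ⟨hj.1, by omega⟩))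
      · exact absurd (hij.trans (congrArg f hj1)) (key i (Finset.mem_Icc.2 ⟨hi.1, by omega⟩))
      · exact ih (Finset.mem_coe.2 (Finset.mem_Icc.2 ⟨hi.1, by omega⟩))
          (Finset.mem_coe.2 (Finset.mem_Icc.2 ⟨hj.1, by omega⟩)) hij
  have hex : ∃ m, f (m + 1) ∈ B := by
    by_contra! hno
    have hall : ∀ m, ∀ i ∈ Finset.Icc 1 m, f i ∉ B := fun m i hi => by
      have := Finset.mem_Icc.1 hi
      rw [← Nat.sub_add_cancel this.1]
      exact hno _
    refine not_injective_infinite_finite (fun i => f (i + 1)) fun i j hij => ?_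
    have := hinj (max i j + 1) (hall _) (Finset.mem_coe.2 (Finset.mem_Icc.2 ⟨by omega, by omega⟩))
      (Finset.mem_coe.2 (Finset.mem_Icc.2 ⟨by omega, by omega⟩)) hij
    omega
  classical
  have hmin : ∀ i ∈ Finset.Icc 1 (Nat.find hex), f i ∉ B := fun i hi => by
    have := Finset.mem_Icc.1 hi
    rw [← Nat.sub_add_cancel this.1]
    exact Nat.find_min hex (by omega)
  refine ⟨Nat.find hex, f, ?_, hf0, hf1, Nat.find_spec hex, hmin, hinj _ hmin,
    fun i hi => (hnb _ hmin i hi).1, fun i hi => (hnb _ hmin i hi).2⟩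
  by_contra! h0
  have h1 := Nat.find_spec hex
  rw [Nat.lt_one_iff.1 h0] at h1
  exact hv h1

/-- By connectedness every component of `G - B` has a vertex next to `B`, from which a path can be
followed. The vertices of this path are closed under adjacency outside `B`, so they form the whole
component. -/
theorem exists_isPathSystem [Finite V] (hG : G.Connected) (hB : B.Nonempty)
    (hdeg : ∀ v ∉ B, ∃ x y, x ≠ y ∧ ∀ w, G.Adj v w ↔ w = x ∨ w = y)
    (hlab : IsLabel G {v | v ∉ B} lab) :
    ∃ (len : V → ℕ) (f : V → ℕ → V), IsPathSystem G B lab len f := by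
  have hex : ∀ κ, κ ∉ B → ∃ (m : ℕ) (f : ℕ → V), 1 ≤ m ∧ f 0 ∈ B ∧
      (within G {v | v ∉ B}).Reachable κ (f 1) ∧ f (m + 1) ∈ B ∧
      (∀ i ∈ Finset.Icc 1 m, f i ∉ B) ∧ Set.InjOn f (Finset.Icc 1 m) ∧
      (∀ i ∈ Finset.Icc 1 m, ∀ w, G.Adj (f i) w ↔ w = f (i - 1) ∨ w = f (i + 1)) ∧
      ∀ i ∈ Finset.Icc 1 m, f (i - 1) ≠ f (i + 1) := by
    intro κ hκ
    obtain ⟨b, hb⟩ := hB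
    obtain ⟨p⟩ := hG.preconnected κ b
    obtain ⟨v, hv, b', hb', ha, hr⟩ := exists_port p hκ hb
    obtain ⟨m, f, h1, h2, h3, h4⟩ := exists_path hdeg hb' hv ha
    exact ⟨m, f, h1, h2 ▸ hb', h3 ▸ hr, h4⟩
  have : Nonempty V := ⟨hB.choose⟩
  choose! len f h1 h2 h3 h4 h5 h6 h7 h8 using hex
  have hlabf : ∀ κ ∉ B, ∀ i ∈ Finset.Icc 1 (len κ), lab (f κ i) = lab κ := by
    intro κ hκ i hi
    have hi' := Finset.mem_Icc.1 hi
    obtain ⟨j, rfl⟩ := Nat.exists_eq_add_of_le' hi'.1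
    clear hi
    induction j with
    | zero => exact (hlab.eq_of_reachable (h3 κ hκ)).symm
    | succ j ih =>
      rw [← ih (by omega)]
      have hm : j + 1 ∈ Finset.Icc 1 (len κ) := Finset.mem_Icc.2 ⟨by omega, by omega⟩
      refine (hlab.adj _ _ (h5 κ hκ _ hm) (h5 κ hκ _ (Finset.mem_Icc.2 hi')) ?_).symm
      exact (h7 κ hκ _ hm _).2 (Or.inr rfl)
  refine ⟨len, f, hlab, h2, h4, h5, fun κ hκ hl i hi => (hlabf κ hκ i hi).trans hl, ?_, h6, h7, h8⟩
  intro v hv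
  have hκ : lab v ∉ B := hlab.mem (u := v) hv
  have hr : (within G {v | v ∉ B}).Reachable (f (lab v) 1) v :=
    (h3 _ hκ).symm.trans (hlab.reach v hv).symm
  have := eq_of_within_reachable (φ := fun u => ∃ i ∈ Finset.Icc 1 (len (lab v)), f (lab v) i = u)
    (fun x y hx hy hxy => by
      have key : ∀ x y, x ∉ B → y ∉ B → G.Adj x y →
          (∃ i ∈ Finset.Icc 1 (len (lab v)), f (lab v) i = x) →
          ∃ i ∈ Finset.Icc 1 (len (lab v)), f (lab v) i = y := by
        rintro x y hx hy hxy ⟨i, hi, rfl⟩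
        have hi' := Finset.mem_Icc.1 hi
        rcases (h7 _ hκ i hi y).1 hxy with rfl | rfl
        · refine ⟨i - 1, Finset.mem_Icc.2 ⟨?_, by omega⟩, rfl⟩
          by_contra! h0
          rw [Nat.lt_one_iff.1 h0] at hy
          exact hy (h2 _ hκ)
        · refine ⟨i + 1, Finset.mem_Icc.2 ⟨by omega, ?_⟩, rfl⟩
          by_contra! h0
          rw [show i = len (lab v) by omega] at hy
          exact hy (h4 _ hκ)
      exact propext ⟨key x y hx hy hxy, key y x hy hx hxy.symm⟩) hr
  rw [← this]
  exact ⟨1, Finset.mem_Icc.2 ⟨le_rfl, h1 _ hκ⟩, rfl⟩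

/-- This and `IsPathSystem.sum_edges` express the length and the ends of a path by labels and
adjacency alone, so that the algorithm never has to list a path in order. -/
theorem IsPathSystem.card_class [Fintype V] [DecidableEq V] {len : V → ℕ} {f : V → ℕ → V}
    (hP : IsPathSystem G B lab len f) {κ : V} (hκ : κ ∉ B) (hl : lab κ = κ) :
    (Finset.univ.filter fun u => lab u = κ).card = len κ := by
  have : (Finset.univ.filter fun u => lab u = κ) = (Finset.Icc 1 (len κ)).image (f κ) := by
    ext u
    simp only [Finset.mem_filter, Finset.mem_univ, true_and, Finset.mem_image]
    constructor
    · rintro rfl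
      have hu : u ∉ B := fun hu => by
        rw [hP.label.off u (by simpa using hu)] at hκ
        exact hκ hu
      exact hP.surj u hu
    · rintro ⟨i, hi, rfl⟩
      exact hP.lab_eq κ hκ hl i hi
  rw [this, Finset.card_image_of_injOn (hP.inj κ hκ), Nat.card_Icc, Nat.add_sub_cancel]

/-- The number of edges between a path and a subset of `B`. -/
theorem IsPathSystem.sum_edges [Fintype V] [DecidableEq V] {len : V → ℕ} {f : V → ℕ → V}
    (hP : IsPathSystem G B lab len f) {κ : V} (hκ : κ ∉ B) (hl : lab κ = κ) {X : Finset V}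
    (hX : X ⊆ B) :
    ∑ u, ∑ x, ind (lab u = κ ∧ G.Adj u x ∧ x ∈ X) = endCount len f X κ := by
  classical
  have h1 : ∀ u, ∑ x, ind (lab u = κ ∧ G.Adj u x ∧ x ∈ X) =
      if lab u = κ then (X.filter fun x => G.Adj u x).card else 0 := by
    intro u
    rw [sum_ind]
    split_ifs with h
    · congr 1
      ext x
      simp [h, and_comm]
    · simp [h]
  rw [Finset.sum_congr rfl fun u _ => h1 u, ← Finset.sum_filter]
  have himg : (Finset.univ.filter fun u => lab u = κ) = (Finset.Icc 1 (len κ)).image (f κ) := by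
    symm
    apply Finset.eq_of_subset_of_card_le
    · intro u hu
      obtain ⟨i, hi, rfl⟩ := Finset.mem_image.1 hu
      simp [hP.lab_eq κ hκ hl i hi]
    · rw [hP.card_class hκ hl, Finset.card_image_of_injOn (hP.inj κ hκ)]
      simp
  rw [himg, Finset.sum_image (hP.inj κ hκ)]
  -- Only the ends of a path have neighbours in `B`. A path with a single vertex has both terms, and
  -- `hP.ne` keeps its two neighbours apart.
  have h2 : ∀ i ∈ Finset.Icc 1 (len κ), (X.filter fun x => G.Adj (f κ i) x).card =
      (if i = 1 then (if f κ 0 ∈ X then 1 else 0) else 0) +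
        if i = len κ then (if f κ (len κ + 1) ∈ X then 1 else 0) else 0 := by
    intro i hi
    have hi' := Finset.mem_Icc.1 hi
    have e : (X.filter fun x => G.Adj (f κ i) x) =
        (if f κ (i - 1) ∈ X then {f κ (i - 1)} else ∅) ∪
          if f κ (i + 1) ∈ X then {f κ (i + 1)} else ∅ := by
      ext x
      simp only [Finset.mem_filter, hP.adj_iff κ hκ i hi, Finset.mem_union]
      split_ifs with h3 h4 h4 <;> simp <;> grind
    rw [e, Finset.card_union_of_disjoint]
    · congr 1
      · by_cases h : i = 1
        · subst h; simp; split_ifs <;> simp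
        · have : f κ (i - 1) ∉ X := fun hx =>
            hP.notMem κ hκ _ (Finset.mem_Icc.2 ⟨by omega, by omega⟩) (hX hx)
          simp [h, this]
      · by_cases h : i = len κ
        · subst h; simp; split_ifs <;> simp
        · have : f κ (i + 1) ∉ X := fun hx =>
            hP.notMem κ hκ _ (Finset.mem_Icc.2 ⟨by omega, by omega⟩) (hX hx)
          simp [h, this]
    · have := hP.ne κ hκ i hi
      split_ifs <;> simp [this]
  rw [Finset.sum_congr rfl h2, Finset.sum_add_distrib]
  obtain ⟨i, hi, -⟩ := hP.surj κ hκ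
  rw [hl] at hi
  have := Finset.mem_Icc.1 hi
  simp only [Finset.sum_ite_eq', Finset.mem_Icc, endCount]
  have hlen : 1 ≤ len κ := by omega
  simp [hlen]
end PathSystem

/-! ### Spanning trees with many leaves -/

section MaxLeaf
variable {V : Type*} [Finite V] {G T : SimpleGraph V}

theorem ncard_neighborSet_pos [Nontrivial V] (hG : G.Connected) (v : V) :
    0 < (G.neighborSet v).ncard := by
  obtain ⟨w, hw⟩ := exists_ne v
  obtain ⟨p⟩ := hG.preconnected v w
  cases p with
  | nil => exact absurd rfl hw
  | cons h _ => exact (Set.ncard_pos).2 ⟨_, h⟩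

theorem exists_maxLeaf_tree (hG : G.Connected) :
    (∃ T ≤ G, T.IsTree ∧ numLeaves T = maxLeaf G) ∧
      ∀ T ≤ G, T.IsTree → numLeaves T ≤ maxLeaf G := by
  have hb : BddAbove {m : ℕ | ∃ T : SimpleGraph V, T ≤ G ∧ T.IsTree ∧ numLeaves T = m} := by
    refine ⟨Nat.card V, ?_⟩
    rintro m ⟨T, -, -, rfl⟩
    exact Set.ncard_le_card _
  refine ⟨?_, fun T h1 h2 => le_csSup hb ⟨T, h1, h2, rfl⟩⟩
  obtain ⟨T, h1, h2⟩ := hG.exists_isTree_le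
  exact Nat.sSup_mem (s := {m : ℕ | ∃ T : SimpleGraph V, T ≤ G ∧ T.IsTree ∧ numLeaves T = m})
    ⟨_, T, h1, h2, rfl⟩ hb

/-- Exchanging an edge of a spanning tree. -/
theorem exists_swap (hT : T.IsTree) (hTG : T ≤ G) {v w : V} (hvw : G.Adj v w) (hn : ¬ T.Adj v w) :
    ∃ (v' : V) (T' : SimpleGraph V), T.Adj v v' ∧ v' ≠ w ∧ T' ≤ G ∧ T'.IsTree ∧
      (∀ x, x ≠ v' → x ≠ w → (T'.neighborSet x).ncard = (T.neighborSet x).ncard) ∧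
      (T'.neighborSet v').ncard + 1 = (T.neighborSet v').ncard ∧
      (T'.neighborSet w).ncard = (T.neighborSet w).ncard + 1 ∧
      ∀ x y, x ≠ v → x ≠ w → T'.Adj x y → T.Adj x y := by
  obtain ⟨p, hp⟩ := (hT.connected.preconnected v w).exists_isPath
  cases p with
  | nil => exact absurd hvw (G.loopless.irrefl _)
  | @cons _ v' _ h q =>
    rw [SimpleGraph.Walk.cons_isPath_iff] at hp
    have hv'w : v' ≠ w := fun he => hn (he ▸ h)
    -- `v'` follows `v` on the path in `T` from `v` to `w`. Replacing the edge `v v'` by `v w`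
    -- preserves the degree of `v`, lowers that of `v'` and raises that of `w`.
    let F := T.deleteEdges {s(v, v')}
    have hq : F.Reachable v' w := ⟨q.toDeleteEdge s(v, v') fun he =>
      hp.2 (q.fst_mem_support_of_mem_edges he)⟩
    have hbr : ¬ F.Reachable v v' := by
      have := (SimpleGraph.isAcyclic_iff_forall_adj_isBridge.1 hT.isAcyclic) h
      rwa [SimpleGraph.isBridge_iff] at this
    let T' := F ⊔ SimpleGraph.edge v w
    have hT'adj : ∀ x y, T'.Adj x y ↔ (T.Adj x y ∧ s(x, y) ≠ s(v, v')) ∨ s(x, y) = s(v, w) := by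
      intro x y
      have hne := hvw.ne
      simp only [T', F, SimpleGraph.sup_adj, SimpleGraph.deleteEdges_adj, Set.mem_singleton_iff,
        SimpleGraph.edge_adj, Sym2.eq_iff, ne_eq]
      constructor
      · rintro (h1 | h1)
        · exact Or.inl h1
        · exact Or.inr h1.1
      · rintro (h1 | h1)
        · exact Or.inl h1
        · refine Or.inr ⟨h1, ?_⟩
          rintro rfl
          rcases h1 with ⟨h1, h2⟩ | ⟨h1, h2⟩
          · exact hne (h1.symm.trans h2)
          · exact hne (h2.symm.trans h1)
    have hvv' := h.ne
    have hvw' := hvw.ne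
    refine ⟨v', T', h, hv'w, ?_, ⟨?_, ?_⟩, ?_, ?_, ?_, ?_⟩
    · intro x y hxy
      rcases (hT'adj x y).1 hxy with h1 | h1
      · exact hTG h1.1
      · rcases Sym2.eq_iff.1 h1 with ⟨rfl, rfl⟩ | ⟨rfl, rfl⟩
        · exact hvw
        · exact hvw.symm
    · have : Nonempty V := ⟨v⟩
      refine ⟨fun x y => ?_⟩
      obtain ⟨r⟩ := hT.connected.preconnected x y
      have hvv : T'.Reachable v v' := by
        have h1 : T'.Adj v w := (hT'adj v w).2 (Or.inr rfl)
        exact h1.reachable.trans ((hq.mono le_sup_left).symm)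
      induction r with
      | nil => rfl
      | @cons a b c hab _ ih =>
        refine SimpleGraph.Reachable.trans ?_ ih
        by_cases he : s(a, b) = s(v, v')
        · rcases Sym2.eq_iff.1 he with ⟨rfl, rfl⟩ | ⟨rfl, rfl⟩
          · exact hvv
          · exact hvv.symm
        · exact ((hT'adj a b).2 (Or.inl ⟨hab, he⟩)).reachable
    · exact (hT.isAcyclic.anti (SimpleGraph.deleteEdges_le _)).sup_edge_of_not_reachable
        fun hr => hbr (hr.trans hq.symm)
    · intro x hx hxw
      by_cases hxv : x = v
      · subst hxv
        have e : T'.neighborSet x = insert w (T.neighborSet x \ {v'}) := by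
          ext y
          simp only [SimpleGraph.mem_neighborSet, hT'adj, Set.mem_insert_iff, Set.mem_sdiff,
            Set.mem_singleton_iff, Sym2.eq_iff]
          grind
        rw [e, Set.ncard_insert_of_notMem (fun hh => hn hh.1) (Set.toFinite _),
          Set.ncard_sdiff_singleton_add_one (by exact h) (Set.toFinite _)]
      · congr 1
        ext y
        simp only [SimpleGraph.mem_neighborSet, hT'adj, Sym2.eq_iff]
        grind
    · have e : T'.neighborSet v' = T.neighborSet v' \ {v} := by
        ext y
        simp only [SimpleGraph.mem_neighborSet, hT'adj, Set.mem_sdiff,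
            Set.mem_singleton_iff, Sym2.eq_iff]
        grind
      rw [e, Set.ncard_sdiff_singleton_add_one (by exact h.symm) (Set.toFinite _)]
    · have e : T'.neighborSet w = insert v (T.neighborSet w) := by
        ext y
        simp only [SimpleGraph.mem_neighborSet, hT'adj, Set.mem_insert_iff, Sym2.eq_iff]
        grind
      have hvn : v ∉ T.neighborSet w := fun hh => hn (SimpleGraph.Adj.symm hh)
      rw [e, Set.ncard_insert_of_notMem hvn (Set.toFinite _)]
    · intro x y hxv hxw hxy
      rcases (hT'adj x y).1 hxy with h1 | h1
      · exact h1.1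
      · rcases Sym2.eq_iff.1 h1 with ⟨rfl, rfl⟩ | ⟨rfl, rfl⟩
        · exact absurd rfl hxv
        · exact absurd rfl hxw

/-- Otherwise the exchange turns `v'`, which has degree two, into a new leaf, and no leaf is lost
since `w` was none; this contradicts the maximality of `T`. -/
theorem three_le_of_nonleaf [Nontrivial V] (hG : G.Connected) (hT : T.IsTree) (hTG : T ≤ G)
    (hm : maxLeaf G ≤ numLeaves T) {v w : V} (hvw : G.Adj v w) (hn : ¬ T.Adj v w)
    (hw : 2 ≤ (T.neighborSet w).ncard) : ∃ u, T.Adj v u ∧ 3 ≤ (T.neighborSet u).ncard := by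
  obtain ⟨v', T', h1, h2, h3, h4, h5, h6, h7, -⟩ := exists_swap hT hTG hvw hn
  refine ⟨v', h1, ?_⟩
  by_contra! hlt
  have hpos := ncard_neighborSet_pos h4.connected v'
  have hv' : v' ∉ {v : V | (T.neighborSet v).ncard = 1} := by
    simp only [Set.mem_ofPred_eq]; omega
  have hsub : insert v' {v : V | (T.neighborSet v).ncard = 1} ⊆
      {v : V | (T'.neighborSet v).ncard = 1} := by
    rintro x (rfl | hx)
    · simp only [Set.mem_ofPred_eq]; omega
    · simp only [Set.mem_ofPred_eq] at hx ⊢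
      rw [h5 x (by rintro rfl; omega) (by rintro rfl; omega), hx]
  have h8 := Set.ncard_le_ncard hsub (Set.toFinite _)
  rw [Set.ncard_insert_of_notMem hv' (Set.toFinite _)] at h8
  have h9 := (exists_maxLeaf_tree hG).2 T' h3 h4
  unfold numLeaves at h9 hm
  omega

/-- The exchange at `v₁` trades the leaf `w` for the leaf `v'`. The new tree is again optimal, but
`w` now has degree two, so if `v₂ ≠ v₁`, then `three_le_of_nonleaf` gives a neighbour of `v₂` of
degree at least three. It was a neighbour of `v₂` before, and the only degree that has grown is that
of `w`, which is not adjacent to `v₂` in the tree. -/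
theorem eq_of_leaf [Nontrivial V] (hG : G.Connected) (hT : T.IsTree) (hTG : T ≤ G)
    (hm : maxLeaf G ≤ numLeaves T) {v₁ v₂ w : V} (hw : (T.neighborSet w).ncard = 1)
    (h₁ : G.Adj v₁ w) (h₂ : G.Adj v₂ w) (hn₁ : ¬ T.Adj v₁ w) (hn₂ : ¬ T.Adj v₂ w)
    (hd₁ : ∀ u, T.Adj v₁ u → (T.neighborSet u).ncard ≤ 2)
    (hd₂ : ∀ u, T.Adj v₂ u → (T.neighborSet u).ncard ≤ 2) : v₁ = v₂ := by
  by_contra hne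
  obtain ⟨v', T', k1, k2, k3, k4, k5, k6, k7, k8⟩ := exists_swap hT hTG h₁ hn₁
  have hpos := ncard_neighborSet_pos k4.connected v'
  have hle := hd₁ v' k1
  have hv' : v' ∉ {v : V | (T.neighborSet v).ncard = 1} \ {w} := by
    rintro ⟨h, -⟩
    simp only [Set.mem_ofPred_eq] at h; omega
  have hsub : insert v' ({v : V | (T.neighborSet v).ncard = 1} \ {w}) ⊆
      {v : V | (T'.neighborSet v).ncard = 1} := by
    rintro x (rfl | ⟨hx, hxw⟩)
    · simp only [Set.mem_ofPred_eq]; omega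
    · simp only [Set.mem_ofPred_eq] at hx ⊢
      rw [k5 x (by rintro rfl; omega) hxw, hx]
  have h8 := Set.ncard_le_ncard hsub (Set.toFinite _)
  rw [Set.ncard_insert_of_notMem hv' (Set.toFinite _),
    Set.ncard_sdiff_singleton_add_one (by exact hw) (Set.toFinite _)] at h8
  have hw2 : v₂ ≠ w := h₂.ne
  obtain ⟨u, hu, hu3⟩ := three_le_of_nonleaf hG k4 k3 (hm.trans h8) h₂
    (fun h => hn₂ (k8 _ _ (Ne.symm hne) hw2 h)) (by omega)
  have hTu := k8 _ _ (Ne.symm hne) hw2 hu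
  have := hd₂ u hTu
  by_cases huv : u = v'
  · subst huv; omega
  · rw [k5 u huv (by rintro rfl; exact hn₂ hTu)] at hu3
    omega
end MaxLeaf

/-! ### The number of special vertices and of paths -/

section Counting
variable {V : Type*} [Fintype V] {G T : SimpleGraph V}

-- In a tree the sum of all degrees minus two is `-2`, and only leaves contribute negative terms.
open Classical in
theorem sum_degree_tree [Nontrivial V] (hT : T.IsTree) :
    ∑ v with 3 ≤ (T.neighborSet v).ncard, ((T.neighborSet v).ncard - 2) ≤ numLeaves T := by
  have hdeg : ∀ v, (T.neighborSet v).ncard = T.degree v := fun v => by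
    rw [← SimpleGraph.card_neighborSet_eq_degree, ← Nat.card_eq_fintype_card, Nat.card_coe_set_eq]
  have h1 := T.sum_degrees_eq_twice_card_edges
  have h2 := hT.card_edgeFinset
  have h3 : numLeaves T = ∑ v, if T.degree v = 1 then 1 else 0 := by
    rw [numLeaves, ← Finset.card_filter, ← Set.ncard_coe_finset]
    simp [hdeg]
  have h4 : ∑ _v : V, (2 : ℕ) = 2 * Fintype.card V := by simp [mul_comm]
  have h5 : ∑ v, T.degree v + ∑ v, (if T.degree v = 1 then 1 else 0) =
      ∑ _v : V, 2 + ∑ v with 3 ≤ (T.neighborSet v).ncard, ((T.neighborSet v).ncard - 2) := by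
    rw [Finset.sum_filter, ← Finset.sum_add_distrib, ← Finset.sum_add_distrib]
    refine Finset.sum_congr rfl fun v _ => ?_
    have := ncard_neighborSet_pos hT.connected v
    rw [hdeg] at this ⊢
    split_ifs <;> omega
  omega

-- A vertex of degree at least three in `G` has degree at least three in `T` (`D`, at most `ml`
-- vertices), or is a neighbour in `T` of such a vertex (`N`, at most `3 * ml`), or is in `P`. For a
-- vertex in `P`, `three_le_of_nonleaf` shows that the other end of a non-tree edge is a leaf, and
-- by `eq_of_leaf` different vertices use different leaves, so `P` has at most `ml` elements.
open Classical in
theorem card_branch_le [Nontrivial V] (hG : G.Connected) {T : SimpleGraph V} (hT : T.IsTree)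
    (hTG : T ≤ G) (hm : maxLeaf G = numLeaves T) :
    ({v | 3 ≤ (G.neighborSet v).ncard} : Finset V).card ≤ 5 * maxLeaf G := by
  let D : Finset V := {v | 3 ≤ (T.neighborSet v).ncard}
  let N : Finset V := D.biUnion fun u => (T.neighborSet u).toFinset
  let P : Finset V := {v | (∀ u, T.Adj v u → (T.neighborSet u).ncard ≤ 2) ∧
    ∃ w, G.Adj v w ∧ ¬ T.Adj v w}
  let L : Finset V := {v | (T.neighborSet v).ncard = 1}
  have hL : L.card = maxLeaf G := by
    rw [hm, numLeaves, ← Set.ncard_coe_finset]; simp [L]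
  have hsum : ∑ v ∈ D, ((T.neighborSet v).ncard - 2) ≤ maxLeaf G := hm ▸ sum_degree_tree hT
  have hD : D.card ≤ maxLeaf G := by
    refine le_trans ?_ hsum
    rw [Finset.card_eq_sum_ones]
    refine Finset.sum_le_sum fun v hv => ?_
    have := (Finset.mem_filter.1 hv).2
    omega
  have hN : N.card ≤ 3 * maxLeaf G := by
    refine Finset.card_biUnion_le.trans ?_
    have : ∀ v ∈ D, (T.neighborSet v).toFinset.card ≤ ((T.neighborSet v).ncard - 2) + 2 := fun v _ => by
      rw [← Set.ncard_eq_toFinset_card']; omega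
    refine (Finset.sum_le_sum this).trans ?_
    rw [Finset.sum_add_distrib, Finset.sum_const, smul_eq_mul]
    omega
  have hP : P.card ≤ maxLeaf G := by
    rw [← hL]
    have hex : ∀ v, v ∈ P → ∃ w, G.Adj v w ∧ ¬ T.Adj v w := fun v hv => (Finset.mem_filter.1 hv).2.2
    have : Nonempty V := hG.nonempty
    choose! φ h1 h2 using hex
    have hleaf : ∀ v ∈ P, (T.neighborSet (φ v)).ncard = 1 := by
      intro v hv
      have h3 := ncard_neighborSet_pos hT.connected (φ v)
      by_contra hne
      obtain ⟨u, hu, hu3⟩ := three_le_of_nonleaf hG hT hTG hm.le (h1 v hv) (h2 v hv) (by omega)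
      have := (Finset.mem_filter.1 hv).2.1 u hu
      omega
    refine Finset.card_le_card_of_injOn φ ?_ ?_
    · exact fun v hv => Finset.mem_coe.2 (Finset.mem_filter.2 ⟨Finset.mem_univ _, hleaf v hv⟩)
    · intro v hv v' hv' he
      rw [Finset.mem_coe] at hv hv'
      exact eq_of_leaf hG hT hTG hm.le (hleaf v hv) (h1 v hv) (he ▸ h1 v' hv') (h2 v hv)
        (he ▸ h2 v' hv') (Finset.mem_filter.1 hv).2.1 (Finset.mem_filter.1 hv').2.1
  have hcover : ({v | 3 ≤ (G.neighborSet v).ncard} : Finset V) ⊆ D ∪ (N ∪ P) := by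
    intro v hv
    have hv := (Finset.mem_filter.1 hv).2
    by_cases h1 : v ∈ D
    · exact Finset.mem_union_left _ h1
    refine Finset.mem_union_right _ ?_
    by_cases h2 : v ∈ N
    · exact Finset.mem_union_left _ h2
    refine Finset.mem_union_right _ (Finset.mem_filter.2 ⟨Finset.mem_univ _, fun u hu => ?_, ?_⟩)
    · by_contra! h3
      exact h2 (Finset.mem_biUnion.2 ⟨u, Finset.mem_filter.2 ⟨Finset.mem_univ _, h3⟩,
        by simpa using hu.symm⟩)
    · by_contra! h3
      refine h1 (Finset.mem_filter.2 ⟨Finset.mem_univ _, hv.trans ?_⟩)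
      exact Set.ncard_le_ncard h3 (Set.toFinite _)
  have := (Finset.card_le_card hcover).trans ((Finset.card_union_le _ _).trans
    (Nat.add_le_add_left (Finset.card_union_le _ _) _))
  omega

/-- The vertices of degree other than two, and the components of the rest, are linear in number. -/
theorem card_special_le [DecidableEq V] (hG : G.Connected) {B : Finset V} {v₀ : V} {lab : V → V}
    (hB : ∀ v ∈ B, (G.neighborSet v).ncard ≠ 2 ∨ v = v₀) (h₀ : v₀ ∈ B)
    (hdeg : ∀ v ∉ B, (G.neighborSet v).ncard = 2) (hlab : IsLabel G {v | v ∉ B} lab) :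
    B.card + (pathLabels B lab).card ≤ 20 * maxLeaf G + 3 := by
  classical
  rcases subsingleton_or_nontrivial V with hs | hnt
  · have h1 := Finset.card_le_one_of_subsingleton B
    have h2 := Finset.card_le_one_of_subsingleton (pathLabels B lab)
    omega
  obtain ⟨T, hTG, hT, hm⟩ := (exists_maxLeaf_tree hG).1
  have hbr := card_branch_le hG hT hTG hm.symm
  let L : Finset V := {v | (T.neighborSet v).ncard = 1}
  have hL : L.card = maxLeaf G := by
    rw [← hm, numLeaves, ← Set.ncard_coe_finset]; simp [L]
  have hsubT : ∀ v, T.neighborSet v ⊆ G.neighborSet v := fun v w hw => hTG hw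
  have hBcard : B.card ≤ 6 * maxLeaf G + 1 := by
    -- A vertex of `B` other than `v₀` that has degree less than three has degree one, and is a leaf
    -- of `T` as well; this gives `1 + 5 * ml + ml`.
    have : B ⊆ {v₀} ∪ (({v | 3 ≤ (G.neighborSet v).ncard} : Finset V) ∪ L) := by
      intro v hv
      rcases hB v hv with h | rfl
      · have h1 := ncard_neighborSet_pos hT.connected v
        have h2 := Set.ncard_le_ncard (hsubT v) (Set.toFinite _)
        refine Finset.mem_union_right _ (Finset.mem_union.2 ?_)
        rcases Nat.lt_or_ge (G.neighborSet v).ncard 3 with h3 | h3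
        · exact Or.inr (Finset.mem_filter.2 ⟨Finset.mem_univ _, by omega⟩)
        · exact Or.inl (Finset.mem_filter.2 ⟨Finset.mem_univ _, h3⟩)
      · exact Finset.mem_union_left _ (Finset.mem_singleton_self _)
    have h1 := (Finset.card_le_card this).trans ((Finset.card_union_le _ _).trans
      (Nat.add_le_add_left (Finset.card_union_le _ _) _))
    rw [Finset.card_singleton] at h1
    omega
  have hNB : (B.biUnion fun b => (T.neighborSet b).toFinset).card ≤ 2 * B.card + maxLeaf G := by
    refine Finset.card_biUnion_le.trans ?_
    calc ∑ b ∈ B, (T.neighborSet b).toFinset.card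
        ≤ ∑ b ∈ B, (2 + if 3 ≤ (T.neighborSet b).ncard then (T.neighborSet b).ncard - 2 else 0) := by
          refine Finset.sum_le_sum fun b _ => ?_
          rw [← Set.ncard_eq_toFinset_card']
          split_ifs <;> omega
      _ = 2 * B.card + ∑ b ∈ B,
            (if 3 ≤ (T.neighborSet b).ncard then (T.neighborSet b).ncard - 2 else 0) := by
          rw [Finset.sum_add_distrib, Finset.sum_const, smul_eq_mul, mul_comm]
      _ ≤ _ := by
          refine Nat.add_le_add_left (le_trans ?_ (hm ▸ sum_degree_tree hT)) _
          rw [Finset.sum_filter]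
          exact Finset.sum_le_sum_of_subset (Finset.subset_univ _)
  -- Each path has a vertex next to `B`, of degree two in `G`. It is a leaf of `T`, or both its
  -- edges are in `T` and it is a neighbour in `T` of `B`. The total is at most `3 * |B| + 2 * ml ≤
  -- 3 * (6 * ml + 1) + 2 * ml`.
  have hK : (pathLabels B lab).card ≤ (L ∪ B.biUnion fun b => (T.neighborSet b).toFinset).card := by
    have hex : ∀ κ, κ ∈ pathLabels B lab → ∃ v ∉ B, (∃ b ∈ B, G.Adj b v) ∧ lab v = κ := by
      intro κ hκ
      obtain ⟨-, hκB, hκl⟩ := Finset.mem_filter.1 hκ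
      obtain ⟨p⟩ := hG.preconnected κ v₀
      obtain ⟨v, hv, b, hb, ha, hr⟩ := exists_port p hκB h₀
      exact ⟨v, hv, ⟨b, hb, ha⟩, (hlab.eq_of_reachable hr).symm.trans hκl⟩
    have : Nonempty V := ⟨v₀⟩
    choose! φ h1 h2 h3 using hex
    refine Finset.card_le_card_of_injOn φ ?_ ?_
    · intro κ hκ
      rw [Finset.mem_coe] at hκ ⊢
      obtain ⟨b, hb, ha⟩ := h2 κ hκ
      have hd := hdeg _ (h1 κ hκ)
      have hp := ncard_neighborSet_pos hT.connected (φ κ)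
      by_cases hl : (T.neighborSet (φ κ)).ncard = 1
      · exact Finset.mem_union_left _ (Finset.mem_filter.2 ⟨Finset.mem_univ _, hl⟩)
      · have he := Set.eq_of_subset_of_ncard_le (hsubT (φ κ)) (by omega) (Set.toFinite _)
        refine Finset.mem_union_right _ (Finset.mem_biUnion.2 ⟨b, hb, ?_⟩)
        have : b ∈ T.neighborSet (φ κ) := he ▸ ha.symm
        simpa using SimpleGraph.Adj.symm this
    · intro κ hκ κ' hκ' he
      rw [← h3 κ hκ, ← h3 κ' hκ', he]
  have := Finset.card_union_le L (B.biUnion fun b => (T.neighborSet b).toFinset)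
  omega
end Counting

/-! ### Guessing a deletion set -/

section Guess
variable {V : Type*} [Fintype V] [DecidableEq V] (G : SimpleGraph V) (B : Finset V) (lab : V → V)
  (l : ℕ) (g : V → ℕ)

/-- The number of vertices with label `κ`. -/
def classSize (κ : V) : ℕ := (Finset.univ.filter fun u => lab u = κ).card

/-- The number of vertices to be deleted from the path `κ`, according to the guess `g`. -/
def guessHits (κ : V) : ℕ := classSize lab κ / (l + 1) + g κ

/-- The vertices of `B` to be deleted, according to the guess `g`. -/
def guessSet : Finset V := {x ∈ B | 1 ≤ g x}

/-- The vertices that remain connected to `B` if nothing is deleted from their path. -/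
abbrev guessKept : Set V := kept B lab (guessSet B g) (guessHits lab l g)

/-- The number of edges between the path `κ` and the guessed set. -/
noncomputable def guessEdges (κ : V) : ℕ :=
  ∑ u, ∑ x, ind (lab u = κ ∧ G.Adj u x ∧ x ∈ guessSet B g)

/-- What has to remain connected to `B`. -/
noncomputable def guessRest (κ : V) : ℕ :=
  classSize lab κ - guessHits lab l g κ - l * (guessHits lab l g κ + guessEdges G B lab g κ - 1)

/-- `κ` is the label of a path from which something is deleted and that has to be connected
to `F`. -/
def GuessConfined (F : Set V) (κ : V) : Prop :=
  (κ ∉ B ∧ lab κ = κ) ∧ 1 ≤ guessHits lab l g κ ∧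
    ∀ u x, lab u = κ → G.Adj u x → x ∈ B → x ∈ guessSet B g ∨ x ∈ F

/-- The union of the components of `G[U]` that meet the support of `h`. -/
def spanned (U : Set V) (lab' : V → V) (h : V → ℕ) : Set V :=
  {u | u ∈ U ∧ ∃ w, 1 ≤ h w ∧ w ∈ U ∧ lab' w = lab' u}

/-- Hall's condition for the union `F` of some components. -/
def HallFor (lab' : V → V) (F : Set V) : Prop :=
  ∑ u, ind (u ∈ F) + ∑ κ, ind (GuessConfined G B lab l g F κ) * guessRest G B lab l g κ ≤
    l * ∑ c, ind (c ∈ F ∧ lab' c = c)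

/-- The number of vertices to be deleted. -/
def guessCost : ℕ := (guessSet B g).card + ∑ κ ∈ pathLabels B lab, guessHits lab l g κ

variable {G B lab l g}

/-- The parametrisation of the paths disappears from Hall's condition: lengths become class sizes,
and the ends of a path are recognised as the neighbours in `B` of its class. -/
theorem hallFor_iff {len : V → ℕ} {f : V → ℕ → V} (hP : IsPathSystem G B lab len f)
    (lab' : V → V) (F : Finset V) :
    HallFor G B lab l g lab' (F : Set V) ↔ F.card +
      ∑ κ ∈ confined B lab len f (guessSet B g) (guessHits lab l g) F,
        rest len f (guessSet B g) (guessHits lab l g) l κ ≤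
      l * (F.filter fun c => lab' c = c).card := by
  classical
  have hXB : guessSet B g ⊆ B := Finset.filter_subset _ _
  have h1 : ∑ u, ind (u ∈ (F : Set V)) = F.card := by
    rw [sum_ind]; simp
  have h2 : ∑ c, ind (c ∈ (F : Set V) ∧ lab' c = c) = (F.filter fun c => lab' c = c).card := by
    rw [sum_ind]
    congr 1
    ext c
    simp
  have h3 : ∀ κ, GuessConfined G B lab l g (F : Set V) κ ↔
      κ ∈ confined B lab len f (guessSet B g) (guessHits lab l g) F := by
    intro κ
    simp only [GuessConfined, confined, pathLabels, Finset.mem_filter, Finset.mem_univ, true_and,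
      Finset.mem_coe]
    refine and_congr_right fun hκ => and_congr_right fun _ => ?_
    have hlen := hP.one_le_len (κ := κ) (by simpa [pathLabels] using hκ)
    have m1 : 1 ∈ Finset.Icc 1 (len κ) := Finset.mem_Icc.2 ⟨le_rfl, hlen⟩
    have m2 : len κ ∈ Finset.Icc 1 (len κ) := Finset.mem_Icc.2 ⟨hlen, le_rfl⟩
    constructor
    · intro h
      exact ⟨h (f κ 1) (f κ 0) (hP.lab_eq κ hκ.1 hκ.2 1 m1)
          ((hP.adj_iff κ hκ.1 1 m1 _).2 (Or.inl rfl)) (hP.start κ hκ.1),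
        h (f κ (len κ)) (f κ (len κ + 1)) (hP.lab_eq κ hκ.1 hκ.2 _ m2)
          ((hP.adj_iff κ hκ.1 _ m2 _).2 (Or.inr rfl)) (hP.finish κ hκ.1)⟩
    · rintro ⟨h4, h5⟩ u x hu hux hx
      have huB : u ∉ B := fun h => by
        rw [hP.label.off u (by simpa using h)] at hu
        exact hκ.1 (hu ▸ h)
      obtain ⟨i, hi, hfi⟩ := hP.surj u huB
      rw [hu] at hi hfi
      subst hfi
      have hi' := Finset.mem_Icc.1 hi
      rcases (hP.adj_iff κ hκ.1 i hi x).1 hux with rfl | rfl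
      · have : i - 1 = 0 := by
          by_contra h0
          exact hP.notMem κ hκ.1 (i - 1) (Finset.mem_Icc.2 ⟨by omega, by omega⟩) hx
        rw [this]; exact h4
      · have : i = len κ := by
          by_contra h0
          exact hP.notMem κ hκ.1 (i + 1) (Finset.mem_Icc.2 ⟨by omega, by omega⟩) hx
        rw [this]; exact h5
  have h4 : ∑ κ, ind (GuessConfined G B lab l g (F : Set V) κ) * guessRest G B lab l g κ =
      ∑ κ ∈ confined B lab len f (guessSet B g) (guessHits lab l g) F,
        rest len f (guessSet B g) (guessHits lab l g) l κ := by
    simp only [h3]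
    rw [sum_ind_mul, Finset.filter_mem_eq_inter, Finset.univ_inter]
    refine Finset.sum_congr rfl fun κ hκ => ?_
    obtain ⟨-, hκB, hκl⟩ := Finset.mem_filter.1 (Finset.mem_filter.1 hκ).1
    have h5 : classSize lab κ = len κ := hP.card_class hκB hκl
    have h6 : guessEdges G B lab g κ = endCount len f (guessSet B g) κ := by
      exact hP.sum_edges hκB hκl hXB
    simp only [guessRest, rest, h5, h6]
  unfold HallFor
  rw [h1, h2, h4]

/-- The set `Γ` of guesses serves twice: `g` prescribes the deletions, and the support of `h` picks
the union of kept components for which Hall's condition is tested. Every such union arises from an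
`h` supported on labels, so both searches have the same small range. -/
theorem vi_le_iff_guess (hG : G.Connected) (hB : B.Nonempty)
    (hdeg : ∀ v ∉ B, ∃ x y, x ≠ y ∧ ∀ w, G.Adj v w ↔ w = x ∨ w = y)
    (hlab : IsLabel G {v | v ∉ B} lab) {lab' : ℕ → (V → ℕ) → V → V} {Γ : Set (V → ℕ)}
    (hlab' : ∀ l, ∀ g ∈ Γ, IsLabel G (guessKept B lab l g) (lab' l g))
    (hΓ : ∀ g : V → ℕ, (∀ v, g v < 4) → (∀ v, lab v ≠ v → g v = 0) → g ∈ Γ) {k : ℕ} :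
    vi G ≤ k ↔ ∃ l < Fintype.card V, ∃ g ∈ Γ, guessCost B lab l g + l ≤ k ∧
      ∀ h ∈ Γ, HallFor G B lab l g (lab' l g) (spanned (guessKept B lab l g) (lab' l g) h) := by
  classical
  obtain ⟨len, f, hP⟩ := exists_isPathSystem hG hB hdeg hlab
  rw [vi_le_iff]
  constructor
  · rintro ⟨S, l, hS, hk⟩
    obtain ⟨S, l, hS, hk, hl⟩ : ∃ S l, SmallComponents G S l ∧ S.card + l ≤ k ∧
        l < Fintype.card V := by
      rcases Nat.lt_or_ge l (Fintype.card V) with hl | hl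
      · exact ⟨S, l, hS, hk, hl⟩
      -- If `l` is at least the number of vertices, deleting all of them is no worse.
      · refine ⟨Finset.univ, 0, fun v hv => absurd (Finset.mem_univ v) hv, ?_,
          Fintype.card_pos_iff.2 hG.nonempty⟩
        rw [Finset.card_univ]; omega
    -- On `B` the guess marks `S`; at the label of a path it is the excess over `len / (l + 1)`, at
    -- most two by `hitCount_bounds`.
    let g : V → ℕ := fun v => if v ∈ B then (if v ∈ S then 1 else 0)
      else if lab v = v then hitCount len f S l v - len v / (l + 1) else 0
    have hgB : guessSet B g = S ∩ B := by
      ext v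
      simp only [guessSet, Finset.mem_filter, Finset.mem_inter, g]
      by_cases h1 : v ∈ B <;> by_cases h2 : v ∈ S <;> simp [h1, h2]
    have hgK : ∀ κ ∈ pathLabels B lab, guessHits lab l g κ = hitCount len f S l κ := by
      intro κ hκ
      obtain ⟨-, hκB, hκl⟩ := Finset.mem_filter.1 hκ
      have h1 : classSize lab κ = len κ := hP.card_class hκB hκl
      have := (hitCount_bounds hP hS hκ).1
      simp only [guessHits, h1, g, hκB, hκl, if_true, if_false]
      omega
    have hg : g ∈ Γ := by
      refine hΓ g (fun v => ?_) fun v hv => ?_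
      · simp only [g]
        split_ifs with h1 h2 h3
        · omega
        · omega
        · have := (hitCount_bounds hP hS (Finset.mem_filter.2 ⟨Finset.mem_univ v, h1, h3⟩)).2
          omega
        · omega
      · have hvB : v ∉ B := fun h => hv (hlab.off v (by simpa using h))
        simp [g, hv, hvB]
    have hkept : guessKept B lab l g = kept B lab (S ∩ B) (hitCount len f S l) := by
      ext u
      simp only [guessKept, kept, hgB, Set.mem_ofPred_eq]
      refine or_congr_right (and_congr_right fun hu => ?_)
      rw [hgK _ (hP.lab_mem hu)]
    refine ⟨l, hl, g, hg, ?_, fun h _ => ?_⟩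
    · have h1 := card_hits_le hP S l
      have h2 : guessCost B lab l g = (S ∩ B).card + ∑ κ ∈ pathLabels B lab, hitCount len f S l κ := by
        unfold guessCost
        rw [hgB, Finset.sum_congr rfl hgK]
      omega
    · have hl' := hlab' l g hg
      rw [hkept] at hl'
      have hH := hallCondition_of_small hP hS hl'
        (Set.toFinset (spanned (guessKept B lab l g) (lab' l g) h))
        (fun u hu => hkept ▸ ((Set.mem_toFinset.1 hu).1))
        (fun u hu v hv huv => by
          obtain ⟨h1, w, h2, h3, h4⟩ := Set.mem_toFinset.1 hu
          exact Set.mem_toFinset.2 ⟨hkept ▸ hv, w, h2, h3, h4.trans huv.symm⟩)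
      have := hallFor_iff (l := l) (g := g) hP (lab' l g)
        (Set.toFinset (spanned (guessKept B lab l g) (lab' l g) h))
      rw [Set.coe_toFinset] at this
      rw [this]
      have hconf : confined B lab len f (guessSet B g) (guessHits lab l g)
          (Set.toFinset (spanned (guessKept B lab l g) (lab' l g) h)) =
          confined B lab len f (S ∩ B) (hitCount len f S l)
          (Set.toFinset (spanned (guessKept B lab l g) (lab' l g) h)) := by
        simp only [confined, hgB]
        refine Finset.filter_congr fun κ hκ => ?_
        rw [hgK κ hκ]
      rw [hconf]
      refine le_trans (Nat.add_le_add_left (le_of_eq (Finset.sum_congr rfl fun κ hκ => ?_)) _) hH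
      simp only [rest, hgB]
      rw [hgK κ (Finset.mem_filter.1 hκ).1]
  · rintro ⟨l, hl, g, hg, hk, hH⟩
    have hl' := hlab' l g hg
    obtain ⟨S, hS, hS'⟩ := exists_deletion hP hl' (l := l) (fun F hF hcl => by
      -- The labels `lab v = v` inside `F` determine `F`. A vertex of `F` in `B` is its own label,
      -- and any other one lies on an untouched path, whose label is in the same kept component and
      -- therefore in `F`.
      let h : V → ℕ := fun v => if lab v = v ∧ v ∈ F then 1 else 0
      have hh : h ∈ Γ := by
        refine hΓ h (fun v => ?_) fun v hv => by simp [h, hv]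
        simp only [h]; split_ifs <;> omega
      have hFs : spanned (guessKept B lab l g) (lab' l g) h = (F : Set V) := by
        ext u
        constructor
        · rintro ⟨h1, w, h2, h3, h4⟩
          have hw : w ∈ F := by
            by_contra hw
            simp [h, hw] at h2
          exact hcl w hw u h1 h4.symm
        · intro hu
          have huU := hF u hu
          refine ⟨huU, ?_⟩
          by_cases huB : u ∈ B
          · refine ⟨u, ?_, huU, rfl⟩
            have h1 : lab u = u := hlab.off u (by simpa using huB)
            have h2 : u ∈ F := hu
            simp [h, h1, h2]
          · have h0 : guessHits lab l g (lab u) = 0 := by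
              rcases huU with h1 | h1
              · exact absurd h1.1 huB
              · exact h1.2
            have hreach : (within G (guessKept B lab l g)).Reachable u (lab u) := by
              have hr := hlab.reach u huB
              have hsub : ∀ w, lab w = lab u → w ∉ B → w ∈ guessKept B lab l g := fun w hw hwB =>
                Or.inr ⟨hwB, by rw [hw]; exact h0⟩
              obtain ⟨p⟩ := hr
              have key : ∀ (a b : V) (p : (within G {v | v ∉ B}).Walk a b), lab a = lab u →
                  (within G (guessKept B lab l g)).Reachable a b := by
                intro a b p
                induction p with
                | nil => intro _; rfl
                | @cons a c b hac _ ih =>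
                  intro ha
                  have hc : lab c = lab u :=
                    (hlab.adj a c hac.2.1 hac.2.2 hac.1).symm.trans ha
                  have : (within G (guessKept B lab l g)).Adj a c :=
                    ⟨hac.1, hsub a ha hac.2.1, hsub c hc hac.2.2⟩
                  exact this.reachable.trans (ih hc)
              exact key _ _ p rfl
            have hlu : lab' l g u = lab' l g (lab u) := hl'.eq_of_reachable hreach
            have hmem : lab u ∈ guessKept B lab l g := within_reachable_mem hreach huU
            have hF' : lab u ∈ F := hcl u hu _ hmem hlu.symm
            exact ⟨lab u, by simp [h, hlab.idem u, hF'], hmem, hlu.symm⟩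
      have := hH h hh
      rw [hFs] at this
      exact (hallFor_iff hP _ F).1 this)
    exact ⟨S, l, hS', by unfold guessCost at hk; omega⟩
end Guess

/-! ### Terms for logic and arithmetic -/

/-- `s'` extends `s`: they agree on the registers below `m` and the arrays below `A`. -/
structure Ext (m A : ℕ) (s s' : Store) : Prop where
  reg : ∀ x < m, s'.reg x = s.reg x
  arr : ∀ a < A, s'.arr a = s.arr a

theorem Ext.bind {m A : ℕ} (s : Store) (v : ℕ) : Ext m A s (s.setReg m v) :=
  ⟨fun x hx => by simp [hx.ne], fun _ _ => rfl⟩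

theorem Ext.bind₂ {m A : ℕ} (s : Store) (v w : ℕ) :
    Ext m A s ((s.setReg m v).setReg (m + 1) w) :=
  ⟨fun x hx => by simp [hx.ne, (show x ≠ m + 1 by omega)], fun _ _ => rfl⟩

theorem Ext.tab {m A : ℕ} (s : Store) (c : ℕ → ℕ) : Ext m A s (s.setTab A c) :=
  ⟨fun _ _ => rfl, fun a ha => by simp [ha.ne]⟩

theorem Ext.trans {m A m' A' : ℕ} {s s' s'' : Store} (h : Ext m A s s') (h' : Ext m' A' s' s'')
    (hm : m ≤ m') (hA : A ≤ A') : Ext m A s s'' :=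
  ⟨fun x hx => (h'.reg x (by omega)).trans (h.reg x hx),
    fun a ha => (h'.arr a (by omega)).trans (h.arr a ha)⟩

namespace Tm

/-- Comparison. -/
def leT (a b : Tm) : Tm := .sub (.lit 1) (.sub a b)
/-- Equality. -/
def eqT (a b : Tm) : Tm := .sub (.lit 1) (.add (.sub a b) (.sub b a))
/-- Conjunction. -/
def andT (a b : Tm) : Tm := .cond a b (.lit 0)
/-- Disjunction. -/
def orT (a b : Tm) : Tm := .cond a (.lit 1) b
/-- Implication. -/
def impT (a b : Tm) : Tm := .cond a b (.lit 1)
/-- Negation. -/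
def notT (a : Tm) : Tm := .sub (.lit 1) a
/-- The sum of the values of `b`, at level `m + 2` with index `m + 1`. -/
def sumT (y m : ℕ) (b : Tm) : Tm := .iter y (.lit 0) (.add (.var m) b)
/-- Existential quantification. -/
def exT (y m : ℕ) (b : Tm) : Tm := leT (.lit 1) (sumT y m b)
/-- Universal quantification. -/
def allT (y m : ℕ) (b : Tm) : Tm := notT (exT y m (notT b))
/-- The product of register `x`, which is at most register `0`, and `b`, at level `m + 2`. -/
def mulT (m x : ℕ) (b : Tm) : Tm :=
  sumT 0 m (.cond (leT (.add (.var (m + 1)) (.lit 1)) (.var x)) b (.lit 0))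

variable {m A : ℕ} {s : Store} {a b : Tm} {P Q : Prop}

theorem eval_leT : (leT a b).eval m A s = ind (a.eval m A s ≤ b.eval m A s) := by
  simp only [leT, eval, ind]; split_ifs <;> omega

theorem eval_eqT : (eqT a b).eval m A s = ind (a.eval m A s = b.eval m A s) := by
  simp only [eqT, eval, ind]; split_ifs <;> omega

theorem eval_notT (ha : a.eval m A s = ind P) : (notT a).eval m A s = ind (¬ P) := by
  simp only [notT, eval, ha]
  by_cases h : P <;> simp [ind, h]

theorem eval_andT (ha : a.eval m A s = ind P) (hb : b.eval m A s = ind Q) :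
    (andT a b).eval m A s = ind (P ∧ Q) := by
  simp only [andT, eval, ha, hb]
  by_cases h : P <;> by_cases h' : Q <;> simp [ind, h, h']

theorem eval_orT (ha : a.eval m A s = ind P) (hb : b.eval m A s = ind Q) :
    (orT a b).eval m A s = ind (P ∨ Q) := by
  simp only [orT, eval, ha, hb]
  by_cases h : P <;> by_cases h' : Q <;> simp [ind, h, h']

theorem eval_impT (ha : a.eval m A s = ind P) (hb : b.eval m A s = ind Q) :
    (impT a b).eval m A s = ind (P → Q) := by
  simp only [impT, eval, ha, hb]
  by_cases h : P <;> by_cases h' : Q <;> simp [ind, h, h']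

theorem eval_cond_ind {v : ℕ} (ha : a.eval m A s = ind P) (hb : b.eval m A s = v) :
    (cond a b (.lit 0)).eval m A s = ind P * v := by
  simp only [eval, ha, hb]
  by_cases h : P <;> simp [ind, h]

/-- The hypothesis covers all extensions of the memory, so that the value of the body does not
depend on the partial sum in register `m`. -/
theorem eval_sumT {y : ℕ} {F : ℕ → ℕ} (h : ∀ i < s.reg y, ∀ s', Ext m A s s' →
    s'.reg (m + 1) = i → b.eval (m + 2) A s' = F i) :
    (sumT y m b).eval m A s = ∑ i ∈ Finset.range (s.reg y), F i := by
  suffices H : ∀ k ≤ s.reg y, (Nat.rec (0 : ℕ) (fun i acc => acc +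
      b.eval (m + 2) A ((s.setReg m acc).setReg (m + 1) i)) k : ℕ) = ∑ i ∈ Finset.range k, F i by
    simpa [sumT, eval] using H _ le_rfl
  intro k
  induction k with
  | zero => intro _; rfl
  | succ k ih =>
    intro hk
    rw [Finset.sum_range_succ, ← ih (by omega)]
    exact congrArg _ (h k (by omega) _ (Ext.bind₂ s _ _) (by simp))

theorem eval_exT {y : ℕ} {p : ℕ → Prop} (h : ∀ i < s.reg y, ∀ s', Ext m A s s' →
    s'.reg (m + 1) = i → b.eval (m + 2) A s' = ind (p i)) :
    (exT y m b).eval m A s = ind (∃ i < s.reg y, p i) := by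
  rw [exT, eval_leT, eval_sumT h]
  refine ind_congr ?_
  rw [eval, Nat.one_le_iff_ne_zero, Ne, Finset.sum_eq_zero_iff]
  push Not
  refine exists_congr fun i => ?_
  rw [Finset.mem_range]
  refine and_congr_right fun _ => ?_
  by_cases hp : p i <;> simp [ind, hp]

theorem eval_allT {y : ℕ} {p : ℕ → Prop} (h : ∀ i < s.reg y, ∀ s', Ext m A s s' →
    s'.reg (m + 1) = i → b.eval (m + 2) A s' = ind (p i)) :
    (allT y m b).eval m A s = ind (∀ i < s.reg y, p i) := by
  rw [allT, eval_notT (eval_exT fun i hi s' hs' hr => eval_notT (h i hi s' hs' hr))]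
  exact ind_congr (by push Not; rfl)

section Fin
variable {n : ℕ} (hn : s.reg 0 = n)
include hn

theorem eval_sumFin {F : Fin n → ℕ} (h : ∀ (i : Fin n) (s' : Store), Ext m A s s' →
    s'.reg (m + 1) = i → b.eval (m + 2) A s' = F i) :
    (sumT 0 m b).eval m A s = ∑ i, F i := by
  subst hn
  rw [eval_sumT (F := fun i => if hi : i < s.reg 0 then F ⟨i, hi⟩ else 0)
    (fun i hi s' hs' hr => by rw [dif_pos hi]; exact h ⟨i, hi⟩ s' hs' hr), Finset.sum_range]
  simp

theorem eval_exFin {p : Fin n → Prop} (h : ∀ (i : Fin n) (s' : Store), Ext m A s s' →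
    s'.reg (m + 1) = i → b.eval (m + 2) A s' = ind (p i)) :
    (exT 0 m b).eval m A s = ind (∃ i, p i) := by
  subst hn
  rw [eval_exT (p := fun i => ∃ hi : i < s.reg 0, p ⟨i, hi⟩)
    (fun i hi s' hs' hr => (h ⟨i, hi⟩ s' hs' hr).trans (ind_congr (by simp [hi])))]
  refine ind_congr ⟨?_, ?_⟩
  · rintro ⟨i, -, hi, hp⟩; exact ⟨_, hp⟩
  · rintro ⟨i, hp⟩; exact ⟨i, i.2, i.2, hp⟩

theorem eval_allFin {p : Fin n → Prop} (h : ∀ (i : Fin n) (s' : Store), Ext m A s s' →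
    s'.reg (m + 1) = i → b.eval (m + 2) A s' = ind (p i)) :
    (allT 0 m b).eval m A s = ind (∀ i, p i) := by
  rw [allT, eval_notT (eval_exFin hn fun i s' hs' hr => eval_notT (h i s' hs' hr))]
  exact ind_congr (by push Not; rfl)

theorem eval_mulT {x u v : ℕ} (hx : s.reg x = u) (hxm : x < m) (hu : u ≤ n)
    (h : ∀ s' : Store, Ext m A s s' → b.eval (m + 2) A s' = v) :
    (mulT m x b).eval m A s = u * v := by
  rw [mulT, eval_sumFin hn (F := fun i => ind ((i : ℕ) + 1 ≤ u) * v)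
    (fun i s' hs' hr => eval_cond_ind (by rw [eval_leT]; simp only [eval, hr, hs'.reg x hxm, hx])
      (h s' hs')), ← Finset.sum_mul, sum_ind]
  simp only [Nat.succ_le_iff, Fin.card_filter_val_lt, min_eq_right hu]
end Fin

end Tm

/-! ### Labels and digits -/

section MinLabel
variable {n : ℕ} (G : SimpleGraph (Fin n)) (U : Set (Fin n))

/-- The least vertex of the component of `i` in `G[U]`. -/
noncomputable def minLabel (i : Fin n) : Fin n :=
  (wellFounded_lt (α := Fin n)).min {v | (within G U).Reachable i v} ⟨i, .rfl⟩

variable {G U}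

theorem minLabel_reachable (i : Fin n) : (within G U).Reachable i (minLabel G U i) :=
  WellFounded.min_mem (wellFounded_lt (α := Fin n)) {v | (within G U).Reachable i v} _

theorem minLabel_le {i v : Fin n} (h : (within G U).Reachable i v) : minLabel G U i ≤ v :=
  not_lt.1 (WellFounded.not_lt_min (wellFounded_lt (α := Fin n)) _ h)

theorem isLabel_minLabel : IsLabel G U (minLabel G U) where
  adj u v hu hv h := by
    have h' : (within G U).Reachable u v := SimpleGraph.Adj.reachable ⟨h, hu, hv⟩
    exact le_antisymm (minLabel_le (h'.trans (minLabel_reachable v)))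
      (minLabel_le (h'.symm.trans (minLabel_reachable u)))
  reach u _ := minLabel_reachable u
  off u hu := by
    obtain ⟨p⟩ := minLabel_reachable (G := G) (U := U) u
    revert p
    generalize minLabel G U u = v
    intro p
    cases p with
    | nil => rfl
    | cons h _ => exact absurd h.2.1 hu

/-- After `t` rounds the entry of `i` is a vertex of the component of `i` and is at most every
vertex reached by a walk of length at most `t`. Paths have length less than `n`, so `n` rounds
suffice. -/
theorem eq_minLabel_of_rounds {C : ℕ → Fin n → ℕ} (h0 : ∀ i, C 0 i = i)
    (hle : ∀ t i, C (t + 1) i ≤ C t i)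
    (hadj : ∀ t i j, (within G U).Adj i j → C (t + 1) i ≤ C t j)
    (hor : ∀ t i, C (t + 1) i = C t i ∨ ∃ j, (within G U).Adj i j ∧ C (t + 1) i = C t j)
    (i : Fin n) : C n i = minLabel G U i := by
  have hreach : ∀ t i, ∃ v : Fin n, C t i = v ∧ (within G U).Reachable i v := by
    intro t
    induction t with
    | zero => exact fun i => ⟨i, h0 i, .rfl⟩
    | succ t ih =>
      intro i
      rcases hor t i with h | ⟨j, hij, h⟩
      · obtain ⟨v, hv, hr⟩ := ih i
        exact ⟨v, h.trans hv, hr⟩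
      · obtain ⟨v, hv, hr⟩ := ih j
        exact ⟨v, h.trans hv, hij.reachable.trans hr⟩
  have hwalk : ∀ {i v : Fin n} (p : (within G U).Walk i v) (t : ℕ), p.length ≤ t → C t i ≤ v := by
    intro i v p
    induction p with
    | @nil u =>
      intro t _
      induction t with
      | zero => exact (h0 u).le
      | succ t ih => exact (hle t u).trans (ih (Nat.zero_le _))
    | cons h p ih =>
      intro t ht
      obtain _ | t := t
      · simp at ht
      · exact (hadj t _ _ h).trans (ih t (by simpa using ht))
  refine le_antisymm ?_ ?_
  · obtain ⟨p⟩ := minLabel_reachable (G := G) (U := U) i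
    classical
    refine hwalk p.toPath.1 n ?_
    simpa using p.toPath.2.length_lt.le
  · obtain ⟨v, hv, hr⟩ := hreach n i
    rw [hv]
    exact minLabel_le hr

end MinLabel

/-- One pass of a search for a minimum. -/
theorem foldMin_spec (M : ℕ → Prop) [DecidablePred M] (c₀ : ℕ) (v : ℕ → ℕ) (k : ℕ) :
    let r : ℕ := Nat.rec c₀ (fun j acc => if M j ∧ v j < acc then v j else acc) k
    r ≤ c₀ ∧ (∀ j < k, M j → r ≤ v j) ∧ (r = c₀ ∨ ∃ j < k, M j ∧ r = v j) := by
  induction k with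
  | zero => simp
  | succ k ih =>
    obtain ⟨h1, h2, h3⟩ := ih
    simp only at h1 h2 h3 ⊢
    generalize (Nat.rec c₀ (fun j acc => if M j ∧ v j < acc then v j else acc) k : ℕ) = r
      at h1 h2 h3 ⊢
    split_ifs with h
    · refine ⟨h.2.le.trans h1, fun j hj hM => ?_, Or.inr ⟨k, by omega, h.1, rfl⟩⟩
      rcases Nat.lt_succ_iff_lt_or_eq.1 hj with hj | rfl
      · exact h.2.le.trans (h2 j hj hM)
      · exact le_rfl
    · refine ⟨h1, fun j hj hM => ?_, h3.imp_right fun ⟨j, hj, h⟩ => ⟨j, by omega, h⟩⟩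
      rcases Nat.lt_succ_iff_lt_or_eq.1 hj with hj | rfl
      · exact h2 j hj hM
      · exact not_lt.1 fun h' => h ⟨hM, h'⟩

/-! ### Coding guesses in base 4 -/

section Digits
variable (W : ℕ → Prop) [DecidablePred W]

/-- The digits of `N` in base `4`, distributed over the elements of `W`. -/
def digit (N v : ℕ) : ℕ := if W v then N / 4 ^ Nat.count W v % 4 else 0

/-- The position of a digit is the number of smaller elements of `W`; therefore `4 ^ |W|` numbers
suffice instead of `4 ^ n`. -/
theorem exists_digits (g : ℕ → ℕ) (hg : ∀ v, g v < 4) (n : ℕ) :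
    ∃ N < 4 ^ Nat.count W n, ∀ v < n, W v → N / 4 ^ Nat.count W v % 4 = g v := by
  induction n with
  | zero => exact ⟨0, by simp, by simp⟩
  | succ n ih =>
    obtain ⟨N, hN, h⟩ := ih
    by_cases hW : W n
    · refine ⟨N + 4 ^ Nat.count W n * g n, ?_, fun v hv hWv => ?_⟩
      · rw [Nat.count_succ, if_pos hW, pow_succ]
        calc N + 4 ^ Nat.count W n * g n < 4 ^ Nat.count W n * (1 + g n) := by rw [mul_add]; omega
          _ ≤ _ := Nat.mul_le_mul_left _ (by have := hg n; omega)
      · rcases Nat.lt_succ_iff_lt_or_eq.1 hv with hv | rfl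
        · have hlt : Nat.count W v < Nat.count W n := Nat.count_strict_mono hWv hv
          obtain ⟨e, he⟩ := Nat.exists_eq_add_of_lt hlt
          rw [he, show 4 ^ (Nat.count W v + e + 1) * g n =
            4 ^ Nat.count W v * (4 * (4 ^ e * g n)) by ring,
            Nat.add_mul_div_left _ _ (by positivity), Nat.add_mul_mod_self_left, h v hv hWv]
        · rw [Nat.add_mul_div_left _ _ (by positivity), Nat.div_eq_of_lt hN, zero_add,
            Nat.mod_eq_of_lt (hg _)]
    · refine ⟨N, by rwa [Nat.count_succ, if_neg hW, add_zero], fun v hv hWv => ?_⟩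
      rcases Nat.lt_succ_iff_lt_or_eq.1 hv with hv | rfl
      · exact h v hv hWv
      · exact absurd hWv hW

/-- A digit is reached by one division by four for each smaller element of `W`. -/
theorem foldDiv_eq (N v k : ℕ) :
    (Nat.rec N (fun u acc => if W u ∧ u < v then acc / 4 else acc) k : ℕ) =
      N / 4 ^ Nat.count W (min k v) := by
  induction k with
  | zero => simp
  | succ k ih =>
    simp only
    rw [ih]
    rcases lt_or_ge k v with h | h
    · rw [min_eq_left h.le, min_eq_left (Nat.succ_le_of_lt h), Nat.count_succ]
      by_cases hW : W k
      · rw [if_pos ⟨hW, h⟩, if_pos hW, pow_succ, Nat.div_div_eq_div_mul]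
      · rw [if_neg (fun h' => hW h'.1), if_neg hW, add_zero]
    · rw [min_eq_right h, min_eq_right (h.trans k.le_succ), if_neg (fun h' => h.not_gt h'.2)]

theorem foldPow_eq (k : ℕ) :
    (Nat.rec 1 (fun u acc => if W u then acc + acc + (acc + acc) else acc) k : ℕ) =
      4 ^ Nat.count W k := by
  induction k with
  | zero => simp
  | succ k ih =>
    simp only
    rw [ih, Nat.count_succ]
    split_ifs
    · rw [pow_succ]; omega
    · rfl

end Digits

/-- Division, which is not an operation of the machine, is done by counting the positive multiples
of `b` up to `a`; `N` is the length of the counting loop. -/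
theorem card_multiples_le (b a N : ℕ) (hb : 0 < b) (h : a ≤ N) :
    ∑ i ∈ Finset.range N, ind ((i + 1) * b ≤ a) = a / b := by
  simp only [← Nat.le_div_iff_mul_le hb, Nat.succ_le_iff]
  rw [Finset.sum_range (fun i => ind (i < a / b)), sum_ind, Fin.card_filter_val_lt,
    min_eq_right ((Nat.div_le_self a b).trans h)]


/-! ### The terms of the algorithm -/

section Terms
variable {n : ℕ}

/-- The vertices whose degree is not `2`, and the vertex `0`. -/
noncomputable def special (G : SimpleGraph (Fin n)) : Finset (Fin n) :=
  {v : Fin n | (G.neighborSet v).ncard ≠ 2 ∨ (v : ℕ) = 0}.toFinite.toFinset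

theorem mem_special {G : SimpleGraph (Fin n)} {v : Fin n} :
    v ∈ special G ↔ (G.neighborSet v).ncard ≠ 2 ∨ (v : ℕ) = 0 := by
  simp [special]

/-- The memory holds the graph `G`. -/
structure Input (G : SimpleGraph (Fin n)) (s : Store) : Prop where
  size : s.reg 0 = n
  adj : ∀ i j : Fin n, s.arr 0 (i * n + j) = ind (G.Adj i j)

/-- The array `a` holds the table `f`. -/
def Holds (s : Store) (a : ℕ) (f : Fin n → ℕ) : Prop := ∀ i : Fin n, s.arr a i = f i

variable {G : SimpleGraph (Fin n)} {m A a x y : ℕ} {s s' : Store} {i j : Fin n}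

theorem Input.ext (h : Input G s) (e : Ext m A s s') (hm : 1 ≤ m) (hA : 1 ≤ A) : Input G s' :=
  ⟨(e.reg 0 hm).trans h.size, fun i j => by rw [e.arr 0 hA]; exact h.adj i j⟩

theorem Holds.ext {f : Fin n → ℕ} (h : Holds s a f) (e : Ext m A s s') (hA : a < A) :
    Holds s' a f := fun i => by rw [e.arr a hA]; exact h i

namespace Tm

/-- Adjacency of the vertices in the registers `x` and `y`. -/
def adjT (m x y : ℕ) : Tm := .get 0 (.add (mulT m x (.var 0)) (.var y))

theorem eval_adjT (h : Input G s) (hxm : x < m) (hx : s.reg x = i) (hy : s.reg y = j) :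
    (adjT m x y).eval m A s = ind (G.Adj i j) := by
  have h1 : (mulT m x (.var 0)).eval m A s = i * n :=
    eval_mulT h.size hx hxm i.2.le fun s' e => (e.reg 0 (by omega)).trans h.size
  rw [adjT, eval, eval, h1, eval, hy, h.adj]

/-- Membership in `special G`. -/
def specialT (m x : ℕ) : Tm :=
  .cond (.var x) (notT (eqT (sumT 0 m (adjT (m + 2) x (m + 1))) (.lit 2))) (.lit 1)

theorem eval_specialT (h : Input G s) (hA : 1 ≤ A) (hxm : x < m) (hx : s.reg x = i) :
    (specialT m x).eval m A s = ind (i ∈ special G) := by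
  classical
  have h1 : (sumT 0 m (adjT (m + 2) x (m + 1))).eval m A s = (G.neighborSet i).ncard := by
    rw [eval_sumFin h.size fun j s' e hr => eval_adjT (j := j) (h.ext e (by omega) hA) (by omega)
      ((e.reg x hxm).trans hx) hr, sum_ind, Set.ncard_eq_toFinset_card']
    congr 1
    ext j
    simp
  simp only [specialT, eval, hx]
  rw [eval_notT (P := (G.neighborSet i).ncard = 2) (by rw [eval_eqT, h1, eval])]
  by_cases h0 : (i : ℕ) = 0
  · rw [if_neg (by simpa using h0), ind_of (mem_special.2 (.inr h0))]
  · rw [if_pos h0]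
    exact ind_congr (by simp [mem_special, h0])

end Tm

/-- The memory holds the graph `G`, the labels of `G - special G`, and the guesses `l`, `g`. -/
structure Guessed (G : SimpleGraph (Fin n)) (lab : Fin n → Fin n) (l : ℕ) (g : Fin n → ℕ)
    (s : Store) : Prop extends Input G s where
  lab : Holds s 2 fun v => lab v
  le : l ≤ n
  num : s.reg 5 = l
  guess : Holds s 4 g

variable {lab lab' : Fin n → Fin n} {l : ℕ} {g h : Fin n → ℕ}

theorem Guessed.ext (c : Guessed G lab l g s) (e : Ext m A s s') (hm : 6 ≤ m) (hA : 5 ≤ A) :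
    Guessed G lab l g s' where
  toInput := c.toInput.ext e (by omega) (by omega)
  lab := c.lab.ext e (by omega)
  le := c.le
  num := (e.reg 5 (by omega)).trans c.num
  guess := c.guess.ext e (by omega)

/-- The memory holds in addition labels of the kept part and a choice of some of them. -/
structure Chosen (G : SimpleGraph (Fin n)) (lab : Fin n → Fin n) (l : ℕ) (g : Fin n → ℕ)
    (lab' : Fin n → Fin n) (h : Fin n → ℕ) (s : Store) : Prop extends Guessed G lab l g s where
  lab' : Holds s 6 fun v => lab' v
  choice : Holds s 8 h

theorem Chosen.ext (c : Chosen G lab l g lab' h s) (e : Ext m A s s') (hm : 6 ≤ m) (hA : 9 ≤ A) :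
    Chosen G lab l g lab' h s' where
  toGuessed := c.toGuessed.ext e hm (by omega)
  lab' := c.lab'.ext e (by omega)
  choice := c.choice.ext e (by omega)

namespace Tm

/-- The test whether the label of the vertex in `x` is the vertex in `y`. -/
def labT (x y : ℕ) : Tm := eqT (.get 2 (.var x)) (.var y)

theorem eval_labT (c : Holds s 2 fun v => lab v) (hx : s.reg x = i) (hy : s.reg y = j) :
    (labT x y).eval m A s = ind (lab i = j) := by
  rw [labT, eval_eqT, eval, eval, eval, hx, c i, hy]
  exact ind_congr Fin.val_inj

/-- `classSize` -/
def sizeT (m x : ℕ) : Tm := sumT 0 m (labT (m + 1) x)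

theorem eval_sizeT (c : Guessed G lab l g s) (hm : 6 ≤ m) (hA : 5 ≤ A) (hxm : x < m)
    (hx : s.reg x = i) : (sizeT m x).eval m A s = classSize lab i := by
  rw [sizeT, eval_sumFin c.size fun j s' e hr => eval_labT (c.ext e hm hA).lab hr
    ((e.reg x hxm).trans hx), sum_ind]
  rfl

/-- `guessHits` -/
def hitsT (m x : ℕ) : Tm :=
  .add (sumT 0 m (leT (.add (mulT (m + 2) (m + 1) (.add (.var 5) (.lit 1)))
    (.add (.var 5) (.lit 1))) (sizeT (m + 2) x))) (.get 4 (.var x))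

theorem eval_hitsT (c : Guessed G lab l g s) (hm : 6 ≤ m) (hA : 5 ≤ A) (hxm : x < m)
    (hx : s.reg x = i) : (hitsT m x).eval m A s = guessHits lab l g i := by
  -- A class has at most `n` vertices, so a counting loop of length `n` finds the quotient.
  rw [hitsT, eval, eval, eval, hx, c.guess i, guessHits,
    ← card_multiples_le (l + 1) (classSize lab i) n l.succ_pos
      ((Finset.card_le_univ _).trans_eq (Fintype.card_fin n)),
    eval_sumT (F := fun j => ind ((j + 1) * (l + 1) ≤ classSize lab i)), c.size]
  intro j hj s' e hr
  have c' := c.ext e hm hA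
  rw [eval_leT, eval_sizeT c' (by omega) hA (by omega) ((e.reg x hxm).trans hx), eval,
    eval_mulT (v := l + 1) c'.size hr (by omega) (by rw [← c.size]; omega)
      (fun s'' e' => by simp only [eval, (c'.ext e' (by omega) hA).num])]
  simp only [eval, c'.num]
  exact ind_congr (by rw [add_mul, one_mul])

/-- `guessSet` -/
def inSetT (m x : ℕ) : Tm := andT (specialT m x) (leT (.lit 1) (.get 4 (.var x)))

theorem eval_inSetT (c : Guessed G lab l g s) (hA : 5 ≤ A) (hxm : x < m)
    (hx : s.reg x = i) : (inSetT m x).eval m A s = ind (i ∈ guessSet (special G) g) := by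
  rw [inSetT, eval_andT (eval_specialT c.toInput (by omega) hxm hx) (Q := 1 ≤ g i)
    (by rw [eval_leT, eval, eval, eval, hx, c.guess i])]
  exact ind_congr (by simp [guessSet])

/-- `guessKept` -/
def keptT (m x : ℕ) : Tm :=
  orT (andT (specialT m x) (notT (inSetT m x)))
    (andT (notT (specialT m x)) (.bind (.get 2 (.var x)) (eqT (hitsT (m + 1) m) (.lit 0))))

theorem eval_keptT (c : Guessed G lab l g s) (hm : 6 ≤ m) (hA : 5 ≤ A) (hxm : x < m)
    (hx : s.reg x = i) :
    (keptT m x).eval m A s = ind (i ∈ guessKept (special G) lab l g) := by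
  have h1 := eval_specialT c.toInput (A := A) (by omega) hxm hx
  refine eval_orT (eval_andT h1 (eval_notT (eval_inSetT c hA hxm hx)))
    (eval_andT (eval_notT h1) ?_)
  rw [eval, eval_eqT, eval, eval, eval, hx, c.lab i, eval_hitsT (i := lab i)
    (c.ext (Ext.bind (A := A) s _) hm hA) (by omega) hA (by omega) (by simp)]

/-- `guessEdges` -/
def edgesT (m x : ℕ) : Tm :=
  sumT 0 m (sumT 0 (m + 2) (andT (labT (m + 1) x)
    (andT (adjT (m + 4) (m + 1) (m + 3)) (inSetT (m + 4) (m + 3)))))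

theorem eval_edgesT (c : Guessed G lab l g s) (hm : 6 ≤ m) (hA : 5 ≤ A) (hxm : x < m)
    (hx : s.reg x = i) : (edgesT m x).eval m A s = guessEdges G (special G) lab g i := by
  rw [edgesT, guessEdges]
  refine eval_sumFin c.size fun u s' e hr => ?_
  have c' := c.ext e hm hA
  refine eval_sumFin c'.size fun w s'' e' hr' => ?_
  have c'' := c'.ext e' (by omega) hA
  have hr1 := (e'.reg _ (by omega)).trans hr
  have hx1 := (e'.reg x (by omega)).trans ((e.reg x hxm).trans hx)
  exact eval_andT (eval_labT c''.lab hr1 hx1) (eval_andT (eval_adjT c''.toInput (by omega) hr1 hr')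
    (eval_inSetT c'' hA (by omega) hr'))

/-- `guessRest` -/
def restT (m x : ℕ) : Tm :=
  .sub (.sub (sizeT m x) (hitsT m x))
    (mulT m 5 (.sub (.add (hitsT (m + 2) x) (edgesT (m + 2) x)) (.lit 1)))

theorem eval_restT (c : Guessed G lab l g s) (hm : 6 ≤ m) (hA : 5 ≤ A) (hxm : x < m)
    (hx : s.reg x = i) : (restT m x).eval m A s = guessRest G (special G) lab l g i := by
  rw [restT, eval, eval, eval_sizeT c hm hA hxm hx, eval_hitsT c hm hA hxm hx, guessRest,
    eval_mulT c.size c.num (by omega) c.le]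
  intro s' e
  have c' := c.ext e hm hA
  have hx' := (e.reg x hxm).trans hx
  rw [eval, eval, eval, eval_hitsT c' (by omega) hA (by omega) hx',
    eval_edgesT c' (by omega) hA (by omega) hx']

/-- The test whether the vertex in `x` is the label of a path. -/
def pathT (m x : ℕ) : Tm := andT (notT (specialT m x)) (labT x x)

theorem eval_pathT (c : Guessed G lab l g s) (hA : 5 ≤ A) (hxm : x < m)
    (hx : s.reg x = i) : (pathT m x).eval m A s = ind (i ∉ special G ∧ lab i = i) :=
  eval_andT (eval_notT (eval_specialT c.toInput (by omega) hxm hx)) (eval_labT c.lab hx hx)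

/-- `guessCost` -/
def costT (m : ℕ) : Tm :=
  .add (sumT 0 m (inSetT (m + 2) (m + 1)))
    (sumT 0 m (.cond (pathT (m + 2) (m + 1)) (hitsT (m + 2) (m + 1)) (.lit 0)))

theorem eval_costT (c : Guessed G lab l g s) (hm : 6 ≤ m) (hA : 5 ≤ A) :
    (costT m).eval m A s = guessCost (special G) lab l g := by
  classical
  rw [costT, eval, guessCost,
    eval_sumFin c.size fun u s' e hr =>
      eval_inSetT (i := u) (c.ext e hm hA) hA (by omega) hr,
    eval_sumFin c.size fun u s' e hr =>
      eval_cond_ind (eval_pathT (i := u) (c.ext e hm hA) hA (by omega) hr)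
        (eval_hitsT (c.ext e hm hA) (by omega) hA (by omega) hr), sum_ind, sum_ind_mul]
  congr 2
  ext u
  simp

/-- `spanned` -/
def spanT (m x : ℕ) : Tm :=
  andT (keptT m x) (exT 0 m (andT (leT (.lit 1) (.get 8 (.var (m + 1))))
    (andT (keptT (m + 2) (m + 1)) (eqT (.get 6 (.var (m + 1))) (.get 6 (.var x))))))

theorem eval_spanT (c : Chosen G lab l g lab' h s) (hm : 6 ≤ m) (hA : 9 ≤ A) (hxm : x < m)
    (hx : s.reg x = i) : (spanT m x).eval m A s =
      ind (i ∈ spanned (guessKept (special G) lab l g) lab' h) := by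
  refine eval_andT (eval_keptT c.toGuessed hm (by omega) hxm hx) (eval_exFin c.size ?_)
  intro w s' e hr
  have c' := c.ext e hm hA
  refine eval_andT ?_ (eval_andT
    (eval_keptT c'.toGuessed (by omega) (by omega) (by omega) hr) ?_)
  · rw [eval_leT, eval, eval, eval, hr, c'.choice w]
  · rw [eval_eqT, eval, eval, eval, eval, hr, (e.reg x hxm).trans hx, c'.lab' w, c'.lab' i]
    exact ind_congr Fin.val_inj

/-- `GuessConfined` -/
def confinedT (m x : ℕ) : Tm :=
  andT (pathT m x) (andT (leT (.lit 1) (hitsT m x)) (allT 0 m (allT 0 (m + 2)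
    (impT (labT (m + 1) x) (impT (adjT (m + 4) (m + 1) (m + 3)) (impT (specialT (m + 4) (m + 3))
      (orT (inSetT (m + 4) (m + 3)) (spanT (m + 4) (m + 3)))))))))

theorem eval_confinedT (c : Chosen G lab l g lab' h s) (hm : 6 ≤ m) (hA : 9 ≤ A) (hxm : x < m)
    (hx : s.reg x = i) : (confinedT m x).eval m A s = ind (GuessConfined G (special G) lab l g
      (spanned (guessKept (special G) lab l g) lab' h) i) := by
  have hA' : 5 ≤ A := by omega
  refine eval_andT (eval_pathT c.toGuessed hA' hxm hx) (eval_andT ?_ (eval_allFin c.size ?_))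
  · rw [eval_leT, eval, eval_hitsT c.toGuessed hm hA' hxm hx]
  intro u s' e hr
  have c' := c.ext e hm hA
  refine eval_allFin c'.size fun w s'' e' hr' => ?_
  have c'' := c'.ext e' (by omega) hA
  have hr1 := (e'.reg _ (by omega)).trans hr
  have hx1 := (e'.reg x (by omega)).trans ((e.reg x hxm).trans hx)
  exact eval_impT (eval_labT c''.lab hr1 hx1) (eval_impT
    (eval_adjT c''.toInput (by omega) hr1 hr') (eval_impT
      (eval_specialT c''.toInput (by omega) (by omega) hr') (eval_orT
        (eval_inSetT c''.toGuessed hA' (by omega) hr')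
        (eval_spanT c'' (by omega) hA (by omega) hr'))))

/-- `HallFor` -/
def hallT (m : ℕ) : Tm :=
  leT (.add (sumT 0 m (spanT (m + 2) (m + 1)))
    (sumT 0 m (.cond (confinedT (m + 2) (m + 1)) (restT (m + 2) (m + 1)) (.lit 0))))
    (mulT m 5 (sumT 0 (m + 2) (andT (spanT (m + 4) (m + 3))
      (eqT (.get 6 (.var (m + 3))) (.var (m + 3))))))

theorem eval_hallT (c : Chosen G lab l g lab' h s) (hm : 6 ≤ m) (hA : 9 ≤ A) :
    (hallT m).eval m A s = ind (HallFor G (special G) lab l g lab'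
      (spanned (guessKept (special G) lab l g) lab' h)) := by
  have hA' : 5 ≤ A := by omega
  rw [hallT, eval_leT, HallFor, eval,
    eval_sumFin c.size fun u s' e hr =>
      eval_spanT (i := u) (c.ext e hm hA) (by omega) hA (by omega) hr,
    eval_sumFin c.size fun u s' e hr =>
      eval_cond_ind (eval_confinedT (i := u) (c.ext e hm hA) (by omega) hA (by omega) hr)
        (eval_restT (c.ext e hm hA).toGuessed (by omega) hA' (by omega) hr),
    eval_mulT c.size c.num (by omega) c.le]
  intro s' e
  have c' := c.ext e hm hA
  refine eval_sumFin c'.size fun u s'' e' hr => ?_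
  have c'' := c'.ext e' (by omega) hA
  refine eval_andT (eval_spanT c'' (by omega) hA (by omega) hr) ?_
  rw [eval_eqT, eval, eval, eval, hr, c''.lab' u]
  exact ind_congr Fin.val_inj

end Tm
end Terms

/-! ### Tables -/

section Tables

namespace Tm
variable {n m A x y : ℕ} {s : Store} {t₀ t b : Tm}

/-- The body is evaluated only at accumulators that really occur, so bounds on them may be used, as
`eval_quarterT` requires. -/
theorem eval_iter {c₀ k : ℕ} {F : ℕ → ℕ → ℕ} (hy : s.reg y = k) (h₀ : t.eval m A s = c₀)
    (h : ∀ i < k, ∀ acc s', acc = Nat.rec c₀ F i → Ext m A s s' → s'.reg m = acc →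
      s'.reg (m + 1) = i → b.eval (m + 2) A s' = F i acc) :
    (iter y t b).eval m A s = Nat.rec c₀ F k := by
  suffices H : ∀ j ≤ k, (Nat.rec c₀ (fun i acc =>
      b.eval (m + 2) A ((s.setReg m acc).setReg (m + 1) i)) j : ℕ) = Nat.rec c₀ F j by
    rw [eval, h₀, hy]; exact H _ le_rfl
  intro j
  induction j with
  | zero => intro _; rfl
  | succ j ih =>
    intro hj
    simp only
    rw [ih (by omega)]
    exact h j (by omega) _ _ rfl (Ext.bind₂ s _ _) (by simp) (by simp)

/-- `C j` is the table after `j` rounds. The memories in which entries are computed are known only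
up to `Ext`, which hides the choice of auxiliary registers. -/
theorem eval_tab (s : Store) : ∃ (s' : Store) (C : ℕ → ℕ → ℕ), Ext m A s s' ∧
    (tab y t₀ t b).eval m A s = b.eval m (A + 2) s' ∧ s'.arr A = C (s.reg y) ∧
    (∀ i < s.reg 0, ∃ s₁, Ext m A s s₁ ∧ s₁.reg m = i ∧ C 0 i = t₀.eval (m + 1) (A + 2) s₁) ∧
    ∀ j, ∀ i < s.reg 0, ∃ s₁, Ext m A s s₁ ∧ s₁.reg (m + 1) = i ∧ s₁.arr A = C j ∧
      C (j + 1) i = t.eval (m + 2) (A + 2) s₁ := by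
  refine ⟨_, fun k => Nat.rec
        (table (s.reg 0) fun i => t₀.eval (m + 1) (A + 2) (s.setReg m i))
        (fun j c => table (s.reg 0) fun i =>
          t.eval (m + 2) (A + 2) (((s.setReg m j).setReg (m + 1) i).setTab A c)) k,
    Ext.tab s _, rfl, by simp, fun i hi => ⟨_, Ext.bind s i, by simp, by simp [table, hi]⟩,
    fun j i hi => ⟨_, (Ext.bind₂ s j i).trans (Ext.tab (m := m) _ _) le_rfl le_rfl, by simp,
      by simp; rfl, by simp only [table, if_pos hi]⟩⟩

/-- Bind the table `A` to the least labels of the components of `G[U]`, where `mask` tests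
membership in `U`. -/
def minTabT (mask : ℕ → ℕ → Tm) (m A : ℕ) (b : Tm) : Tm :=
  .tab 0 (.var m) (.iter 0 (.get A (.var (m + 1)))
    (.cond (andT (andT (adjT (m + 4) (m + 1) (m + 3))
      (andT (mask (m + 4) (m + 1)) (mask (m + 4) (m + 3))))
        (notT (leT (.var (m + 2)) (.get A (.var (m + 3))))))
      (.get A (.var (m + 3))) (.var (m + 2)))) b

theorem eval_minTabT {G : SimpleGraph (Fin n)} {U : Set (Fin n)} {mask : ℕ → ℕ → Tm}
    (hs : Input G s) (hm : 1 ≤ m) (hA : 1 ≤ A)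
    (hmask : ∀ s' m' x (i : Fin n), Ext m A s s' → m ≤ m' → x < m' → s'.reg x = i →
      (mask m' x).eval m' (A + 2) s' = ind (i ∈ U)) :
    ∃ s', Ext m A s s' ∧ Holds s' A (fun i => (minLabel G U i : ℕ)) ∧
      (minTabT mask m A b).eval m A s = b.eval m (A + 2) s' := by
  classical
  obtain ⟨s', C, he, hev, hC, h0, h1⟩ := eval_tab (m := m) (A := A) (y := 0) (b := b)
    (t₀ := .var m) (t := .iter 0 (.get A (.var (m + 1)))
      (.cond (andT (andT (adjT (m + 4) (m + 1) (m + 3))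
        (andT (mask (m + 4) (m + 1)) (mask (m + 4) (m + 3))))
          (notT (leT (.var (m + 2)) (.get A (.var (m + 3))))))
        (.get A (.var (m + 3))) (.var (m + 2)))) s
  refine ⟨s', he, fun i => ?_, hev⟩
  rw [hs.size] at hC h0 h1
  -- In a round, the inner loop takes the minimum of the old entry of `i` and the old entries of its
  -- neighbours within `U`.
  have hround : ∀ j (i : Fin n), C (j + 1) i = Nat.rec (C j i) (fun k acc =>
      if (∃ hk : k < n, (within G U).Adj i ⟨k, hk⟩) ∧ C j k < acc then C j k else acc) n := by
    intro j i
    obtain ⟨s₁, he₁, hi₁, ha₁, hc⟩ := h1 j i i.2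
    rw [hc]
    have hs₁ := hs.ext he₁ hm hA
    refine eval_iter hs₁.size (by rw [eval, eval, hi₁, ha₁]) ?_
    intro k hk acc s₂ _ he₂ hacc hk₂
    have hs₂ := hs₁.ext he₂ (by omega) (by omega)
    have he := he₁.trans he₂ (by omega) (by omega)
    have hi₂ : s₂.reg (m + 1) = i := (he₂.reg _ (by omega)).trans hi₁
    have ha₂ : s₂.arr A = C j := (he₂.arr _ (by omega)).trans ha₁
    have hk₂' : s₂.reg (m + 3) = (⟨k, hk⟩ : Fin n) := hk₂
    have hcond : (andT (andT (adjT (m + 4) (m + 1) (m + 3))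
        (andT (mask (m + 4) (m + 1)) (mask (m + 4) (m + 3))))
          (notT (leT (.var (m + 2)) (.get A (.var (m + 3)))))).eval (m + 4) (A + 2) s₂ =
        ind ((G.Adj i ⟨k, hk⟩ ∧ i ∈ U ∧ (⟨k, hk⟩ : Fin n) ∈ U) ∧ ¬ acc ≤ C j k) := by
      refine eval_andT (eval_andT (eval_adjT hs₂ (by omega) hi₂ hk₂') (eval_andT
        (hmask _ _ _ _ he (by omega) (by omega) hi₂)
        (hmask _ _ _ _ he (by omega) (by omega) hk₂'))) (eval_notT ?_)
      rw [eval_leT, eval, eval, eval, hk₂', ha₂, hacc]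
    rw [eval, show m + 2 + 2 = m + 4 from rfl, hcond]
    simp only [eval, hk₂', ha₂, hacc]
    rw [ind_eq]
    refine if_congr ?_ rfl rfl
    rw [ite_ne_right_iff]
    simp [within, hk, and_assoc]
  rw [hC]
  refine eq_minLabel_of_rounds (C := fun t i => C t i) ?_ ?_ ?_ ?_ i
  · intro i
    obtain ⟨s₁, -, hi, hc⟩ := h0 i i.2
    simp only [hc, eval, hi]
  all_goals
    intro t i
    have h := foldMin_spec (fun k => ∃ hk : k < n, (within G U).Adj i ⟨k, hk⟩) (C t i) (C t) n
    rw [← hround t i] at h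
  · exact h.1
  · exact fun j hj => h.2.1 j j.2 ⟨j.2, hj⟩
  · exact h.2.2.imp_right fun ⟨j, hj, ⟨hj', ha⟩, h⟩ => ⟨⟨j, hj⟩, ha, h⟩

/-- Four times `t`. -/
def quadT (t : Tm) : Tm := .add (.add t t) (.add t t)

/-- A quarter of register `x`, which is at most register `3`. -/
def quarterT (m x : ℕ) : Tm :=
  sumT 3 m (leT (quadT (.add (.var (m + 1)) (.lit 1))) (.var x))

theorem eval_quarterT (hx : x < m) (h : s.reg x ≤ s.reg 3) :
    (quarterT m x).eval m A s = s.reg x / 4 := by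
  rw [← card_multiples_le 4 (s.reg x) (s.reg 3) (by omega) h]
  refine eval_sumT fun i hi s' e hr => ?_
  rw [eval_leT]
  simp only [quadT, eval, hr, e.reg x hx]
  exact ind_congr (by omega)

end Tm

/-- `v` is the label of a component. -/
def IsRep {n : ℕ} (lab : Fin n → Fin n) (v : ℕ) : Prop := ∃ h : v < n, lab ⟨v, h⟩ = ⟨v, h⟩

open Classical in
/-- The number of labels. -/
noncomputable def repCount {n : ℕ} (lab : Fin n → Fin n) : ℕ := Nat.count (IsRep lab) n

open Classical in
/-- The guess with number `N`. -/
noncomputable def digits {n : ℕ} (lab : Fin n → Fin n) (N : ℕ) (v : Fin n) : ℕ :=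
  digit (IsRep lab) N v

namespace Tm
variable {n m A x y : ℕ} {s : Store} {b : Tm} {G : SimpleGraph (Fin n)} {lab : Fin n → Fin n}

theorem eval_repT {v : ℕ} (c : Holds s 2 fun v => lab v) (hx : s.reg x = v) (hv : v < n) :
    (labT x x).eval m A s = ind (IsRep lab v) := by
  rw [eval_labT (i := ⟨v, hv⟩) (j := ⟨v, hv⟩) c hx hx]
  exact ind_congr (by simp [IsRep, hv])

/-- Four to the number of labels. -/
def powT (m : ℕ) : Tm := .iter 0 (.lit 1) (.cond (labT (m + 1) (m + 1)) (quadT (.var m)) (.var m))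

theorem eval_powT (hs : Input G s) (c : Holds s 2 fun v => lab v) (hA : 3 ≤ A) :
    (powT m).eval m A s = 4 ^ repCount lab := by
  classical
  rw [repCount, ← foldPow_eq]
  refine eval_iter hs.size rfl fun i hi acc s' _ e hacc hr => ?_
  rw [eval, eval_repT (c.ext e (by omega)) hr hi, ind_eq]
  simp only [quadT, eval, hacc]
  exact if_congr (by simp) rfl rfl

/-- The digit of register `x` at the vertex in register `v`. -/
def digitT (m x v : ℕ) : Tm :=
  .cond (labT v v) (.bind (.iter 0 (.var x)
    (.cond (andT (labT (m + 1) (m + 1)) (notT (leT (.var v) (.var (m + 1)))))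
      (quarterT (m + 2) m) (.var m))) (.sub (.var m) (quadT (quarterT (m + 1) m)))) (.lit 0)

/-- The bound on `N` is needed because quarters are found by a counting loop up to register 3. The
digit is the shifted number minus four times its quarter. -/
theorem eval_digitT {v : Fin n} {z N : ℕ} (hs : Input G s) (c : Holds s 2 fun v => lab v)
    (hm : 4 ≤ m) (hA : 3 ≤ A) (hzm : z < m) (hx : s.reg x = N) (hz : s.reg z = v)
    (hN : N ≤ s.reg 3) : (digitT m x z).eval m A s = digits lab N v := by
  classical
  have h1 : (iter 0 (.var x)
      (.cond (andT (labT (m + 1) (m + 1)) (notT (leT (.var z) (.var (m + 1)))))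
        (quarterT (m + 2) m) (.var m))).eval m A s = N / 4 ^ Nat.count (IsRep lab) v := by
    have h2 := foldDiv_eq (IsRep lab) N v n
    rw [min_eq_right v.2.le] at h2
    rw [← h2]
    refine eval_iter hs.size hx fun i hi acc s' hrec e hacc hr => ?_
    rw [foldDiv_eq] at hrec
    have h3 : s'.reg m ≤ s'.reg 3 := by
      rw [hacc, hrec, e.reg 3 (by omega)]
      exact (Nat.div_le_self _ _).trans hN
    rw [eval, eval_andT (Q := ¬ (v : ℕ) ≤ i) (eval_repT (c.ext e (by omega)) hr hi)
      (eval_notT (by rw [eval_leT, eval, eval, (e.reg z hzm).trans hz, hr])),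
      eval_quarterT (by omega) h3, eval, ind_eq, hacc]
    exact if_congr (by simp) rfl rfl
  have h3 : N / 4 ^ Nat.count (IsRep lab) v ≤ s.reg 3 := (Nat.div_le_self _ _).trans hN
  rw [digitT, eval, eval_repT c hz v.2, eval.eq_7, h1, digits, digit, ind_eq]
  simp only [quadT, eval]
  rw [eval_quarterT (by omega) (by simpa [(show (3 : ℕ) ≠ m by omega)] using h3)]
  refine if_congr (by simp) ?_ rfl
  simp only [Store.setReg_reg, Function.update_self]
  omega

/-- Bind the table `A` to the guess whose number is in register `x`. -/
def digitTabT (m A x : ℕ) (b : Tm) : Tm :=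
  .tab 0 (digitT (m + 1) x m) (.get A (.var (m + 1))) b

theorem eval_digitTabT {N : ℕ} (hs : Input G s) (c : Holds s 2 fun v => lab v)
    (hm : 4 ≤ m) (hA : 3 ≤ A) (hxm : x < m) (hx : s.reg x = N) (hN : N ≤ s.reg 3) :
    ∃ s', Ext m A s s' ∧ Holds s' A (digits lab N) ∧
      (digitTabT m A x b).eval m A s = b.eval m (A + 2) s' := by
  obtain ⟨s', C, he, hev, hC, h0, h1⟩ := eval_tab (m := m) (A := A) (y := 0) (b := b)
    (t₀ := digitT (m + 1) x m) (t := .get A (.var (m + 1))) s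
  refine ⟨s', he, fun i => ?_, hev⟩
  rw [hs.size] at h0 h1
  -- The rounds of this table only copy the old entries.
  have h2 : ∀ j, C j i = C 0 i := by
    intro j
    induction j with
    | zero => rfl
    | succ j ih =>
      obtain ⟨s₁, -, hi, ha, hc⟩ := h1 j i i.2
      rw [hc, eval, eval, hi, ha, ih]
  rw [hC, h2]
  obtain ⟨s₁, e, hi, hc⟩ := h0 i i.2
  rw [hc]
  exact eval_digitT (hs.ext e (by omega) (by omega)) (c.ext e (by omega)) (by omega) (by omega)
    (by omega) ((e.reg x hxm).trans hx) hi (by rwa [e.reg 3 (by omega)])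

end Tm
end Tables

/-! ### The algorithm -/

section Algorithm

namespace Tm

/-- The test whether the vertex in `x` is not in `special G`. -/
def plainT (m x : ℕ) : Tm := notT (specialT m x)

/-- The number of guesses. -/
def boundT : Tm := minTabT plainT 3 2 (powT 3)

/-- Vertex integrity; register `3` holds the number of guesses. -/
def mainT : Tm :=
  minTabT plainT 4 2 (exT 0 4 (exT 3 6 (digitTabT 8 4 7 (minTabT keptT 8 6
    (andT (leT (.add (.add (costT 8) (.var 5)) (.var 2)) (.var 1))
      (allT 3 8 (digitTabT 10 8 9 (hallT 10))))))))

end Tm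

/-- Compute the number of guesses, then decide. -/
def algorithm : Prog :=
  .seq (Tm.boundT.comp 3 2 0) (.seq (.assign 3 (.get 1 (.const 0)))
    (.seq (Tm.mainT.comp 4 2 0) (.assign 0 (.get 1 (.const 0)))))

variable {n : ℕ} {G : SimpleGraph (Fin n)} {m : ℕ} {s : Store}

variable (G) in
/-- The labels of `G - special G`. -/
noncomputable abbrev pathLabel : Fin n → Fin n := minLabel G {v | v ∉ special G}

open Tm

theorem eval_plainTab (hs : Input G s) (hm : 1 ≤ m) (b : Tm) :
    ∃ s', Ext m 2 s s' ∧ Holds s' 2 (fun i => (pathLabel G i : ℕ)) ∧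
      (minTabT plainT m 2 b).eval m 2 s = b.eval m 4 s' :=
  eval_minTabT hs hm (by omega) fun _ _ _ _ e _ hx hi =>
    eval_notT (eval_specialT (hs.ext e hm (by omega)) (by omega) hx hi)

theorem eval_boundT (hs : Input G s) : boundT.eval 3 2 s = 4 ^ repCount (pathLabel G) := by
  obtain ⟨s', e, h, hev⟩ := eval_plainTab hs (m := 3) (by omega) (powT 3)
  rw [boundT, hev]
  exact eval_powT (hs.ext e (by omega) (by omega)) h (by omega)

variable (G) in
/-- Vertex integrity, in terms of guesses with numbers below `E`. -/
def Accepts (E k k' : ℕ) : Prop :=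
  ∃ l < n, ∃ N < E, guessCost (special G) (pathLabel G) l (digits (pathLabel G) N) + l + k' ≤ k ∧
    ∀ M < E, HallFor G (special G) (pathLabel G) l (digits (pathLabel G) N)
      (minLabel G (guessKept (special G) (pathLabel G) l (digits (pathLabel G) N)))
      (spanned (guessKept (special G) (pathLabel G) l (digits (pathLabel G) N))
        (minLabel G (guessKept (special G) (pathLabel G) l (digits (pathLabel G) N)))
        (digits (pathLabel G) M))

/-- Array 2 holds the labels of `G - special G`. Register 5 is `l`, register 7 the number `N` of the
guess `g` in array 4, array 6 holds the labels of the kept part, and register 9 is the number `M` of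
the guess `h` in array 8. Registers 4, 6 and 8 are the accumulators of the three searches. -/
theorem eval_mainT (hs : Input G s) :
    mainT.eval 4 2 s = ind (Accepts G (s.reg 3) (s.reg 1) (s.reg 2)) := by
  obtain ⟨s₁, e₁, h₁, hev₁⟩ := eval_plainTab hs (m := 4) (by omega) (exT 0 4 (exT 3 6 (digitTabT 8 4 7
    (minTabT keptT 8 6 (andT (leT (.add (.add (costT 8) (.var 5)) (.var 2)) (.var 1))
      (allT 3 8 (digitTabT 10 8 9 (hallT 10))))))))
  have hs₁ := hs.ext e₁ (by omega) (by omega)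
  rw [mainT, hev₁, Accepts, ← e₁.reg 1 (by omega), ← e₁.reg 2 (by omega), ← e₁.reg 3 (by omega)]
  clear hev₁ e₁ hs
  rw [eval_exT (p := fun l => ∃ N < s₁.reg 3, _) ?_, hs₁.size]
  intro l hl s₂ e₂ hl₂
  rw [hs₁.size] at hl
  have hs₂ := hs₁.ext e₂ (by omega) (by omega)
  have h₂ := h₁.ext e₂ (by omega)
  rw [← e₂.reg 1 (by omega), ← e₂.reg 2 (by omega), ← e₂.reg 3 (by omega)]
  clear e₂ h₁ hs₁
  refine eval_exT fun N hN s₃ e₃ hN₃ => ?_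
  rw [← e₃.reg 3 (by omega)] at hN
  have hl₃ := (e₃.reg 5 (by omega)).trans hl₂
  have hs₃ := hs₂.ext e₃ (by omega) (by omega)
  have h₃ := h₂.ext e₃ (by omega)
  rw [← e₃.reg 1 (by omega), ← e₃.reg 2 (by omega), ← e₃.reg 3 (by omega)]
  clear e₃ h₂ hs₂
  obtain ⟨s₄, e₄, hg, hev⟩ := eval_digitTabT (m := 8) (A := 4) (b := minTabT keptT 8 6
    (andT (leT (.add (.add (costT 8) (.var 5)) (.var 2)) (.var 1))
      (allT 3 8 (digitTabT 10 8 9 (hallT 10))))) hs₃ h₃ (by omega) (by omega) (by omega) hN₃ hN.le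
  rw [hev, ← e₄.reg 1 (by omega), ← e₄.reg 2 (by omega), ← e₄.reg 3 (by omega)]
  have c : Guessed G (pathLabel G) l (digits (pathLabel G) N) s₄ :=
    ⟨hs₃.ext e₄ (by omega) (by omega), h₃.ext e₄ (by omega), hl.le,
      (e₄.reg 5 (by omega)).trans hl₃, hg⟩
  clear e₄ hev hs₃ h₃ hg
  obtain ⟨s₅, e₅, h', hev⟩ := eval_minTabT (m := 8) (A := 6) (mask := keptT)
    (U := guessKept (special G) (pathLabel G) l (digits (pathLabel G) N)) (b :=
    (andT (leT (.add (.add (costT 8) (.var 5)) (.var 2)) (.var 1))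
      (allT 3 8 (digitTabT 10 8 9 (hallT 10))))) c.toInput (by omega) (by omega)
    fun s' m' x i e hm' hx hi => eval_keptT (c.ext e (by omega) (by omega)) (by omega) (by omega)
      hx hi
  rw [hev, ← e₅.reg 1 (by omega), ← e₅.reg 2 (by omega), ← e₅.reg 3 (by omega)]
  replace c := c.ext e₅ (by omega) (by omega)
  clear e₅ hev
  refine eval_andT ?_ (eval_allT fun M hM s₆ e₆ hM₆ => ?_)
  · rw [eval_leT, eval, eval, eval, eval, eval, eval_costT c (by omega) (by omega), c.num]
  rw [← e₆.reg 3 (by omega)] at hM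
  replace c := c.ext e₆ (by omega) (by omega)
  replace h' := h'.ext e₆ (by omega)
  obtain ⟨s₇, e₇, hh, hev⟩ := eval_digitTabT (m := 10) (A := 8) (b := hallT 10) c.toInput c.lab
    (by omega) (by omega) (by omega) hM₆ hM.le
  rw [hev]
  exact eval_hallT ⟨c.ext e₇ (by omega) (by omega), h'.ext e₇ (by omega), hh⟩ (by omega) (by omega)

/-- `k` and `k'` are the positive and the negative part of the bound. If `k' > 0`, then `k = 0` and
both sides fail; otherwise this is `vi_le_iff_guess`, with the guesses coded by digits. -/
theorem accepts_iff (hG : G.Connected) {k k' : ℕ} (hk : k = 0 ∨ k' = 0) :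
    Accepts G (4 ^ repCount (pathLabel G)) k k' ↔ vi G + k' ≤ k := by
  classical
  obtain ⟨v₀⟩ := hG.nonempty
  have hB : (special G).Nonempty := ⟨⟨0, v₀.pos⟩, mem_special.2 (.inr rfl)⟩
  have hdeg : ∀ v ∉ special G, ∃ x y, x ≠ y ∧ ∀ w, G.Adj v w ↔ w = x ∨ w = y := by
    intro v hv
    rw [mem_special] at hv
    push Not at hv
    obtain ⟨x, y, hxy, he⟩ := Set.ncard_eq_two.1 hv.1
    exact ⟨x, y, hxy, fun w => by rw [← SimpleGraph.mem_neighborSet, he]; simp⟩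
  have key := fun k => vi_le_iff_guess (k := k) hG hB hdeg (isLabel_minLabel (U := {v | v ∉ special G}))
    (lab' := fun l g => minLabel G (guessKept (special G) (pathLabel G) l g))
    (Γ := {g | ∃ N < 4 ^ repCount (pathLabel G), digits (pathLabel G) N = g})
    (fun _ _ _ => isLabel_minLabel) (by
      intro g hg hg0
      obtain ⟨N, hN, h⟩ := exists_digits (IsRep (pathLabel G))
        (fun v => if hv : v < n then g ⟨v, hv⟩ else 0) (fun v => by
          split_ifs; exacts [hg _, by omega]) n
      refine ⟨N, hN, funext fun v => ?_⟩
      rw [digits, digit]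
      split_ifs with hv
      · rw [h v v.2 hv]; simp
      · exact (hg0 v fun h' => hv ⟨v.2, h'⟩).symm)
  rcases Nat.eq_zero_or_pos k' with rfl | hk'
  · rw [add_zero, key k, Accepts]
    simp only [Fintype.card_fin, Set.mem_ofPred_eq, add_zero, exists_exists_and_eq_and,
      forall_exists_index, and_imp, forall_apply_eq_imp_iff₂]
  · obtain rfl : k = 0 := by omega
    refine iff_of_false ?_ (by omega)
    rintro ⟨l, -, N, -, h, -⟩
    omega

/-- The labels are the special vertices, each of which is its own label, and one label for each
path. -/
theorem repCount_le (hG : G.Connected) : repCount (pathLabel G) ≤ 20 * maxLeaf G + 3 := by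
  classical
  obtain ⟨v⟩ := hG.nonempty
  refine le_trans ?_ (card_special_le hG (B := special G) (v₀ := ⟨0, v.pos⟩)
    (lab := pathLabel G) ?_ (mem_special.2 (.inr rfl)) ?_ isLabel_minLabel)
  · rw [repCount, Nat.count_eq_card_filter_range, ← Finset.card_union_of_disjoint]
    · refine (Finset.card_le_card (t := (special G ∪
        pathLabels (special G) (pathLabel G)).map Fin.valEmbedding) ?_).trans_eq
        (Finset.card_map _)
      intro v hv
      obtain ⟨hv, h⟩ := (Finset.mem_filter.1 hv).2
      refine Finset.mem_map.2 ⟨⟨v, hv⟩, ?_, rfl⟩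
      by_cases hs : (⟨v, hv⟩ : Fin n) ∈ special G
      · exact Finset.mem_union_left _ hs
      · exact Finset.mem_union_right _ (by simp [pathLabels, hs, h])
    · refine Finset.disjoint_left.2 fun v hv h => ?_
      simp only [pathLabels, Finset.mem_filter] at h
      exact h.2.1 hv
  · intro v hv
    exact (mem_special.1 hv).imp_right fun h => Fin.ext h
  · intro v hv
    by_contra h
    exact hv (mem_special.2 (.inl h))

theorem input_inputStore (G : SimpleGraph (Fin n)) (k : ℤ) : Input G (inputStore G k) := by
  classical
  refine ⟨by simp [inputStore], fun i j => ?_⟩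
  rw [ind_eq]
  refine if_congr ⟨?_, fun h => ⟨rfl, i, j, rfl, h⟩⟩ rfl rfl
  rintro ⟨-, i', j', he, h⟩
  have hn : 0 < n := i.pos
  have h1 : (i : ℕ) = i' := by
    have := congrArg (· / n) he
    simpa [Nat.add_div_of_dvd_right, add_comm _ (j : ℕ), add_comm _ (j' : ℕ),
      Nat.add_mul_div_right _ _ hn, Nat.div_eq_of_lt] using this
  have h2 : (j : ℕ) = j' := by rw [h1] at he; omega
  rwa [Fin.ext h1, Fin.ext h2]

theorem clean_inputStore (G : SimpleGraph (Fin n)) (k : ℤ) : (inputStore G k).Clean := by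
  intro a ha i _
  simp [inputStore, (show a ≠ 0 by omega)]

/-- All loops are bounded by `n` or by the number `E` of guesses, which are both at most `n * E`.
The constants `K` and `D` come from two fixed terms and hence do not depend on the instance. -/
theorem exists_exec_algorithm : ∃ K D : ℕ, ∀ (n : ℕ) (G : SimpleGraph (Fin n)) (k : ℤ),
    G.Connected → DecidesWithin algorithm G k (K * (n * 4 ^ repCount (pathLabel G)) ^ D) := by
  obtain ⟨K₁, D₁, h₁⟩ := boundT.evaluates [0] (by simp) 3 2 0 [0] (by decide) le_rfl (by simp)
    (by simp)
  obtain ⟨K₂, D₂, h₂⟩ := mainT.evaluates [0, 3] (by simp) 4 2 0 [0] (by decide) le_rfl (by simp)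
    (by simp)
  refine ⟨K₁ + K₂ + 6, D₁ + D₂, fun n G k hG => ?_⟩
  obtain ⟨v₀⟩ := hG.nonempty
  have hn : 1 ≤ n := v₀.pos
  set E := 4 ^ repCount (pathLabel G) with hE
  have hE1 : 1 ≤ E := Nat.one_le_pow _ _ (by omega)
  set Q := n * E with hQ
  have hnQ : n ≤ Q := Nat.le_mul_of_pos_right _ hE1
  have hEQ : E ≤ Q := Nat.le_mul_of_pos_left _ hn
  have hs := input_inputStore G k
  obtain ⟨t₁, s₁, hx₁, ht₁, hk₁, hv₁⟩ := h₁ Q (inputStore G k) (hn.trans hnQ)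
    (by simpa [hs.size] using hnQ) (clean_inputStore G k)
  rw [eval_boundT hs, ← hE] at hv₁
  have hr₁ : ∀ x < 3, (s₁.setReg 3 E).reg x = (inputStore G k).reg x := fun x hx => by
    simpa [hx.ne] using hk₁.reg x hx
  have hs₁ : Input G (s₁.setReg 3 E) := ⟨(hr₁ 0 (by omega)).trans hs.size, fun i j => by
    rw [Store.setReg_arr, hk₁.arr 0 (by omega) (by omega)]; exact hs.adj i j⟩
  have hc₁ : (s₁.setReg 3 E).Clean := by
    simpa [Store.Clean] using hk₁.clean' (by omega) (clean_inputStore G k)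
  obtain ⟨t₂, s₂, hx₂, ht₂, -, hv₂⟩ := h₂ Q (s₁.setReg 3 E) (hn.trans hnQ)
    (by
      intro y hy
      obtain rfl | rfl : y = 0 ∨ y = 3 := by simpa using hy
      · rw [hs₁.size]; exact hnQ
      · simpa using hEQ) hc₁
  rw [eval_mainT hs₁, hr₁ 1 (by omega), hr₁ 2 (by omega),
    show (s₁.setReg 3 E).reg 3 = E by simp] at hv₂
  rw [← hv₁] at hx₂
  refine ⟨_, _, .seq hx₁ (.seq (.assign _ _ _) (.seq hx₂ (.assign _ _ _))), ?_, ?_⟩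
  · simp only [Expr.cost]
    have h1 : 1 ≤ Q ^ (D₁ + D₂) := Nat.one_le_pow _ _ (by omega)
    have h2 := mul_pow_mono (hn.trans hnQ) ht₁ (Nat.le_add_right D₁ D₂)
    have h3 := mul_pow_mono (hn.trans hnQ) ht₂ (Nat.le_add_left D₂ D₁)
    rw [add_mul, add_mul]
    omega
  · have h1 : (inputStore G k).reg 1 = k.toNat := by simp [inputStore]
    have h2 : (inputStore G k).reg 2 = (-k).toNat := by simp [inputStore]
    simp only [Store.setReg_reg, Function.update_self, Expr.eval]
    rw [hv₂, hE, ind_congr (accepts_iff hG (by omega)), ind_eq, h1, h2]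
    exact if_congr (by omega) rfl rfl

end Algorithm
end VertexIntegrity

theorem mainTheorem3 :
    ∃ (p : VertexIntegrity.Prog) (C c d : ℕ),
      ∀ (n : ℕ) (G : SimpleGraph (Fin n)) (k : ℤ), G.Connected →
        VertexIntegrity.DecidesWithin p G k
          (C * 2 ^ (c * VertexIntegrity.maxLeaf G) * n ^ d) := by
  obtain ⟨K, D, h⟩ := VertexIntegrity.exists_exec_algorithm
  -- The constants come from `4 ^ (20 * ml + 3) = 64 * 2 ^ (40 * ml)`, raised to the power `D`.
  refine ⟨VertexIntegrity.algorithm, K * 64 ^ D, 40 * D, D, fun n G k hG => ?_⟩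
  obtain ⟨t, s, hx, ht, hs⟩ := h n G k hG
  refine ⟨t, s, hx, ht.trans ?_, hs⟩
  calc _ ≤ K * (n * 4 ^ (20 * VertexIntegrity.maxLeaf G + 3)) ^ D := by
        gcongr
        · norm_num
        · exact VertexIntegrity.repCount_le hG
    _ = _ := by
        rw [mul_pow, pow_add, mul_pow, show (4 : ℕ) = 2 ^ 2 by norm_num, ← pow_mul, ← pow_mul,
          show 2 * (20 * VertexIntegrity.maxLeaf G * D) = 40 * D * VertexIntegrity.maxLeaf G by ring]
        norm_num
        ring
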